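/- **Setting.** Let $1\le p\le\infty$, let $\mathbf x$ be a random data vector with coordinates indexed by $i<p$ (finite or countably infinite dimension), $y$ a real label, and $\mathbf S$ a fixed $M\times p$ sketch matrix. Let $\mathcal Q_d,\mathcal Q_s,\mathcal Q_f,\mathcal Q_l,\mathcal Q_p,\mathcal Q_a,\mathcal Q_o$ be independent random quantization operations (for data, sketch, feature, label, parameter, activation, output gradient), each unbiased, $\mathbb E[\mathcal Q_i(\mathbf u)\mid\mathbf u]=\mathbf u$ for every $\mathbf u$, and each using fresh randomness whenever it is applied. Put $\tilde{\mathbf x}^{(q)}=\mathcal Q_f(\mathcal Q_s(\mathbf S)\mathcal Q_d(\mathbf x))$ (where, if $p=\infty$, the series defining $\mathcal Q_s(\mathbf S)\mathcal Q_d(\mathbf x)$ are assumed to converge almost surely) and $\mathbf H=\mathbf H_f^{(q)}=\mathbb E[\tilde{\mathbf x}^{(q)}(\tilde{\mathbf x}^{(q)})^\top]$. Quantized SGD with stepsize $\gamma>0$ on i.i.d. samples $(\mathbf x_t,y_t)$ is $\mathbf v_0=0$ and $$\mathbf v_t=\mathbf v_{t-1}+\gamma\,\mathcal Q_o(o_t)\,\tilde{\mathbf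 x}^{(q)}_t,\qquad a_t=(\tilde{\mathbf x}_t^{(q)})^\top\mathcal Q_p(\mathbf v_{t-1}),\qquad o_t=\mathcal Q_l(y_t)-\mathcal Q_a(a_t),\qquad t=1,\dots,N,$$ and $\overline{\mathbf v}_N=\frac1N\sum_{t=0}^{N-1}\mathbf v_t$. Quantization errors are $\boldsymbol\epsilon^{(p)}_{t-1}=\mathcal Q_p(\mathbf v_{t-1})-\mathbf v_{t-1}$, $\epsilon^{(a)}_t=\mathcal Q_a(a_t)-a_t$, $\epsilon_t^{(o)}=\mathcal Q_o(o_t)-o_t$. Let $\mathbf v^*=\mathbf v^{(q)*}$ be a minimizer of $\frac12\mathbb E[(\langle\tilde{\mathbf x}^{(q)},\mathbf v\rangle-\mathcal Q_l(y))^2]$ (with $\mathcal Q_l(y)$ square integrable), $\xi=\mathcal Q_l(y)-\langle\mathbf v^*,\tilde{\mathbf x}^{(q)}\rangle$, $\boldsymbol\eta=\overline{\mathbf v}_N-\mathbf v^*$, and $$R_N^{(0)}=\tfrac12\big\langle\mathbf H,\mathbb E[\boldsymbol\eta\boldsymbol\eta^\top]\big\rangle .$$ **Assumptions.** (i) $\tilde{\mathbf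 x}^{(q)}$ has finite fourth moments, and there are $\alpha,\beta>0$ such that for every PSD $\mathbf A$ $$\mathbf H\mathbf A\mathbf H+\beta\,\mathrm{tr}(\mathbf H\mathbf A)\mathbf H\preceq\mathbb E[\tilde{\mathbf x}^{(q)}(\tilde{\mathbf x}^{(q)})^\top\mathbf A\tilde{\mathbf x}^{(q)}(\tilde{\mathbf x}^{(q)})^\top]\preceq\alpha\,\mathrm{tr}(\mathbf H\mathbf A)\mathbf H;$$ (ii) there are $\underline\sigma,\overline\sigma>0$ with $\underline\sigma^2\mathbf H\preceq\mathbb E[\xi^2\tilde{\mathbf x}^{(q)}(\tilde{\mathbf x}^{(q)})^\top]\preceq\overline\sigma^2\mathbf H$; (iii) $\mathbb E[\xi\mid\tilde{\mathbf x}^{(q)}]=0$. Let $\mathbf H=\sum_{i=1}^M\tilde\lambda_i\mathbf v_i\mathbf v_i^\top$ be an eigendecomposition with $\tilde\lambda_1\ge\dots\ge\tilde\lambda_M$ and orthonormal $\mathbf v_i$; write $\mathbf H_{0:k}=\sum_{i\le k}\tilde\lambda_i\mathbf v_i\mathbf v_i^\top$, $\mathbf H_{k:\infty}=\sum_{i>k}\tilde\lambda_i\mathbf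 v_i\mathbf v_i^\top$, $\mathbf I_{0:k}=\sum_{i\le k}\mathbf v_i\mathbf v_i^\top$, let $(\mathbf H_{0:k})^{-1}=\sum_{i\le k}\tilde\lambda_i^{-1}\mathbf v_i\mathbf v_i^\top$, and $\|\mathbf v\|_{\mathbf A}^2=\mathbf v^\top\mathbf A\mathbf v$. Suppose $\gamma<1/\tilde\lambda_1$ and $N>500$, and put $k^*=\max\{i:\tilde\lambda_i\ge 1/(\gamma N)\}$ (with $k^*=0$ if there is no such $i$), $$\frac{d_{\rm eff}}N=\frac{k^*}N+N\gamma^2\sum_{i>k^*}\tilde\lambda_i^2,\qquad B=\frac1{100\gamma^2N^2}\Big(\|\mathbf v^*\|^2_{(\mathbf H_{0:k^*})^{-1}}+N^2\gamma^2\|\mathbf v^*\|^2_{\mathbf H_{k^*:\infty}}\Big),\qquad \sigma_{\rm bias}^2=\frac1{N\gamma}\|\mathbf v^*\|^2_{\mathbf I_{0:k^*}}+\|\mathbf v^*\|^2_{\mathbf H_{k^*:\infty}}.$$ **(General quantization.)** If $\mathbf v_t$ and $\mathcal Q_p(\mathbf v_t)$ have finite second moments for all $t<N$, then $$R_N^{(0)}\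 \ge\ B+\Big(\frac{\beta}{1000}\,\sigma_{\rm bias}^2+\frac{\underline\sigma_G^2}{50}\Big)\frac{d_{\rm eff}}N,$$ $$\underline\sigma_G^2=\underline\sigma^2+\inf_{1\le t\le N}\beta\,\mathrm{tr}\big(\mathbf H\,\mathbb E[\boldsymbol\epsilon_{t-1}^{(p)}{\boldsymbol\epsilon_{t-1}^{(p)}}^{\top}]\big)+\inf_{1\le t\le N}\operatorname{ess\,inf}\Big(\mathbb E[(\epsilon_t^{(a)})^2\mid a_t]+\mathbb E[(\epsilon_t^{(o)})^2\mid o_t]\Big).$$ **(Multiplicative quantization.)** Suppose that for $i\in\{p,a,o\}$ there are $\underline\epsilon_i\ge0$ and $\overline\epsilon_i$ such that $\mathcal Q_i$ is multiplicative: $\mathcal Q_i(\mathbf u)$ has finite second moments and $\underline\epsilon_i\mathbf u\mathbf u^\top\preceq\mathbb E[(\mathcal Q_i(\mathbf u)-\mathbf u)(\mathcal Q_i(\mathbf u)-\mathbf u)^\top\mid\mathbf u]\preceq\overline\epsilon_i\mathbf u\mathbf u^\top$ for every $\mathbf u$. Then $$R_N^{(0)}\ \ge\ B+\Big(\frac{(1+\underline\epsilon_o)\underline\sigma^2}{50}+\beta(1+\underline\epsilon_o)\big(\underline\epsilon_p+(1+\underline\epsilon_p)\underline\epsilon_a\big)P_{\rm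 eff}+\frac\beta{1000}\,\sigma_{\rm bias}^2\Big)\frac{d_{\rm eff}}N,$$ $$P_{\rm eff}=\frac1{2500}\Big(\|\mathbf v^*\|^2_{\mathbf H_{0:k^*}}+N^2\gamma^2\|\mathbf v^*\|^2_{(\mathbf H_{k^*:\infty})^3}\Big)+\frac{\gamma\beta}{600}\Big(\|\mathbf v^*\|^2_{\mathbf I_{0:k^*}}+N\gamma\|\mathbf v^*\|^2_{\mathbf H_{k^*:\infty}}\Big)\sum_i\tilde\lambda_i^2(1-\gamma\tilde\lambda_i)^{2N}.$$ -/

import Mathlib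

open MeasureTheory ProbabilityTheory Filter Topology
open scoped Matrix MatrixOrder

namespace QuantSGD

/-- Coordinates of the data space `ℍ ⊆ ℝ^p`: finite-dimensional for `p < ⊤`, and countably
infinite-dimensional for `p = ⊤`. -/
abbrev Coord (p : ℕ∞) : Type := {i : ℕ // (i : ℕ∞) < p}

/-- An unbiased (stochastic) quantization operation on real arrays indexed by `J`.
`toFun θ u` is the quantized value of `u` when the rounding randomness is the seed `θ ∼ ν`, so that
a conditional expectation given the input is an integral over the seed. -/
structure Quantizer {Θ : Type*} [MeasurableSpace Θ] (ν : Measure Θ) (J : Type*) where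
  toFun : Θ → (J → ℝ) → (J → ℝ)
  measurable_toFun : Measurable (Function.uncurry toFun)
  integrable : ∀ (u : J → ℝ) (j : J), Integrable (fun θ => toFun θ u j) ν
  unbiased : ∀ (u : J → ℝ) (j : J), ∫ θ, toFun θ u j ∂ν = u j

namespace Quantizer

variable {Θ : Type*} [MeasurableSpace Θ] {ν : Measure Θ} {J : Type*}

/-- Action of a quantizer of scalars. -/
def scalar (Q : Quantizer ν Unit) (θ : Θ) (a : ℝ) : ℝ := Q.toFun θ (fun _ => a) ()

/-- `E[(Q(u) - u)(Q(u) - u)ᵀ | u]`. -/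
noncomputable def errMoment (Q : Quantizer ν J) (u : J → ℝ) : Matrix J J ℝ :=
  Matrix.of fun i j => ∫ θ, (Q.toFun θ u i - u i) * (Q.toFun θ u j - u j) ∂ν

/-- `E[(Q(a) - a)² | a]` for a scalar `a`. -/
noncomputable def errVar (Q : Quantizer ν Unit) (a : ℝ) : ℝ :=
  ∫ θ, (Q.scalar θ a - a) ^ 2 ∂ν

/-- `(lo, hi)`-multiplicative quantization (in the Loewner order):
`lo · u uᵀ ⪯ E[(Q(u) - u)(Q(u) - u)ᵀ | u] ⪯ hi · u uᵀ`. -/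
def IsMultiplicative (Q : Quantizer ν J) (lo hi : ℝ) : Prop :=
  ∀ u : J → ℝ,
    (∀ j, MemLp (fun θ => Q.toFun θ u j) 2 ν) ∧
    lo • Matrix.vecMulVec u u ≤ Q.errMoment u ∧
    Q.errMoment u ≤ hi • Matrix.vecMulVec u u

end Quantizer

/-- The quantizers for data, sketch matrix, feature, label, parameter, activation and output
gradient. -/
structure Scheme (p : ℕ∞) (M : ℕ) {Θ : Type*} [MeasurableSpace Θ] (ν : Measure Θ) where
  Qd : Quantizer ν (Coord p)
  Qs : Quantizer ν (Fin M × Coord p)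
  Qf : Quantizer ν (Fin M)
  Ql : Quantizer ν Unit
  Qp : Quantizer ν (Fin M)
  Qa : Quantizer ν Unit
  Qo : Quantizer ν Unit

section Model

variable {p : ℕ∞} {M : ℕ}

/-- Partial sums of the `m`-th coordinate of the product `S x`. -/
noncomputable def sketchPartial (S : Fin M × Coord p → ℝ) (x : Coord p → ℝ) (m : Fin M) (n : ℕ) :
    ℝ :=
  ∑ i ∈ Finset.range n, if h : (i : ℕ∞) < p then S (m, ⟨i, h⟩) * x ⟨i, h⟩ else 0

/-- The product `S x` of a sketch matrix and a data vector (a convergent series if `p = ⊤`). -/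
noncomputable def sketchMul (S : Fin M × Coord p → ℝ) (x : Coord p → ℝ) : Fin M → ℝ :=
  fun m => limUnder atTop (sketchPartial S x m)

variable {Θ : Type*} [MeasurableSpace Θ] {ν : Measure Θ}

/-- The randomness of one SGD step: a sample `(x, y)` and one seed for each of the seven
quantizers, in the order data, sketch, feature, label, parameter, activation, output gradient. -/
abbrev Round (p : ℕ∞) (Θ : Type*) : Type _ := ((Coord p → ℝ) × ℝ) × (Fin 7 → Θ)

/-- The law of one round: the sample has law `ρ`, the seeds are i.i.d. of law `ν` and independent
of the sample. -/
noncomputable def roundLaw (ρ : Measure ((Coord p → ℝ) × ℝ)) (ν : Measure Θ) :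
    Measure (Round p Θ) :=
  ρ.prod (Measure.pi fun _ => ν)

variable (q : Scheme p M ν) (S : Fin M × Coord p → ℝ)

/-- The quantized feature `Q_f(Q_s(S) Q_d(x))`. -/
noncomputable def feature (z : Round p Θ) : Fin M → ℝ :=
  q.Qf.toFun (z.2 2) (sketchMul (q.Qs.toFun (z.2 1) S) (q.Qd.toFun (z.2 0) z.1.1))

/-- The quantized label `Q_l(y)`. -/
def label (z : Round p Θ) : ℝ := q.Ql.scalar (z.2 3) z.1.2

/-- The quantized parameter `Q_p(v)`. -/
def qparam (v : Fin M → ℝ) (z : Round p Θ) : Fin M → ℝ := q.Qp.toFun (z.2 4) v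

/-- `a = ⟨feature, Q_p(v)⟩`, the activation before quantization. -/
noncomputable def preact (v : Fin M → ℝ) (z : Round p Θ) : ℝ := feature q S z ⬝ᵥ qparam q v z

/-- `o = Q_l(y) - Q_a(a)`, the output gradient before quantization. -/
noncomputable def outGrad (v : Fin M → ℝ) (z : Round p Θ) : ℝ :=
  label q z - q.Qa.scalar (z.2 5) (preact q S v z)

/-- One step of quantized SGD with stepsize `γ`. -/
noncomputable def step (γ : ℝ) (v : Fin M → ℝ) (z : Round p Θ) : Fin M → ℝ :=
  v + (γ * q.Qo.scalar (z.2 6) (outGrad q S v z)) • feature q S z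

/-- The iterates `v_t`, with `v_0 = 0`; the step from `v_t` to `v_{t+1}` uses the round `Z t`. -/
noncomputable def iterate {Ω : Type*} (γ : ℝ) (Z : ℕ → Ω → Round p Θ) : ℕ → Ω → (Fin M → ℝ)
  | 0, _ => 0
  | t + 1, ω => step q S γ (iterate γ Z t ω) (Z t ω)

/-- The averaged iterate `(1/N) ∑_{t < N} v_t`. -/
noncomputable def average {Ω : Type*} (γ : ℝ) (Z : ℕ → Ω → Round p Θ) (N : ℕ) (ω : Ω) :
    Fin M → ℝ :=
  (1 / (N : ℝ)) • ∑ t ∈ Finset.range N, iterate q S γ Z t ω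

/-- The rounds `Z 0, Z 1, …` are independent with common law `roundLaw ρ ν`. -/
structure IsSampling {Ω : Type*} [MeasurableSpace Ω] (P : Measure Ω)
    (ρ : Measure ((Coord p → ℝ) × ℝ)) (ν : Measure Θ) (Z : ℕ → Ω → Round p Θ) : Prop where
  measurable : ∀ t, Measurable (Z t)
  law : ∀ t, P.map (Z t) = roundLaw ρ ν
  indep : iIndepFun Z P

variable (ρ : Measure ((Coord p → ℝ) × ℝ))

/-- The series that define `Q_s(S) Q_d(x)` converge almost surely (automatic if `p < ⊤`). -/
def SketchConverges : Prop :=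
  ∀ᵐ z ∂(roundLaw ρ ν), ∀ m : Fin M, ∃ l : ℝ,
    Tendsto (sketchPartial (q.Qs.toFun (z.2 1) S) (q.Qd.toFun (z.2 0) z.1.1) m) atTop (𝓝 l)

/-- The quantized feature covariance `H_f = E[x̃ x̃ᵀ]`. -/
noncomputable def Hf : Matrix (Fin M) (Fin M) ℝ :=
  Matrix.of fun i j => ∫ z, feature q S z i * feature q S z j ∂(roundLaw ρ ν)

/-- `E[x̃ x̃ᵀ A x̃ x̃ᵀ]`. -/
noncomputable def fourthMoment (A : Matrix (Fin M) (Fin M) ℝ) : Matrix (Fin M) (Fin M) ℝ :=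
  Matrix.of fun i j =>
    ∫ z, (feature q S z ⬝ᵥ A *ᵥ feature q S z) * (feature q S z i * feature q S z j)
      ∂(roundLaw ρ ν)

/-- Fourth-moment condition with constants `α, β`. -/
structure FourthMomentCondition (α β : ℝ) : Prop where
  pos_alpha : 0 < α
  pos_beta : 0 < β
  finite : ∀ i, MemLp (fun z => feature q S z i) 4 (roundLaw ρ ν)
  lower : ∀ A : Matrix (Fin M) (Fin M) ℝ, A.PosSemidef →
    Hf q S ρ * A * Hf q S ρ + (β * (Hf q S ρ * A).trace) • Hf q S ρ ≤ fourthMoment q S ρ A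
  upper : ∀ A : Matrix (Fin M) (Fin M) ℝ, A.PosSemidef →
    fourthMoment q S ρ A ≤ (α * (Hf q S ρ * A).trace) • Hf q S ρ

/-- The population risk in the quantized feature space. -/
noncomputable def quantRisk (v : Fin M → ℝ) : ℝ :=
  1 / 2 * ∫ z, (feature q S z ⬝ᵥ v - label q z) ^ 2 ∂(roundLaw ρ ν)

/-- `vstar` is a global minimizer of the (finite) quantized population risk. -/
structure IsQuantOptimum (vstar : Fin M → ℝ) : Prop where
  feature_sq : ∀ i, MemLp (fun z => feature q S z i) 2 (roundLaw ρ ν)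
  label_sq : MemLp (fun z => label q z) 2 (roundLaw ρ ν)
  isMin : ∀ v, quantRisk q S ρ vstar ≤ quantRisk q S ρ v

/-- The noise `ξ = Q_l(y) - ⟨vstar, x̃⟩`. -/
noncomputable def xi (vstar : Fin M → ℝ) (z : Round p Θ) : ℝ :=
  label q z - vstar ⬝ᵥ feature q S z

/-- `E[ξ² x̃ x̃ᵀ]`. -/
noncomputable def noiseMoment (vstar : Fin M → ℝ) : Matrix (Fin M) (Fin M) ℝ :=
  Matrix.of fun i j =>
    ∫ z, xi q S vstar z ^ 2 * (feature q S z i * feature q S z j) ∂(roundLaw ρ ν)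

/-- Noise condition `σlo² H_f ⪯ E[ξ² x̃ x̃ᵀ] ⪯ σhi² H_f`. -/
structure NoiseCondition (vstar : Fin M → ℝ) (σlo σhi : ℝ) : Prop where
  pos_lo : 0 < σlo
  pos_hi : 0 < σhi
  finite : ∀ i j, Integrable
    (fun z => xi q S vstar z ^ 2 * (feature q S z i * feature q S z j)) (roundLaw ρ ν)
  lower : σlo ^ 2 • Hf q S ρ ≤ noiseMoment q S ρ vstar
  upper : noiseMoment q S ρ vstar ≤ σhi ^ 2 • Hf q S ρ

/-- Well-specified low-precision model: `E[ξ | x̃] = 0`. -/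
def WellSpecified (vstar : Fin M → ℝ) : Prop :=
  (roundLaw ρ ν)[xi q S vstar | MeasurableSpace.comap (feature q S) inferInstance]
    =ᵐ[roundLaw ρ ν] 0

section Run

variable {Ω : Type*} [MeasurableSpace Ω] (P : Measure Ω) (γ : ℝ) (Z : ℕ → Ω → Round p Θ)

/-- `R_N^{(0)} = ½ ⟨H_f, E[(v̄_N - vstar) (v̄_N - vstar)ᵀ]⟩`. -/
noncomputable def RN0 (vstar : Fin M → ℝ) (N : ℕ) : ℝ :=
  1 / 2 * ((Hf q S ρ)ᵀ * Matrix.of fun i j : Fin M =>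
    ∫ ω, (average q S γ Z N ω i - vstar i) * (average q S γ Z N ω j - vstar j) ∂P).trace

/-- `E[ε εᵀ]` for the parameter quantization error `ε = Q_p(v_t) - v_t` in the step that leads from
`v_t` to `v_{t+1}`. -/
noncomputable def paramErrMoment (t : ℕ) : Matrix (Fin M) (Fin M) ℝ :=
  Matrix.of fun i j =>
    ∫ ω, (qparam q (iterate q S γ Z t ω) (Z t ω) i - iterate q S γ Z t ω i) *
      (qparam q (iterate q S γ Z t ω) (Z t ω) j - iterate q S γ Z t ω j) ∂P

/-- `E[(ε^{(a)})² | a] + E[(ε^{(o)})² | o]` in the step that leads from `v_t` to `v_{t+1}`, as a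
random variable. -/
noncomputable def actOutErr (t : ℕ) (ω : Ω) : ℝ :=
  q.Qa.errVar (preact q S (iterate q S γ Z t ω) (Z t ω)) +
    q.Qo.errVar (outGrad q S (iterate q S γ Z t ω) (Z t ω))

/-- The effective noise level `σ_G²` of general quantization. The infima run over the `N` steps;
the conditional variances are random, and their infimum is the essential one. -/
noncomputable def sigmaG2 (β σlo : ℝ) (N : ℕ) : ℝ :=
  σlo ^ 2 + (⨅ t : Fin N, β * (Hf q S ρ * paramErrMoment q S P γ Z t).trace) +
    ⨅ t : Fin N, essInf (actOutErr q S γ Z t) P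

/-- All iterates `v_t` and quantized iterates `Q_p(v_t)`, `t < N`, have finite second moments. -/
def FiniteSecondMoments (N : ℕ) : Prop :=
  ∀ t < N, ∀ i,
    MemLp (fun ω => iterate q S γ Z t ω i) 2 P ∧
    MemLp (fun ω => qparam q (iterate q S γ Z t ω) (Z t ω) i) 2 P

end Run

end Model

section Spectrum

variable {M : ℕ}

/-- `H = ∑ i, lam i • u_i u_iᵀ` with orthonormal `u_i` and non-increasing `lam`. The index `i` here
is `i + 1` in the usual numbering `lam_1 ≥ lam_2 ≥ …`. -/
structure IsEigenDecomposition (H : Matrix (Fin M) (Fin M) ℝ) (lam : Fin M → ℝ)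
    (u : Fin M → (Fin M → ℝ)) : Prop where
  antitone : Antitone lam
  orthonormal : ∀ i j, u i ⬝ᵥ u j = if i = j then 1 else 0
  decomp : H = ∑ i, lam i • Matrix.vecMulVec (u i) (u i)

/-- `‖v‖²_A = vᵀ A v`. -/
def sqNorm (A : Matrix (Fin M) (Fin M) ℝ) (v : Fin M → ℝ) : ℝ := v ⬝ᵥ A *ᵥ v

variable (lam : Fin M → ℝ) (u : Fin M → (Fin M → ℝ))

/-- `H_{0:k}`, the part of the first `k` eigenvalues. -/
noncomputable def headMat (k : ℕ) : Matrix (Fin M) (Fin M) ℝ :=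
  ∑ i ∈ Finset.univ.filter (fun i : Fin M => i.val < k), lam i • Matrix.vecMulVec (u i) (u i)

/-- `(H_{0:k})⁻¹`, the inverse on the span of the first `k` eigenvectors, extended by zero. -/
noncomputable def headInv (k : ℕ) : Matrix (Fin M) (Fin M) ℝ :=
  ∑ i ∈ Finset.univ.filter (fun i : Fin M => i.val < k), (lam i)⁻¹ • Matrix.vecMulVec (u i) (u i)

/-- `I_{0:k}`, the orthogonal projection on the span of the first `k` eigenvectors. -/
noncomputable def headId (k : ℕ) : Matrix (Fin M) (Fin M) ℝ :=
  ∑ i ∈ Finset.univ.filter (fun i : Fin M => i.val < k), Matrix.vecMulVec (u i) (u i)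

/-- `H_{k:∞}`, the part of the eigenvalues after the first `k`. -/
noncomputable def tailMat (k : ℕ) : Matrix (Fin M) (Fin M) ℝ :=
  ∑ i ∈ Finset.univ.filter (fun i : Fin M => k ≤ i.val), lam i • Matrix.vecMulVec (u i) (u i)

/-- `k* = max {k : lam_k ≥ 1 / (γ N)}`, and `0` if there is no such `k`. -/
noncomputable def kStar (γ : ℝ) (N : ℕ) : ℕ :=
  (Finset.univ.filter fun i : Fin M => 1 / (γ * N) ≤ lam i).sup fun i => (i : ℕ) + 1

/-- `d_eff = k* + N² γ² ∑_{i > k*} lam_i²`. -/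
noncomputable def dEff (γ : ℝ) (N : ℕ) : ℝ :=
  kStar lam γ N + (N : ℝ) ^ 2 * γ ^ 2 *
    ∑ i ∈ Finset.univ.filter (fun i : Fin M => kStar lam γ N ≤ i.val), lam i ^ 2

/-- Lower bound on the bias error. -/
noncomputable def biasLB (γ : ℝ) (N : ℕ) (v : Fin M → ℝ) : ℝ :=
  1 / (100 * γ ^ 2 * (N : ℝ) ^ 2) *
    (sqNorm (headInv lam u (kStar lam γ N)) v +
      (N : ℝ) ^ 2 * γ ^ 2 * sqNorm (tailMat lam u (kStar lam γ N)) v)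

/-- `(1/(Nγ)) ‖v‖²_{I_{0:k*}} + ‖v‖²_{H_{k*:∞}}`. -/
noncomputable def sigmaBias2 (γ : ℝ) (N : ℕ) (v : Fin M → ℝ) : ℝ :=
  1 / (N * γ) * sqNorm (headId u (kStar lam γ N)) v + sqNorm (tailMat lam u (kStar lam γ N)) v

/-- The signal-dependent noise level under multiplicative quantization. -/
noncomputable def pEff (γ β : ℝ) (N : ℕ) (v : Fin M → ℝ) : ℝ :=
  1 / 2500 * (sqNorm (headMat lam u (kStar lam γ N)) v +
      (N : ℝ) ^ 2 * γ ^ 2 * sqNorm (tailMat lam u (kStar lam γ N) ^ 3) v) +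
    γ * β / 600 * (sqNorm (headId u (kStar lam γ N)) v +
      N * γ * sqNorm (tailMat lam u (kStar lam γ N)) v) *
      ∑ i, lam i ^ 2 * (1 - γ * lam i) ^ (2 * N)

end Spectrum

section Measurability

variable {p : ℕ∞} {M : ℕ} {Θ : Type*} [MeasurableSpace Θ] {ν : Measure Θ}

/-- The quantized feature is measurable, so that conditioning on it is meaningful. -/
theorem measurable_feature (q : Scheme p M ν) (S : Fin M × Coord p → ℝ) :
    Measurable (feature q S) := by
  have hz (i : Fin 7) : Measurable fun z : Round p Θ => z.2 i :=
    (measurable_pi_apply i).comp measurable_snd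
  have hs : Measurable fun z : Round p Θ => q.Qs.toFun (z.2 1) S :=
    q.Qs.measurable_toFun.comp ((hz 1).prodMk measurable_const)
  have hd : Measurable fun z : Round p Θ => q.Qd.toFun (z.2 0) z.1.1 :=
    q.Qd.measurable_toFun.comp ((hz 0).prodMk (measurable_fst.comp measurable_fst))
  have hpart (m : Fin M) (n : ℕ) : StronglyMeasurable fun z : Round p Θ =>
      sketchPartial (q.Qs.toFun (z.2 1) S) (q.Qd.toFun (z.2 0) z.1.1) m n := by
    refine Measurable.stronglyMeasurable ?_
    unfold sketchPartial
    refine Finset.measurable_sum _ fun i _ => ?_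
    by_cases h : (i : ℕ∞) < p
    · simp only [h, dif_pos]
      exact (measurable_pi_iff.1 hs (m, ⟨i, h⟩)).mul (measurable_pi_iff.1 hd ⟨i, h⟩)
    · simp only [h, dif_neg, not_false_eq_true]
      exact measurable_const
  have hm : Measurable fun z : Round p Θ =>
      sketchMul (q.Qs.toFun (z.2 1) S) (q.Qd.toFun (z.2 0) z.1.1) := by
    refine measurable_pi_iff.2 fun m => ?_
    exact (StronglyMeasurable.limUnder (hpart m)).measurable
  exact q.Qf.measurable_toFun.comp ((hz 2).prodMk hm)

end Measurability

end QuantSGD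

/-! Work in the eigenbasis of H. Put η_t = v_t - v*, w_i = ⟨u_i, v*⟩, δ_i = γ λ_i and c_t(i) =
E⟨u_i, η_t⟩² (`errSq`).

Averaging over the output, activation and parameter seeds, in this order, replaces each quantizer by
its input and leaves an error orthogonal to the rest (`quantizer_split`). Together with E[ξ | x̃] =
0 this makes the conditional mean of a step linear: any function of v_s paired with ⟨u_i, η_t⟩, s ≤
t, shrinks by the factor 1 - δ_i per step (`integral_cross`). So the correlations E⟨u_i, η_s⟩⟨u_i,
η_t⟩ are nonnegative, half of the double sum behind the averaged risk may be dropped, and geometric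
sums remain: R_N ≥ (2γN²)⁻¹ ∑_i ∑_s c_s(i) (1 - (1 - δ_i)^(N - s)) (`RN0_ge`).

For the second moments, the lower fourth-moment condition at A = f fᵀ, with f independent of x̃,
bounds E[⟨u_i, x̃⟩²⟨x̃, f⟩²] below by λ_i² E⟨u_i, f⟩² + β λ_i E[fᵀHf]. At f = η_t the first term
completes 1 - 2δ_i to (1 - δ_i)², so c_{t+1}(i) ≥ (1 - δ_i)² c_t(i) + γ² λ_i D_t with D_t = β ∑_j
λ_j c_t(j) + F_t (`errSq_succ_ge`, `errSq_succ_ge_of_isMultiplicative`). Here F_t is σ_G² for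
general quantization; for multiplicative quantization it is (1 + ε_o)σ² plus a multiple of E[v_tᵀ H
v_t].

Unrolling this inequality inside the risk bound, each injection of noise is multiplied by an
explicit kernel (`weighted_sum_ge`), and δ · kern(1 - δ, n) ≥ μ² n(n+1)/(8N²) with μ = min(1, Nδ)
(`kern_ge`). The cut-off k* is where μ leaves the value 1, so d_eff = ∑ μ_i², and σ_bias², B and the
signal part of P_eff are sums in μ_i too. The result is a bias term plus d_eff/(16N⁴) · ∑_r D_r
(N-1-r)(N-r) (`risk_ge`).

It remains to bound D_r below, by a bootstrap on `iterate_ge`. The decay of the initial error alone,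
c_r ≥ (1 - δ)^(2r) w², turns the β-part of D_r into σ_bias². Fed back into the recursion, it adds a
noise term to the lower bound of c_r; since E⟨u_i, v_r⟩² = c_r + w²(1 - 2(1 - δ)^r), completing the
square yields the two terms of P_eff (`sum_signal_weights_ge`). The numerical constants leave slack.
-/

namespace QuantSGD

set_option linter.unusedSectionVars false

/-! ### Conditional expectation as an average over a resampled variable -/

section Resampling

variable {X Y : Type*} [MeasurableSpace X] [MeasurableSpace Y] {m : Measure X} {ν : Measure Y}
  {T : X × Y → X}

theorem integral_comp_of_measurePreserving {W : Type*} [MeasurableSpace W] {μ : Measure W}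
    {f : W → X} (hf : MeasurePreserving f μ m) {g : X → ℝ} (hg : AEStronglyMeasurable g m) :
    ∫ w, g (f w) ∂μ = ∫ x, g x ∂m := by
  have h := integral_map hf.aemeasurable (f := g) (by rw [hf.map_eq]; exact hg)
  rw [hf.map_eq] at h
  exact h.symm

variable [SFinite m] [IsProbabilityMeasure ν]

/-- Fubini for a resampling map. -/
theorem integral_eq_integral_resample (hT : MeasurePreserving T (m.prod ν) m) {g : X → ℝ}
    (hg : Integrable g m) : ∫ x, g x ∂m = ∫ x, ∫ y, g (T (x, y)) ∂ν ∂m := by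
  rw [← integral_comp_of_measurePreserving hT hg.1]
  exact integral_prod _ (hT.integrable_comp_of_integrable hg)

theorem integrable_integral_resample (hT : MeasurePreserving T (m.prod ν) m) {g : X → ℝ}
    (hg : Integrable g m) : Integrable (fun x => ∫ y, g (T (x, y)) ∂ν) m :=
  (hT.integrable_comp_of_integrable hg).integral_prod_left

theorem sq_integral_le_integral_sq {f : Y → ℝ} (hf : AEStronglyMeasurable f ν)
    (h : Integrable (fun y => f y ^ 2) ν) : (∫ y, f y ∂ν) ^ 2 ≤ ∫ y, f y ^ 2 ∂ν := by
  have hL : MemLp f 2 ν := (memLp_two_iff_integrable_sq hf).2 h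
  have := variance_nonneg f ν
  rw [variance_eq_sub hL] at this
  simpa using this

section Mean

variable {r rbar : X → ℝ} (hT : MeasurePreserving T (m.prod ν) m) (hr : MemLp r 2 m)
  (hbar : ∀ x, ∫ y, r (T (x, y)) ∂ν = rbar x) (hinv : ∀ x y, rbar (T (x, y)) = rbar x)

include hT hr hbar in
-- `rbar` is the conditional mean of `r` given what the resampling keeps, so this is Jensen's
-- inequality in the fresh variable followed by Fubini.
theorem memLp_resample_mean : MemLp rbar 2 m := by
  have h2 : Integrable (fun x => r x ^ 2) m := hr.integrable_sq
  have hc : MemLp (fun p => r (T p)) 2 (m.prod ν) := hr.comp_measurePreserving hT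
  have hmeas : AEStronglyMeasurable rbar m := by
    have := hc.1.integral_prod_right'
    exact this.congr (Eventually.of_forall hbar)
  have hint := integrable_integral_resample hT h2
  have hae := (hT.integrable_comp_of_integrable h2).prod_right_ae
  have hmae := hc.1.prodMk_left
  refine (memLp_two_iff_integrable_sq hmeas).2 (hint.mono' (hmeas.pow 2) ?_)
  filter_upwards [hae, hmae] with x hx hx'
  rw [Real.norm_of_nonneg (sq_nonneg _), ← hbar]
  exact sq_integral_le_integral_sq hx' hx

include hT hr hbar in
theorem integral_mul_resample_mean {g : X → ℝ} (hg : MemLp g 2 m)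
    (hginv : ∀ x y, g (T (x, y)) = g x) : ∫ x, g x * r x ∂m = ∫ x, g x * rbar x ∂m := by
  have hi : Integrable (fun x => g x * r x) m := hg.integrable_mul hr
  rw [integral_eq_integral_resample hT hi]
  refine integral_congr_ae (Eventually.of_forall fun x => ?_)
  simp only [hginv, integral_const_mul, hbar]

include hT hr hbar hinv in
-- Pythagoras: by `hinv` the conditional mean depends only on what the resampling keeps, hence is
-- orthogonal to `r - rbar`.
theorem integral_sq_resample_mean :
    ∫ x, r x ^ 2 ∂m = ∫ x, rbar x ^ 2 ∂m + ∫ x, (r x - rbar x) ^ 2 ∂m := by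
  have hb := memLp_resample_mean hT hr hbar
  have h := integral_mul_resample_mean hT hr hbar hb hinv
  have e : ∀ x, (r x - rbar x) ^ 2 = r x ^ 2 - 2 * (rbar x * r x) + rbar x ^ 2 := fun x => by ring
  have i1 : Integrable (fun x => r x ^ 2) m := hr.integrable_sq
  have i2 : Integrable (fun x => 2 * (rbar x * r x)) m := (hb.integrable_mul hr).const_mul 2
  have i3 : Integrable (fun x => rbar x ^ 2) m := hb.integrable_sq
  have i4 : Integrable (fun x => r x ^ 2 - 2 * (rbar x * r x)) m := i1.sub i2
  simp_rw [e]
  rw [integral_add i4 i3, integral_sub i1 i2, integral_const_mul, h]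
  have : ∫ x, rbar x * rbar x ∂m = ∫ x, rbar x ^ 2 ∂m := by simp_rw [sq]
  rw [this]; ring

end Mean

/-- Tonelli for the nonnegative function `d²` after resampling. This is how square-integrability is
produced, rather than assumed, from an upper bound on conditional variances. -/
theorem memLp_of_resample_var {d B : X → ℝ} (hT : MeasurePreserving T (m.prod ν) m)
    (hd : AEStronglyMeasurable d m) (hi : ∀ x, Integrable (fun y => d (T (x, y)) ^ 2) ν)
    (hB : Integrable B m) (hle : ∀ x, ∫ y, d (T (x, y)) ^ 2 ∂ν ≤ B x) : MemLp d 2 m := by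
  refine (memLp_two_iff_integrable_sq hd).2 ?_
  refine (hT.integrable_comp (hd.pow 2)).1 ?_
  have hm : AEStronglyMeasurable (fun p => d (T p) ^ 2) (m.prod ν) :=
    (hd.comp_measurePreserving hT).pow 2
  refine (integrable_prod_iff hm).2 ⟨Eventually.of_forall hi, ?_⟩
  refine hB.mono' hm.norm.integral_prod_right' (Eventually.of_forall fun x => ?_)
  have e : ∀ y, ‖d (T (x, y)) ^ 2‖ = d (T (x, y)) ^ 2 := fun y =>
    Real.norm_of_nonneg (sq_nonneg _)
  simp only [e]
  rw [Real.norm_of_nonneg (integral_nonneg fun y => sq_nonneg _)]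
  exact hle x

/-- Product of two square-integrable functions, one preserved by resampling and the other one a
function of the fresh sample. -/
theorem memLp_mul_of_resample {f g : X → ℝ} {g' : Y → ℝ} (hT : MeasurePreserving T (m.prod ν) m)
    (hf : MemLp f 2 m) (hg : AEStronglyMeasurable g m) (hg' : MemLp g' 2 ν)
    (hfT : ∀ x y, f (T (x, y)) = f x) (hgT : ∀ x y, g (T (x, y)) = g' y) :
    MemLp (fun x => f x * g x) 2 m := by
  have hm : AEStronglyMeasurable (fun x => f x * g x) m := hf.1.mul hg
  refine (memLp_two_iff_integrable_sq hm).2 ((hT.integrable_comp (hm.pow 2)).1 ?_)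
  have : Integrable (fun p : X × Y => f p.1 ^ 2 * g' p.2 ^ 2) (m.prod ν) :=
    hf.integrable_sq.mul_prod hg'.integrable_sq
  refine this.congr (Eventually.of_forall fun p => ?_)
  simp [hfT, hgT, mul_pow]

end Resampling

/-! ### Measure-preserving replacements of seeds and rounds -/

section Seeds

variable {Θ : Type*} [MeasurableSpace Θ] {ν : Measure Θ} [IsProbabilityMeasure ν]

/-- The preimage of a box is again a box: the erased coordinate becomes unconstrained, of mass 1,
and its factor reappears in the fresh variable. -/
theorem measurePreserving_update (k : Fin 7) :
    MeasurePreserving (fun w : (Fin 7 → Θ) × Θ => Function.update w.1 k w.2)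
      ((Measure.pi fun _ => ν).prod ν) (Measure.pi fun _ => ν) := by
  have hm : Measurable (fun w : (Fin 7 → Θ) × Θ => Function.update w.1 k w.2) := by
    refine measurable_pi_iff.2 fun i => ?_
    by_cases h : i = k
    · subst h; simpa using measurable_snd
    · simp only [Function.update_of_ne h]
      exact (measurable_pi_apply i).comp measurable_fst
  refine ⟨hm, (Measure.pi_eq fun s hs => ?_).symm⟩
  rw [Measure.map_apply hm (MeasurableSet.univ_pi hs)]
  have : (fun w : (Fin 7 → Θ) × Θ => Function.update w.1 k w.2) ⁻¹' (Set.univ.pi s) =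
      (Set.univ.pi (Function.update s k Set.univ)) ×ˢ s k := by
    ext w
    simp only [Set.mem_preimage, Set.mem_pi, Set.mem_univ, forall_true_left, Set.mem_prod]
    constructor
    · intro h
      refine ⟨fun i => ?_, by simpa using h k⟩
      by_cases hi : i = k
      · subst hi; simp
      · simpa [Function.update_of_ne hi] using h i
    · rintro ⟨h1, h2⟩ i
      by_cases hi : i = k
      · subst hi; simpa using h2
      · simpa [Function.update_of_ne hi] using h1 i
  rw [this, Measure.prod_prod, Measure.pi_pi,
    ← Finset.mul_prod_erase Finset.univ (fun i => ν (s i)) (Finset.mem_univ k),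
    ← Finset.mul_prod_erase Finset.univ _ (Finset.mem_univ k), mul_comm]
  congr 1
  simp only [Function.update_self, measure_univ, one_mul]
  refine Finset.prod_congr rfl fun i hi => ?_
  rw [Function.update_of_ne (Finset.ne_of_mem_erase hi)]

variable {p : ℕ∞} (ρ : Measure ((Coord p → ℝ) × ℝ)) [IsProbabilityMeasure ρ]

instance : IsProbabilityMeasure (roundLaw ρ ν) := by unfold roundLaw; infer_instance

/-- Replace seed `k` of a round. -/
def reseed (k : Fin 7) (z : Round p Θ) (θ : Θ) : Round p Θ := (z.1, Function.update z.2 k θ)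

theorem measurePreserving_reseed (k : Fin 7) :
    MeasurePreserving (fun w : Round p Θ × Θ => reseed k w.1 w.2)
      ((roundLaw ρ ν).prod ν) (roundLaw ρ ν) := by
  have h1 := measurePreserving_prodAssoc ρ (Measure.pi fun _ : Fin 7 => ν) ν
  exact ((MeasurePreserving.id ρ).prod (measurePreserving_update k)).comp h1

variable {A : Type*} [MeasurableSpace A] (κ : Measure A) [IsProbabilityMeasure κ]

/-- Replace seed `k` of the round in a pair of a past and a round. -/
def reseedSnd (k : Fin 7) (w : (A × Round p Θ) × Θ) : A × Round p Θ :=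
  (w.1.1, reseed k w.1.2 w.2)

theorem measurePreserving_reseedSnd (k : Fin 7) :
    MeasurePreserving (reseedSnd (A := A) (p := p) (Θ := Θ) k)
      ((κ.prod (roundLaw ρ ν)).prod ν) (κ.prod (roundLaw ρ ν)) :=
  ((MeasurePreserving.id κ).prod (measurePreserving_reseed ρ k)).comp
    (measurePreserving_prodAssoc κ (roundLaw ρ ν) ν)

/-- Replace the round by a fresh one, but keep the seed of the parameter quantizer. -/
def renew (w : (A × Round p Θ) × Round p Θ) : A × Round p Θ :=
  (w.1.1, reseed 4 w.2 (w.1.2.2 4))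

/-- The old parameter seed is an independent draw from ν, so writing it into the fresh round does
not change the law. The map fixes both the past and Q_p(v) but redraws the feature, which expresses
that x̃ is independent of Q_p(v) although both belong to one round. -/
theorem measurePreserving_renew :
    MeasurePreserving (renew (A := A) (p := p) (Θ := Θ))
      ((κ.prod (roundLaw ρ ν)).prod (roundLaw ρ ν)) (κ.prod (roundLaw ρ ν)) := by
  set R := roundLaw ρ ν with hR
  have he : MeasurePreserving (fun z : Round p Θ => z.2 4) R ν :=
    (measurePreserving_eval (fun _ : Fin 7 => ν) 4).comp measurePreserving_snd
  have h1 := measurePreserving_prodAssoc κ R R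
  have h2 : MeasurePreserving (fun w : Round p Θ × Round p Θ => reseed 4 w.2 (w.1.2 4))
      (R.prod R) R :=
    (measurePreserving_reseed ρ 4).comp
      (((MeasurePreserving.id R).prod he).comp Measure.measurePreserving_swap)
  exact ((MeasurePreserving.id κ).prod h2).comp h1

end Seeds

/-! ### Quadratic forms in the eigenbasis -/

section MatrixFacts

variable {M : ℕ} {J : Type*} [Fintype J]

theorem dotProduct_mulVec_mono {A B : Matrix J J ℝ} (h : A ≤ B) (b : J → ℝ) :
    b ⬝ᵥ A *ᵥ b ≤ b ⬝ᵥ B *ᵥ b := by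
  have := (Matrix.le_iff.1 h).dotProduct_mulVec_nonneg b
  rw [star_trivial, Matrix.sub_mulVec, dotProduct_sub] at this
  linarith

theorem mulVec_vecMulVec_self (a f b : J → ℝ) :
    b ⬝ᵥ Matrix.vecMulVec a a *ᵥ f = (b ⬝ᵥ a) * (a ⬝ᵥ f) := by
  rw [Matrix.vecMulVec_mulVec]
  simp [dotProduct_smul, mul_comm]

theorem sqNorm_sum_smul_vecMulVec {ι : Type*} (s : Finset ι) (c : ι → ℝ) (u : ι → Fin M → ℝ)
    (v : Fin M → ℝ) :
    sqNorm (∑ i ∈ s, c i • Matrix.vecMulVec (u i) (u i)) v = ∑ i ∈ s, c i * (u i ⬝ᵥ v) ^ 2 := by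
  rw [sqNorm, Matrix.sum_mulVec, dotProduct_sum]
  refine Finset.sum_congr rfl fun i _ => ?_
  rw [Matrix.smul_mulVec, dotProduct_smul, mulVec_vecMulVec_self, smul_eq_mul, dotProduct_comm v,
    sq]

variable {H : Matrix (Fin M) (Fin M) ℝ} {lam : Fin M → ℝ} {u : Fin M → (Fin M → ℝ)}

theorem IsEigenDecomposition.dot_mulVec (h : IsEigenDecomposition H lam u) (i : Fin M)
    (f : Fin M → ℝ) : u i ⬝ᵥ H *ᵥ f = lam i * (u i ⬝ᵥ f) := by
  rw [h.decomp, Matrix.sum_mulVec, dotProduct_sum, Finset.sum_eq_single i]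
  · rw [Matrix.smul_mulVec, dotProduct_smul, mulVec_vecMulVec_self, h.orthonormal]; simp
  · intro j _ hj
    rw [Matrix.smul_mulVec, dotProduct_smul, mulVec_vecMulVec_self, h.orthonormal]
    simp [hj.symm]
  · simp

theorem IsEigenDecomposition.mulVec_eq (h : IsEigenDecomposition H lam u) (i : Fin M) :
    H *ᵥ u i = lam i • u i := by
  rw [h.decomp, Matrix.sum_mulVec, Finset.sum_eq_single i]
  · rw [Matrix.smul_mulVec, Matrix.vecMulVec_mulVec, h.orthonormal]; simp
  · intro j _ hj
    rw [Matrix.smul_mulVec, Matrix.vecMulVec_mulVec, h.orthonormal]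
    simp [hj]
  · simp

theorem IsEigenDecomposition.trace_mul (h : IsEigenDecomposition H lam u)
    (C : Matrix (Fin M) (Fin M) ℝ) : (H * C).trace = ∑ i, lam i * (u i ⬝ᵥ C *ᵥ u i) := by
  rw [h.decomp, Finset.sum_mul, Matrix.trace_sum]
  refine Finset.sum_congr rfl fun i _ => ?_
  rw [Matrix.smul_mul, Matrix.trace_smul, Matrix.trace_mul_comm, Matrix.mul_vecMulVec,
    Matrix.trace_vecMulVec, smul_eq_mul, dotProduct_comm]

theorem IsEigenDecomposition.transpose_eq (h : IsEigenDecomposition H lam u) : Hᵀ = H := by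
  rw [h.decomp, Matrix.transpose_sum]
  refine Finset.sum_congr rfl fun i _ => ?_
  rw [Matrix.transpose_smul, Matrix.transpose_vecMulVec]

/-- All the moment matrices (covariance, fourth moment, noise, quantization errors) have this shape
for a suitable weight `w`; Loewner inequalities between them thus become inequalities of scalar
integrals. -/
theorem integral_mul_dot_mul_dot {Ω : Type*} [MeasurableSpace Ω] {μ : Measure Ω} {w : Ω → ℝ}
    {x : Ω → J → ℝ} (hint : ∀ i j, Integrable (fun ω => w ω * (x ω i * x ω j)) μ)
    (a b : J → ℝ) :
    Integrable (fun ω => w ω * ((a ⬝ᵥ x ω) * (b ⬝ᵥ x ω))) μ ∧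
    a ⬝ᵥ (Matrix.of fun i j => ∫ ω, w ω * (x ω i * x ω j) ∂μ) *ᵥ b =
      ∫ ω, w ω * ((a ⬝ᵥ x ω) * (b ⬝ᵥ x ω)) ∂μ := by
  have e : ∀ ω, w ω * ((a ⬝ᵥ x ω) * (b ⬝ᵥ x ω)) =
      ∑ i, ∑ j, (a i * b j) * (w ω * (x ω i * x ω j)) := fun ω => by
    rw [dotProduct, dotProduct, Finset.sum_mul_sum, Finset.mul_sum]
    refine Finset.sum_congr rfl fun i _ => ?_
    rw [Finset.mul_sum]
    exact Finset.sum_congr rfl fun j _ => by ring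
  simp_rw [e]
  have hi : ∀ i j, Integrable (fun ω => (a i * b j) * (w ω * (x ω i * x ω j))) μ :=
    fun i j => (hint i j).const_mul _
  refine ⟨integrable_finsetSum _ fun i _ => integrable_finsetSum _ fun j _ => hi i j, ?_⟩
  rw [integral_finsetSum _ fun i _ => integrable_finsetSum _ fun j _ => hi i j]
  rw [dotProduct]
  refine Finset.sum_congr rfl fun i _ => ?_
  rw [integral_finsetSum _ fun j _ => hi i j, Matrix.mulVec, dotProduct, Finset.mul_sum]
  refine Finset.sum_congr rfl fun j _ => ?_
  rw [integral_const_mul, Matrix.of_apply]; ring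

theorem memLp_dotProduct {Ω : Type*} [MeasurableSpace Ω] {μ : Measure Ω} {r : ENNReal}
    {x : Ω → J → ℝ} (h : ∀ i, MemLp (fun ω => x ω i) r μ) (b : J → ℝ) :
    MemLp (fun ω => b ⬝ᵥ x ω) r μ :=
  memLp_finsetSum _ fun i _ => (h i).const_mul (b i)

end MatrixFacts

/-! ### Moments of the quantized feature and of the noise -/

section FeatureMoments

/-- Lets Hölder's inequality place products of two L⁴ feature coordinates in L². -/
instance holderTriple_four_four_two : ENNReal.HolderTriple 4 4 2 where
  inv_add_inv_eq_inv := by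
    rw [← two_mul, show (4 : ENNReal) = 2 * 2 by norm_num,
      ENNReal.mul_inv (by simp) (by simp), ← mul_assoc,
      ENNReal.mul_inv_cancel (by simp) (by simp), one_mul]

variable {p : ℕ∞} {M : ℕ} {Θ : Type*} [MeasurableSpace Θ] {ν : Measure Θ} [IsProbabilityMeasure ν]
  {ρ : Measure ((Coord p → ℝ) × ℝ)} [IsProbabilityMeasure ρ]
  {q : Scheme p M ν} {S : Fin M × Coord p → ℝ} {α β σlo σhi : ℝ} {vstar : Fin M → ℝ}

theorem FourthMomentCondition.memLp_dot (h : FourthMomentCondition q S ρ α β) (b : Fin M → ℝ) :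
    MemLp (fun z => b ⬝ᵥ feature q S z) 4 (roundLaw ρ ν) :=
  memLp_dotProduct h.finite b

theorem FourthMomentCondition.memLp_dot_mul_dot (h : FourthMomentCondition q S ρ α β)
    (b c : Fin M → ℝ) :
    MemLp (fun z => (b ⬝ᵥ feature q S z) * (c ⬝ᵥ feature q S z)) 2 (roundLaw ρ ν) :=
  (h.memLp_dot c).mul' (h.memLp_dot b)

theorem FourthMomentCondition.memLp_coord_mul_coord (h : FourthMomentCondition q S ρ α β)
    (i j : Fin M) :
    MemLp (fun z => feature q S z i * feature q S z j) 2 (roundLaw ρ ν) :=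
  (h.finite j).mul' (h.finite i)

theorem FourthMomentCondition.memLp_dot_mul_coord (h : FourthMomentCondition q S ρ α β)
    (b : Fin M → ℝ) (j : Fin M) :
    MemLp (fun z => (b ⬝ᵥ feature q S z) * feature q S z j) 2 (roundLaw ρ ν) :=
  (h.finite j).mul' (h.memLp_dot b)

theorem FourthMomentCondition.integral_dot_mul_dot (h : FourthMomentCondition q S ρ α β)
    (b c : Fin M → ℝ) :
    ∫ z, (b ⬝ᵥ feature q S z) * (c ⬝ᵥ feature q S z) ∂(roundLaw ρ ν) =
      b ⬝ᵥ Hf q S ρ *ᵥ c := by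
  have := (integral_mul_dot_mul_dot (μ := roundLaw ρ ν) (w := fun _ => 1) (x := feature q S)
    (fun i j => by simpa using (h.memLp_coord_mul_coord i j).integrable (by norm_num)) b c).2
  simpa [Hf] using this.symm

theorem FourthMomentCondition.lam_nonneg (h : FourthMomentCondition q S ρ α β)
    {lam : Fin M → ℝ} {u : Fin M → (Fin M → ℝ)} (heig : IsEigenDecomposition (Hf q S ρ) lam u)
    (i : Fin M) : 0 ≤ lam i := by
  have h1 := heig.dot_mulVec i (u i)
  rw [heig.orthonormal, if_pos rfl, mul_one, ← h.integral_dot_mul_dot] at h1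
  rw [← h1]
  exact integral_nonneg fun z => mul_self_nonneg _

/-- The lower fourth-moment condition on rank-one matrices. -/
theorem FourthMomentCondition.lower_rank_one (h : FourthMomentCondition q S ρ α β)
    {lam : Fin M → ℝ} {u : Fin M → (Fin M → ℝ)} (heig : IsEigenDecomposition (Hf q S ρ) lam u)
    (i : Fin M) (f : Fin M → ℝ) :
    lam i ^ 2 * (u i ⬝ᵥ f) ^ 2 + β * lam i * ∑ j, lam j * (u j ⬝ᵥ f) ^ 2 ≤
      ∫ z, ((u i ⬝ᵥ feature q S z) * (feature q S z ⬝ᵥ f)) ^ 2 ∂(roundLaw ρ ν) := by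
  have hA : (Matrix.vecMulVec f f).PosSemidef := by
    simpa using Matrix.posSemidef_vecMulVec_self_star f
  -- Tested on `u i`, the term H A H yields `lam i ^ 2`, later used to complete 1 - 2γλ to a square,
  -- and the trace term yields `β * lam i` times fᵀHf.
  have h1 := dotProduct_mulVec_mono (h.lower _ hA) (u i)
  have hint : ∀ k l, Integrable (fun z => (feature q S z ⬝ᵥ Matrix.vecMulVec f f *ᵥ feature q S z) *
      (feature q S z k * feature q S z l)) (roundLaw ρ ν) := fun k l => by
    have := (h.memLp_dot_mul_dot f f).integrable_mul (h.memLp_coord_mul_coord k l)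
    refine this.congr (Eventually.of_forall fun z => ?_)
    simp only [Pi.mul_apply, mulVec_vecMulVec_self, dotProduct_comm f]
  have h2 := (integral_mul_dot_mul_dot hint (u i) (u i)).2
  rw [show (Matrix.of fun k l => ∫ z, (feature q S z ⬝ᵥ Matrix.vecMulVec f f *ᵥ feature q S z) *
      (feature q S z k * feature q S z l) ∂(roundLaw ρ ν)) =
      fourthMoment q S ρ (Matrix.vecMulVec f f) from rfl] at h2
  rw [h2, Matrix.add_mulVec, dotProduct_add, Matrix.smul_mulVec, dotProduct_smul,
    ← Matrix.mulVec_mulVec, ← Matrix.mulVec_mulVec, heig.dot_mulVec, heig.dot_mulVec,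
    heig.mulVec_eq, Matrix.mulVec_smul, dotProduct_smul, mulVec_vecMulVec_self,
    heig.orthonormal, if_pos rfl, heig.trace_mul] at h1
  simp only [mulVec_vecMulVec_self, smul_eq_mul, mul_one, dotProduct_comm f] at h1
  have e : ∀ z, ((u i ⬝ᵥ feature q S z) * (feature q S z ⬝ᵥ f)) ^ 2 =
      (feature q S z ⬝ᵥ f) * (feature q S z ⬝ᵥ f) *
        ((u i ⬝ᵥ feature q S z) * (u i ⬝ᵥ feature q S z)) := fun z => by ring
  simp_rw [e]
  refine le_trans (le_of_eq ?_) h1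
  simp only [sq, Finset.mul_sum, Finset.sum_mul]
  congr 1
  · ring
  · exact Finset.sum_congr rfl fun j _ => by ring

theorem measurable_label : Measurable (label q) := by
  have h3 : Measurable fun z : Round p Θ => z.2 3 :=
    (measurable_pi_apply 3).comp measurable_snd
  have hy : Measurable fun z : Round p Θ => (fun _ : Unit => z.1.2) :=
    measurable_pi_iff.2 fun _ => measurable_snd.comp measurable_fst
  exact measurable_pi_iff.1 (q.Ql.measurable_toFun.comp (h3.prodMk hy)) ()

theorem measurable_dot {X : Type*} [MeasurableSpace X] {f g : X → Fin M → ℝ} (hf : Measurable f)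
    (hg : Measurable g) : Measurable fun x => f x ⬝ᵥ g x := by
  unfold dotProduct
  exact Finset.measurable_sum _ fun i _ =>
    (measurable_pi_iff.1 hf i).mul (measurable_pi_iff.1 hg i)

theorem measurable_xi : Measurable (xi q S vstar) :=
  measurable_label.sub (measurable_dot measurable_const (measurable_feature q S))

theorem IsQuantOptimum.memLp_xi (hopt : IsQuantOptimum q S ρ vstar) :
    MemLp (xi q S vstar) 2 (roundLaw ρ ν) :=
  hopt.label_sq.sub (memLp_dotProduct hopt.feature_sq vstar)

theorem NoiseCondition.memLp_xi_mul_coord (h : NoiseCondition q S ρ vstar σlo σhi) (j : Fin M) :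
    MemLp (fun z => xi q S vstar z * feature q S z j) 2 (roundLaw ρ ν) := by
  have hm : Measurable (fun z => xi q S vstar z * feature q S z j) :=
    measurable_xi.mul (measurable_pi_iff.1 (measurable_feature q S) j)
  refine (memLp_two_iff_integrable_sq hm.aestronglyMeasurable).2 ?_
  refine (h.finite j j).congr (Eventually.of_forall fun z => ?_)
  simp only; ring

theorem NoiseCondition.memLp_xi_mul_dot (h : NoiseCondition q S ρ vstar σlo σhi)
    (b : Fin M → ℝ) :
    MemLp (fun z => (b ⬝ᵥ feature q S z) * xi q S vstar z) 2 (roundLaw ρ ν) := by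
  have := memLp_dotProduct (x := fun z j => xi q S vstar z * feature q S z j)
    h.memLp_xi_mul_coord b
  refine this.ae_eq (Eventually.of_forall fun z => ?_)
  simp only [dotProduct, Finset.sum_mul]
  exact Finset.sum_congr rfl fun i _ => by ring

theorem NoiseCondition.integral_ge (h : NoiseCondition q S ρ vstar σlo σhi)
    {lam : Fin M → ℝ} {u : Fin M → (Fin M → ℝ)} (heig : IsEigenDecomposition (Hf q S ρ) lam u)
    (i : Fin M) :
    σlo ^ 2 * lam i ≤ ∫ z, ((u i ⬝ᵥ feature q S z) * xi q S vstar z) ^ 2 ∂(roundLaw ρ ν) := by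
  have h1 := dotProduct_mulVec_mono h.lower (u i)
  have h2 := (integral_mul_dot_mul_dot h.finite (u i) (u i)).2
  rw [show (Matrix.of fun k l => ∫ z, xi q S vstar z ^ 2 *
      (feature q S z k * feature q S z l) ∂(roundLaw ρ ν)) = noiseMoment q S ρ vstar from rfl] at h2
  rw [h2, Matrix.smul_mulVec, dotProduct_smul, heig.dot_mulVec, heig.orthonormal, if_pos rfl,
    mul_one, smul_eq_mul] at h1
  refine h1.trans (le_of_eq (integral_congr_ae (Eventually.of_forall fun z => ?_)))
  simp only; ring

/-- A measurable function of x̃ can be pulled out of the conditional expectation given x̃. The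
well-specified assumption enters the argument in this form. -/
theorem WellSpecified.integral_eq_zero (h : WellSpecified q S ρ vstar)
    (hxi : MemLp (xi q S vstar) 2 (roundLaw ρ ν)) {g : (Fin M → ℝ) → ℝ} (hg : Measurable g)
    (hi : Integrable (fun z => g (feature q S z) * xi q S vstar z) (roundLaw ρ ν)) :
    ∫ z, g (feature q S z) * xi q S vstar z ∂(roundLaw ρ ν) = 0 := by
  have hle : MeasurableSpace.comap (feature q S) inferInstance ≤
      (inferInstance : MeasurableSpace (Round p Θ)) := (measurable_feature q S).comap_le
  have hsm : StronglyMeasurable[MeasurableSpace.comap (feature q S) inferInstance]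
      (fun z => g (feature q S z)) :=
    (hg.comp (comap_measurable (feature q S))).stronglyMeasurable
  have h1 := condExp_mul_of_stronglyMeasurable_left hsm hi (hxi.integrable (by norm_num))
  rw [← integral_condExp hle (μ := roundLaw ρ ν)]
  have h2 : (roundLaw ρ ν)[(fun z => g (feature q S z) * xi q S vstar z) |
      MeasurableSpace.comap (feature q S) inferInstance] =ᵐ[roundLaw ρ ν] 0 := by
    refine h1.trans ?_
    filter_upwards [h] with z hz
    simp [hz]
  rw [integral_congr_ae h2]; simp

end FeatureMoments

/-! ### Conditional error moments of a single quantizer -/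

section QuantizerMoments

variable {Θ : Type*} [MeasurableSpace Θ] {ν : Measure Θ} [IsProbabilityMeasure ν]

theorem Quantizer.IsMultiplicative.integral_dot {J : Type*} [Fintype J] {Q : Quantizer ν J}
    {lo hi : ℝ} (h : Q.IsMultiplicative lo hi) (b v : J → ℝ) :
    Integrable (fun θ => (b ⬝ᵥ (Q.toFun θ v - v)) ^ 2) ν ∧
    lo * (b ⬝ᵥ v) ^ 2 ≤ ∫ θ, (b ⬝ᵥ (Q.toFun θ v - v)) ^ 2 ∂ν ∧
    ∫ θ, (b ⬝ᵥ (Q.toFun θ v - v)) ^ 2 ∂ν ≤ hi * (b ⬝ᵥ v) ^ 2 := by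
  obtain ⟨h2, hlo, hhi⟩ := h v
  have hL : ∀ i, MemLp (fun θ => Q.toFun θ v i - v i) 2 ν := fun i => (h2 i).sub (memLp_const _)
  have hint : ∀ i j, Integrable
      (fun θ => (1 : ℝ) * ((Q.toFun θ v - v) i * (Q.toFun θ v - v) j)) ν := fun i j => by
    simp only [one_mul, Pi.sub_apply]
    exact (hL i).integrable_mul (hL j)
  obtain ⟨hi1, hi2⟩ := integral_mul_dot_mul_dot hint b b
  have h3 := dotProduct_mulVec_mono hlo b
  have h4 := dotProduct_mulVec_mono hhi b
  have e : (Matrix.of fun i j => ∫ θ, (1 : ℝ) * ((Q.toFun θ v - v) i * (Q.toFun θ v - v) j) ∂ν) =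
      Q.errMoment v := by
    simp [Quantizer.errMoment]
  simp only [one_mul, ← sq] at hi1 hi2 e
  rw [e] at hi2
  rw [Matrix.smul_mulVec, dotProduct_smul, mulVec_vecMulVec_self, hi2, smul_eq_mul,
    dotProduct_comm v b, ← sq] at h3 h4
  exact ⟨hi1, h3, h4⟩

theorem Quantizer.IsMultiplicative.errVar {Q : Quantizer ν Unit} {lo hi : ℝ}
    (h : Q.IsMultiplicative lo hi) (a : ℝ) :
    Integrable (fun θ => (Q.scalar θ a - a) ^ 2) ν ∧
    lo * a ^ 2 ≤ Q.errVar a ∧ Q.errVar a ≤ hi * a ^ 2 := by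
  have := h.integral_dot (fun _ => 1) (fun _ => a)
  simpa [dotProduct, Quantizer.scalar, Quantizer.errVar] using this

theorem Quantizer.errVar_nonneg (Q : Quantizer ν Unit) (a : ℝ) : 0 ≤ Q.errVar a :=
  integral_nonneg fun _ => sq_nonneg _

theorem Quantizer.measurable_scalar_comp {X : Type*} [MeasurableSpace X] (Q : Quantizer ν Unit)
    {θ : X → Θ} {a : X → ℝ} (hθ : Measurable θ) (ha : Measurable a) :
    Measurable fun x => Q.scalar (θ x) (a x) :=
  measurable_pi_iff.1
    (Q.measurable_toFun.comp (hθ.prodMk (measurable_pi_iff.2 fun _ : Unit => ha))) ()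

/-- Needed to carry the essential lower bound of the conditional variances from Ω to the product of
past and round. -/
theorem Quantizer.measurable_errVar (Q : Quantizer ν Unit) : Measurable Q.errVar := by
  have h : Measurable fun p : ℝ × Θ => (Q.scalar p.2 p.1 - p.1) ^ 2 :=
    ((Q.measurable_scalar_comp measurable_snd measurable_fst).sub measurable_fst).pow_const 2
  exact (h.stronglyMeasurable.integral_prod_right' (ν := ν)).measurable

end QuantizerMoments

/-! ### Which quantities are untouched by which seeds -/

section Reseed

variable {p : ℕ∞} {M : ℕ} {Θ : Type*} [MeasurableSpace Θ] {ν : Measure Θ}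
  (q : Scheme p M ν) (S : Fin M × Coord p → ℝ)

theorem reseed_apply_of_ne {k l : Fin 7} (h : l ≠ k) (z : Round p Θ) (θ : Θ) :
    (reseed k z θ).2 l = z.2 l := Function.update_of_ne h _ _

@[simp] theorem reseed_apply_self {k : Fin 7} (z : Round p Θ) (θ : Θ) :
    (reseed k z θ).2 k = θ := Function.update_self _ _ _

@[simp] theorem reseed_fst {k : Fin 7} (z : Round p Θ) (θ : Θ) : (reseed k z θ).1 = z.1 := rfl

theorem feature_reseed {k : Fin 7} (h0 : 0 ≠ k) (h1 : 1 ≠ k) (h2 : 2 ≠ k) (z : Round p Θ)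
    (θ : Θ) : feature q S (reseed k z θ) = feature q S z := by
  simp only [feature, reseed_apply_of_ne h0, reseed_apply_of_ne h1, reseed_apply_of_ne h2,
    reseed_fst]

@[simp] theorem feature_reseed_four (z : Round p Θ) (θ : Θ) :
    feature q S (reseed 4 z θ) = feature q S z :=
  feature_reseed q S (by decide) (by decide) (by decide) z θ

@[simp] theorem feature_reseed_five (z : Round p Θ) (θ : Θ) :
    feature q S (reseed 5 z θ) = feature q S z :=
  feature_reseed q S (by decide) (by decide) (by decide) z θ

@[simp] theorem feature_reseed_six (z : Round p Θ) (θ : Θ) :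
    feature q S (reseed 6 z θ) = feature q S z :=
  feature_reseed q S (by decide) (by decide) (by decide) z θ

theorem label_reseed {k : Fin 7} (h : 3 ≠ k) (z : Round p Θ) (θ : Θ) :
    label q (reseed k z θ) = label q z := by
  simp only [label, reseed_apply_of_ne h, reseed_fst]

@[simp] theorem label_reseed_four (z : Round p Θ) (θ : Θ) :
    label q (reseed 4 z θ) = label q z := label_reseed q (by decide) z θ

@[simp] theorem label_reseed_five (z : Round p Θ) (θ : Θ) :
    label q (reseed 5 z θ) = label q z := label_reseed q (by decide) z θ

@[simp] theorem label_reseed_six (z : Round p Θ) (θ : Θ) :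
    label q (reseed 6 z θ) = label q z := label_reseed q (by decide) z θ

@[simp] theorem preact_reseed_five (v : Fin M → ℝ) (z : Round p Θ) (θ : Θ) :
    preact q S v (reseed 5 z θ) = preact q S v z := by
  simp only [preact, qparam, feature_reseed_five,
    reseed_apply_of_ne (show (4 : Fin 7) ≠ 5 by decide)]

@[simp] theorem preact_reseed_six (v : Fin M → ℝ) (z : Round p Θ) (θ : Θ) :
    preact q S v (reseed 6 z θ) = preact q S v z := by
  simp only [preact, qparam, feature_reseed_six,
    reseed_apply_of_ne (show (4 : Fin 7) ≠ 6 by decide)]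

@[simp] theorem outGrad_reseed_six (v : Fin M → ℝ) (z : Round p Θ) (θ : Θ) :
    outGrad q S v (reseed 6 z θ) = outGrad q S v z := by
  simp only [outGrad, label_reseed_six, preact_reseed_six,
    reseed_apply_of_ne (show (5 : Fin 7) ≠ 6 by decide)]

end Reseed

/-! ### Orthogonal splitting off of one quantizer -/

section Split

variable {p : ℕ∞} {Θ : Type*} [MeasurableSpace Θ] {ν : Measure Θ} [IsProbabilityMeasure ν]
  {ρ : Measure ((Coord p → ℝ) × ℝ)} [IsProbabilityMeasure ρ]
  {A : Type*} [MeasurableSpace A] {κ : Measure A} [IsProbabilityMeasure κ]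

/-- Conditioning on everything but seed `k` replaces an unbiased quantizer by its input; the error
is orthogonal. -/
theorem quantizer_split {J : Type*} [Fintype J] (Q : Quantizer ν J) (k : Fin 7)
    {h : A × Round p Θ → ℝ} {g U : A × Round p Θ → J → ℝ}
    (hh : ∀ x θ, h (reseedSnd k (x, θ)) = h x) (hg : ∀ x θ, g (reseedSnd k (x, θ)) = g x)
    (hU : ∀ x θ, U (reseedSnd k (x, θ)) = U x)
    (hr : MemLp (fun x => h x + g x ⬝ᵥ Q.toFun (x.2.2 k) (U x)) 2 (κ.prod (roundLaw ρ ν))) :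
    MemLp (fun x => h x + g x ⬝ᵥ U x) 2 (κ.prod (roundLaw ρ ν)) ∧
    MemLp (fun x => g x ⬝ᵥ (Q.toFun (x.2.2 k) (U x) - U x)) 2 (κ.prod (roundLaw ρ ν)) ∧
    ∫ x, (h x + g x ⬝ᵥ Q.toFun (x.2.2 k) (U x)) ^ 2 ∂(κ.prod (roundLaw ρ ν)) =
      ∫ x, (h x + g x ⬝ᵥ U x) ^ 2 ∂(κ.prod (roundLaw ρ ν)) +
      ∫ x, (g x ⬝ᵥ (Q.toFun (x.2.2 k) (U x) - U x)) ^ 2 ∂(κ.prod (roundLaw ρ ν)) ∧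
    ∀ φ : A × Round p Θ → ℝ, MemLp φ 2 (κ.prod (roundLaw ρ ν)) →
      (∀ x θ, φ (reseedSnd k (x, θ)) = φ x) →
      ∫ x, φ x * (h x + g x ⬝ᵥ Q.toFun (x.2.2 k) (U x)) ∂(κ.prod (roundLaw ρ ν)) =
        ∫ x, φ x * (h x + g x ⬝ᵥ U x) ∂(κ.prod (roundLaw ρ ν)) := by
  have hT := measurePreserving_reseedSnd ρ (ν := ν) κ k
  have hseed : ∀ x θ, (reseedSnd k (x, θ) : A × Round p Θ).2.2 k = θ := fun x θ => by
    simp [reseedSnd]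
  have hbar : ∀ x, ∫ θ, (h (reseedSnd k (x, θ)) + g (reseedSnd k (x, θ)) ⬝ᵥ
      Q.toFun ((reseedSnd k (x, θ) : A × Round p Θ).2.2 k) (U (reseedSnd k (x, θ)))) ∂ν =
      h x + g x ⬝ᵥ U x := fun x => by
    simp only [hh, hg, hU, hseed, dotProduct]
    have hi : ∀ j, Integrable (fun θ => g x j * Q.toFun θ (U x) j) ν :=
      fun j => (Q.integrable _ _).const_mul _
    rw [integral_add (integrable_const _) (integrable_finsetSum _ fun j _ => hi j),
      integral_finsetSum _ fun j _ => hi j]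
    simp [integral_const_mul, Q.unbiased]
  have hinv : ∀ x θ, (fun x => h x + g x ⬝ᵥ U x) (reseedSnd k (x, θ)) =
      (fun x => h x + g x ⬝ᵥ U x) x := fun x θ => by simp only [hh, hg, hU]
  have hL := memLp_resample_mean hT hr hbar
  have e : ∀ x, (h x + g x ⬝ᵥ Q.toFun (x.2.2 k) (U x)) - (h x + g x ⬝ᵥ U x) =
      g x ⬝ᵥ (Q.toFun (x.2.2 k) (U x) - U x) := fun x => by rw [dotProduct_sub]; ring
  refine ⟨hL, (hr.sub hL).ae_eq (Eventually.of_forall e), ?_, fun φ hφ hφT =>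
    integral_mul_resample_mean hT hr hbar hφ hφT⟩
  have := integral_sq_resample_mean hT hr hbar hinv
  simp only [e] at this
  exact this

/-- For a scalar quantizer the squared error can be integrated over its seed first. The resulting
form with `errVar` is the one to which essential infima and multiplicative bounds apply. -/
theorem scalar_split (Q : Quantizer ν Unit) (k : Fin 7) {h g a : A × Round p Θ → ℝ}
    (hh : ∀ x θ, h (reseedSnd k (x, θ)) = h x) (hg : ∀ x θ, g (reseedSnd k (x, θ)) = g x)
    (ha : ∀ x θ, a (reseedSnd k (x, θ)) = a x)
    (hr : MemLp (fun x => h x + g x * Q.scalar (x.2.2 k) (a x)) 2 (κ.prod (roundLaw ρ ν))) :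
    MemLp (fun x => h x + g x * a x) 2 (κ.prod (roundLaw ρ ν)) ∧
    Integrable (fun x => g x ^ 2 * Q.errVar (a x)) (κ.prod (roundLaw ρ ν)) ∧
    ∫ x, (h x + g x * Q.scalar (x.2.2 k) (a x)) ^ 2 ∂(κ.prod (roundLaw ρ ν)) =
      ∫ x, (h x + g x * a x) ^ 2 ∂(κ.prod (roundLaw ρ ν)) +
      ∫ x, g x ^ 2 * Q.errVar (a x) ∂(κ.prod (roundLaw ρ ν)) ∧
    ∀ φ : A × Round p Θ → ℝ, MemLp φ 2 (κ.prod (roundLaw ρ ν)) →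
      (∀ x θ, φ (reseedSnd k (x, θ)) = φ x) →
      ∫ x, φ x * (h x + g x * Q.scalar (x.2.2 k) (a x)) ∂(κ.prod (roundLaw ρ ν)) =
        ∫ x, φ x * (h x + g x * a x) ∂(κ.prod (roundLaw ρ ν)) := by
  have hT := measurePreserving_reseedSnd ρ (ν := ν) κ k
  have hseed : ∀ x θ, (reseedSnd k (x, θ) : A × Round p Θ).2.2 k = θ := fun x θ => by
    simp [reseedSnd]
  obtain ⟨h1, h2, h3, h4⟩ := quantizer_split (κ := κ) (ρ := ρ) Q k (h := h)
    (g := fun x _ => g x) (U := fun x _ => a x)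
    hh (fun x θ => by rw [hg]) (fun x θ => by rw [ha]) (by simpa [dotProduct, Quantizer.scalar] using hr)
  simp only [dotProduct, Finset.univ_unique, Finset.sum_singleton, Pi.sub_apply] at h1 h2 h3 h4
  have e : ∀ x, ∫ θ, (g (reseedSnd k (x, θ)) *
      (Q.toFun ((reseedSnd k (x, θ) : A × Round p Θ).2.2 k) (fun _ => a (reseedSnd k (x, θ)))
        default - a (reseedSnd k (x, θ)))) ^ 2 ∂ν = g x ^ 2 * Q.errVar (a x) := fun x => by
    simp only [hg, ha, hseed, mul_pow, integral_const_mul]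
    rfl
  have i2 := h2.integrable_sq
  have i3 := integrable_integral_resample hT i2
  simp only [e] at i3
  refine ⟨h1, i3, ?_, h4⟩
  have i4 := integral_eq_integral_resample hT i2
  simp only [e] at i4
  rw [i4] at h3
  exact h3

end Split

/-! ### One step from an independent past: feature and noise terms -/

section OneStep

variable {p : ℕ∞} {M : ℕ} {Θ : Type*} [MeasurableSpace Θ] {ν : Measure Θ} [IsProbabilityMeasure ν]
  {ρ : Measure ((Coord p → ℝ) × ℝ)} [IsProbabilityMeasure ρ]
  {A : Type*} [MeasurableSpace A] {κ : Measure A} [IsProbabilityMeasure κ]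
  {q : Scheme p M ν} {S : Fin M × Coord p → ℝ} {α β σlo σhi : ℝ} {vstar : Fin M → ℝ}
  {V : A → Fin M → ℝ}

theorem measurable_feature_snd (i : Fin M) :
    Measurable fun x : A × Round p Θ => feature q S x.2 i :=
  (measurable_pi_iff.1 (measurable_feature q S) i).comp measurable_snd

theorem measurable_dot_feature_snd (b : Fin M → ℝ) :
    Measurable fun x : A × Round p Θ => b ⬝ᵥ feature q S x.2 :=
  measurable_dot measurable_const ((measurable_feature q S).comp measurable_snd)

theorem measurable_seed (k : Fin 7) : Measurable fun z : Round p Θ => z.2 k :=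
  (measurable_pi_apply k).comp measurable_snd

theorem measurable_qparam_uncurry :
    Measurable fun x : (Fin M → ℝ) × Round p Θ => qparam q x.1 x.2 :=
  q.Qp.measurable_toFun.comp (((measurable_seed 4).comp measurable_snd).prodMk measurable_fst)

theorem measurable_preact_uncurry :
    Measurable fun x : (Fin M → ℝ) × Round p Θ => preact q S x.1 x.2 :=
  measurable_dot ((measurable_feature q S).comp measurable_snd) measurable_qparam_uncurry

theorem measurable_outGrad_uncurry :
    Measurable fun x : (Fin M → ℝ) × Round p Θ => outGrad q S x.1 x.2 :=
  (measurable_label.comp measurable_snd).sub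
    (q.Qa.measurable_scalar_comp ((measurable_seed 5).comp measurable_snd)
      measurable_preact_uncurry)

theorem measurable_qoutGrad_uncurry :
    Measurable fun x : (Fin M → ℝ) × Round p Θ =>
      q.Qo.scalar (x.2.2 6) (outGrad q S x.1 x.2) :=
  q.Qo.measurable_scalar_comp ((measurable_seed 6).comp measurable_snd) measurable_outGrad_uncurry

theorem measurable_step_uncurry (γ : ℝ) :
    Measurable fun x : (Fin M → ℝ) × Round p Θ => step q S γ x.1 x.2 :=
  measurable_fst.add ((measurable_qoutGrad_uncurry.const_mul γ).smul
    ((measurable_feature q S).comp measurable_snd))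

theorem measurable_lift {E : Type*} [MeasurableSpace E] (hV : Measurable V)
    {f : (Fin M → ℝ) × Round p Θ → E} (hf : Measurable f) :
    Measurable fun x : A × Round p Θ => f (V x.1, x.2) :=
  hf.comp ((hV.comp measurable_fst).prodMk measurable_snd)

variable (hF : FourthMomentCondition q S ρ α β)

theorem memLp_snd_of {f : Round p Θ → ℝ} (hf : MemLp f 2 (roundLaw ρ ν)) :
    MemLp (fun x : A × Round p Θ => f x.2) 2 (κ.prod (roundLaw ρ ν)) :=
  hf.comp_measurePreserving measurePreserving_snd

theorem memLp_fst_of {f : A → ℝ} (hf : MemLp f 2 κ) :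
    MemLp (fun x : A × Round p Θ => f x.1) 2 (κ.prod (roundLaw ρ ν)) :=
  hf.comp_measurePreserving measurePreserving_fst

include hF in
-- Given `F`, the feature is a fresh draw, so L² for `F` and L⁴ for x̃ suffice. `F` will be v - v*,
-- Q_p(v) or Q_p(v) - v.
theorem memLp_dot_mul_dot_of_renew {F : A × Round p Θ → Fin M → ℝ}
    (hL : ∀ j, MemLp (fun x => F x j) 2 (κ.prod (roundLaw ρ ν)))
    (hT : ∀ x z, F (renew (x, z)) = F x) (b : Fin M → ℝ) :
    MemLp (fun x : A × Round p Θ => (b ⬝ᵥ feature q S x.2) * (feature q S x.2 ⬝ᵥ F x)) 2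
      (κ.prod (roundLaw ρ ν)) := by
  have h : ∀ j, MemLp (fun x : A × Round p Θ => F x j *
      ((b ⬝ᵥ feature q S x.2) * feature q S x.2 j)) 2 (κ.prod (roundLaw ρ ν)) := fun j =>
    memLp_mul_of_resample (measurePreserving_renew ρ κ) (hL j)
      ((measurable_dot_feature_snd b).mul (measurable_feature_snd j)).aestronglyMeasurable
      (hF.memLp_dot_mul_coord b j) (fun x z => by rw [hT]) (fun x z => by simp [renew])
  refine (memLp_finsetSum Finset.univ fun j _ => h j).ae_eq (Eventually.of_forall fun x => ?_)
  simp only [dotProduct, Finset.mul_sum]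
  exact Finset.sum_congr rfl fun j _ => by ring

include hF in
-- Redrawing the feature with `F` fixed reduces the claim to `lower_rank_one` at `f = F x`,
-- integrated over `x`.
theorem integral_sq_dot_mul_dot_ge {lam : Fin M → ℝ} {u : Fin M → (Fin M → ℝ)}
    (heig : IsEigenDecomposition (Hf q S ρ) lam u) {F : A × Round p Θ → Fin M → ℝ}
    (hL : ∀ j, MemLp (fun x => F x j) 2 (κ.prod (roundLaw ρ ν)))
    (hT : ∀ x z, F (renew (x, z)) = F x) (i : Fin M) :
    lam i ^ 2 * ∫ x, (u i ⬝ᵥ F x) ^ 2 ∂(κ.prod (roundLaw ρ ν)) +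
      β * lam i * ∑ j, lam j * ∫ x, (u j ⬝ᵥ F x) ^ 2 ∂(κ.prod (roundLaw ρ ν)) ≤
    ∫ x : A × Round p Θ, ((u i ⬝ᵥ feature q S x.2) * (feature q S x.2 ⬝ᵥ F x)) ^ 2
      ∂(κ.prod (roundLaw ρ ν)) := by
  have hR := measurePreserving_renew ρ (ν := ν) κ
  have h1 := (memLp_dot_mul_dot_of_renew hF hL hT (u i)).integrable_sq
  have hsq : ∀ j, Integrable (fun x => (u j ⬝ᵥ F x) ^ 2) (κ.prod (roundLaw ρ ν)) := fun j =>
    (memLp_dotProduct hL (u j)).integrable_sq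
  have hsum : Integrable (fun x => β * lam i * ∑ j, lam j * (u j ⬝ᵥ F x) ^ 2)
      (κ.prod (roundLaw ρ ν)) :=
    (integrable_finsetSum _ fun j _ => (hsq j).const_mul _).const_mul _
  have e : lam i ^ 2 * ∫ x, (u i ⬝ᵥ F x) ^ 2 ∂(κ.prod (roundLaw ρ ν)) +
      β * lam i * ∑ j, lam j * ∫ x, (u j ⬝ᵥ F x) ^ 2 ∂(κ.prod (roundLaw ρ ν)) =
      ∫ x, (lam i ^ 2 * (u i ⬝ᵥ F x) ^ 2 + β * lam i * ∑ j, lam j * (u j ⬝ᵥ F x) ^ 2)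
        ∂(κ.prod (roundLaw ρ ν)) := by
    rw [integral_add ((hsq i).const_mul _) hsum, integral_const_mul, integral_const_mul,
      integral_finsetSum _ fun j _ => (hsq j).const_mul _]
    simp only [integral_const_mul]
  rw [e, integral_eq_integral_resample hR h1]
  refine integral_mono (((hsq i).const_mul _).add hsum) (integrable_integral_resample hR h1)
    fun x => ?_
  simp only [hT]
  simpa [renew] using hF.lower_rank_one heig i (F x)

variable (hN : NoiseCondition q S ρ vstar σlo σhi) (hO : IsQuantOptimum q S ρ vstar)
  (hW : WellSpecified q S ρ vstar)

include hF hN hO hW in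
theorem integral_mul_residual {lam : Fin M → ℝ} {u : Fin M → (Fin M → ℝ)}
    (heig : IsEigenDecomposition (Hf q S ρ) lam u)
    (hL : ∀ j, MemLp (fun x => V x j) 2 κ) {ψ : A → ℝ} (hψ : MemLp ψ 2 κ) (i : Fin M) :
    ∫ x : A × Round p Θ, ψ x.1 * ((u i ⬝ᵥ feature q S x.2) * xi q S vstar x.2 -
      (u i ⬝ᵥ feature q S x.2) * (feature q S x.2 ⬝ᵥ V x.1)) ∂(κ.prod (roundLaw ρ ν)) =
      -lam i * ∫ w, ψ w * (u i ⬝ᵥ V w) ∂κ := by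
  have h1 : MemLp (fun x : A × Round p Θ => (u i ⬝ᵥ feature q S x.2) * xi q S vstar x.2) 2
      (κ.prod (roundLaw ρ ν)) := memLp_snd_of (hN.memLp_xi_mul_dot (u i))
  have h2 := memLp_dot_mul_dot_of_renew (κ := κ) hF (F := fun x => V x.1)
    (fun j => memLp_fst_of (hL j)) (fun x z => rfl) (u i)
  have h3 := (memLp_fst_of (ρ := ρ) (ν := ν) hψ).integrable_mul (h1.sub h2)
  have h4 := integral_prod _ h3
  simp only [Pi.mul_apply, Pi.sub_apply] at h4
  rw [h4, ← integral_const_mul]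
  refine integral_congr_ae (Eventually.of_forall fun w => ?_)
  have i1 : Integrable (fun z => (u i ⬝ᵥ feature q S z) * xi q S vstar z) (roundLaw ρ ν) :=
    (hN.memLp_xi_mul_dot (u i)).integrable (by norm_num)
  have i2 : Integrable (fun z => (u i ⬝ᵥ feature q S z) * (feature q S z ⬝ᵥ V w))
      (roundLaw ρ ν) := by
    have := (hF.memLp_dot_mul_dot (u i) (V w)).integrable (by norm_num)
    simpa only [dotProduct_comm (V w)] using this
  have h5 := hF.integral_dot_mul_dot (u i) (V w)
  simp only [dotProduct_comm (V w)] at h5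
  have h6 := hW.integral_eq_zero hO.memLp_xi (g := fun f => u i ⬝ᵥ f)
    (measurable_dot measurable_const measurable_id) i1
  simp only [integral_const_mul]
  rw [integral_sub i1 i2, h5, h6, heig.dot_mulVec]
  ring

include hF hN hO hW in
-- With the past fixed, the cross term is ξ times a function of x̃ and so integrates to zero.
theorem integral_sq_residual (hL : ∀ j, MemLp (fun x => V x j) 2 κ) (b : Fin M → ℝ) :
    ∫ x : A × Round p Θ, ((b ⬝ᵥ feature q S x.2) * xi q S vstar x.2 -
      (b ⬝ᵥ feature q S x.2) * (feature q S x.2 ⬝ᵥ V x.1)) ^ 2 ∂(κ.prod (roundLaw ρ ν)) =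
    ∫ z, ((b ⬝ᵥ feature q S z) * xi q S vstar z) ^ 2 ∂(roundLaw ρ ν) +
    ∫ x : A × Round p Θ, ((b ⬝ᵥ feature q S x.2) * (feature q S x.2 ⬝ᵥ V x.1)) ^ 2
      ∂(κ.prod (roundLaw ρ ν)) := by
  have h1 : MemLp (fun x : A × Round p Θ => (b ⬝ᵥ feature q S x.2) * xi q S vstar x.2) 2
      (κ.prod (roundLaw ρ ν)) := memLp_snd_of (hN.memLp_xi_mul_dot b)
  have h2 := memLp_dot_mul_dot_of_renew (κ := κ) hF (F := fun x => V x.1)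
    (fun j => memLp_fst_of (hL j)) (fun x z => rfl) b
  have h3 : Integrable (fun x : A × Round p Θ => (b ⬝ᵥ feature q S x.2) * xi q S vstar x.2 *
    ((b ⬝ᵥ feature q S x.2) * (feature q S x.2 ⬝ᵥ V x.1))) (κ.prod (roundLaw ρ ν)) :=
    h1.integrable_mul h2
  have hz : ∫ x : A × Round p Θ, (b ⬝ᵥ feature q S x.2) * xi q S vstar x.2 *
      ((b ⬝ᵥ feature q S x.2) * (feature q S x.2 ⬝ᵥ V x.1)) ∂(κ.prod (roundLaw ρ ν)) = 0 := by
    rw [integral_prod _ h3]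
    refine (integral_congr_ae (Eventually.of_forall fun w => ?_)).trans (integral_zero A ℝ)
    have i1 : Integrable (fun z => (b ⬝ᵥ feature q S z) * (b ⬝ᵥ feature q S z) *
        (feature q S z ⬝ᵥ V w) * xi q S vstar z) (roundLaw ρ ν) := by
      refine ((hN.memLp_xi_mul_dot b).integrable_mul (hF.memLp_dot_mul_dot b (V w))).congr
        (Eventually.of_forall fun z => ?_)
      simp only [Pi.mul_apply, dotProduct_comm (V w)]; ring
    have hm : Measurable fun f : Fin M → ℝ => (b ⬝ᵥ f) * (b ⬝ᵥ f) * (f ⬝ᵥ V w) :=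
      ((measurable_dot measurable_const measurable_id).mul
        (measurable_dot measurable_const measurable_id)).mul
        (measurable_dot measurable_id measurable_const)
    have h6 := hW.integral_eq_zero hO.memLp_xi hm i1
    refine Eq.trans (integral_congr_ae (Eventually.of_forall fun z => ?_)) h6
    simp only; ring
  have hm2 : ∫ x : A × Round p Θ, ((b ⬝ᵥ feature q S x.2) * xi q S vstar x.2) ^ 2
      ∂(κ.prod (roundLaw ρ ν)) = ∫ z, ((b ⬝ᵥ feature q S z) * xi q S vstar z) ^ 2 ∂(roundLaw ρ ν) :=
    integral_comp_of_measurePreserving measurePreserving_snd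
      (hN.memLp_xi_mul_dot b).integrable_sq.1
  have e : ∀ x : A × Round p Θ, ((b ⬝ᵥ feature q S x.2) * xi q S vstar x.2 -
      (b ⬝ᵥ feature q S x.2) * (feature q S x.2 ⬝ᵥ V x.1)) ^ 2 =
      ((b ⬝ᵥ feature q S x.2) * xi q S vstar x.2) ^ 2 -
      2 * ((b ⬝ᵥ feature q S x.2) * xi q S vstar x.2 *
        ((b ⬝ᵥ feature q S x.2) * (feature q S x.2 ⬝ᵥ V x.1))) +
      ((b ⬝ᵥ feature q S x.2) * (feature q S x.2 ⬝ᵥ V x.1)) ^ 2 := fun x => by ring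
  have i12 : Integrable (fun x : A × Round p Θ =>
      ((b ⬝ᵥ feature q S x.2) * xi q S vstar x.2) ^ 2 -
      2 * ((b ⬝ᵥ feature q S x.2) * xi q S vstar x.2 *
        ((b ⬝ᵥ feature q S x.2) * (feature q S x.2 ⬝ᵥ V x.1)))) (κ.prod (roundLaw ρ ν)) :=
    h1.integrable_sq.sub (h3.const_mul 2)
  simp_rw [e]
  rw [integral_add i12 h2.integrable_sq, integral_sub h1.integrable_sq (h3.const_mul 2),
    integral_const_mul, hz, hm2]
  ring

end OneStep

/-! ### Peeling off the three quantizers inside a step -/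

section OneStepSplit

variable {p : ℕ∞} {M : ℕ} {Θ : Type*} [MeasurableSpace Θ] {ν : Measure Θ} [IsProbabilityMeasure ν]
  {ρ : Measure ((Coord p → ℝ) × ℝ)} [IsProbabilityMeasure ρ]
  {A : Type*} [MeasurableSpace A] {κ : Measure A} [IsProbabilityMeasure κ]
  {q : Scheme p M ν} {S : Fin M × Coord p → ℝ} {α β σlo σhi : ℝ} {vstar : Fin M → ℝ}
  {V : A → Fin M → ℝ}

/-- `⟨b, x̃⟩` times the quantized output gradient. -/
noncomputable def gradDot (q : Scheme p M ν) (S : Fin M × Coord p → ℝ) (V : A → Fin M → ℝ)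
    (b : Fin M → ℝ) (x : A × Round p Θ) : ℝ :=
  (b ⬝ᵥ feature q S x.2) * q.Qo.scalar (x.2.2 6) (outGrad q S (V x.1) x.2)

theorem dot_step (γ : ℝ) (b : Fin M → ℝ) (x : A × Round p Θ) :
    b ⬝ᵥ step q S γ (V x.1) x.2 = b ⬝ᵥ V x.1 + γ * gradDot q S V b x := by
  rw [step, dotProduct_add, dotProduct_smul, gradDot, smul_eq_mul]; ring

/-- Seeds 6, 5 and 4 are averaged out from the outermost quantizer inwards, because the input of
each quantizer involves the seeds of the inner ones but not its own. This is the first layer. -/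
theorem outGrad_split {b : Fin M → ℝ}
    (h : MemLp (gradDot q S V b) 2 (κ.prod (roundLaw ρ ν))) :
    MemLp (fun x : A × Round p Θ => (b ⬝ᵥ feature q S x.2) * outGrad q S (V x.1) x.2) 2
      (κ.prod (roundLaw ρ ν)) ∧
    Integrable (fun x : A × Round p Θ => (b ⬝ᵥ feature q S x.2) ^ 2 *
      q.Qo.errVar (outGrad q S (V x.1) x.2)) (κ.prod (roundLaw ρ ν)) ∧
    ∫ x, gradDot q S V b x ^ 2 ∂(κ.prod (roundLaw ρ ν)) =
      ∫ x : A × Round p Θ, ((b ⬝ᵥ feature q S x.2) * outGrad q S (V x.1) x.2) ^ 2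
        ∂(κ.prod (roundLaw ρ ν)) +
      ∫ x : A × Round p Θ, (b ⬝ᵥ feature q S x.2) ^ 2 * q.Qo.errVar (outGrad q S (V x.1) x.2)
        ∂(κ.prod (roundLaw ρ ν)) ∧
    ∀ ψ : A → ℝ, MemLp ψ 2 κ →
      ∫ x, ψ x.1 * gradDot q S V b x ∂(κ.prod (roundLaw ρ ν)) =
        ∫ x : A × Round p Θ, ψ x.1 * ((b ⬝ᵥ feature q S x.2) * outGrad q S (V x.1) x.2)
          ∂(κ.prod (roundLaw ρ ν)) := by
  obtain ⟨h1, h2, h3, h4⟩ := scalar_split (κ := κ) (ρ := ρ) q.Qo 6 (h := fun _ => 0)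
    (g := fun x => b ⬝ᵥ feature q S x.2) (a := fun x => outGrad q S (V x.1) x.2)
    (fun _ _ => rfl) (fun x θ => by simp [reseedSnd]) (fun x θ => by simp [reseedSnd])
    (by simp only [zero_add]; exact h)
  simp only [zero_add] at h1 h3 h4
  exact ⟨h1, h2, h3, fun ψ hψ => h4 (fun x => ψ x.1) (memLp_fst_of hψ) fun _ _ => rfl⟩

theorem preact_split {b : Fin M → ℝ}
    (h : MemLp (fun x : A × Round p Θ => (b ⬝ᵥ feature q S x.2) * outGrad q S (V x.1) x.2) 2
      (κ.prod (roundLaw ρ ν))) :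
    MemLp (fun x : A × Round p Θ => (b ⬝ᵥ feature q S x.2) *
      (label q x.2 - preact q S (V x.1) x.2)) 2 (κ.prod (roundLaw ρ ν)) ∧
    Integrable (fun x : A × Round p Θ => (b ⬝ᵥ feature q S x.2) ^ 2 *
      q.Qa.errVar (preact q S (V x.1) x.2)) (κ.prod (roundLaw ρ ν)) ∧
    ∫ x : A × Round p Θ, ((b ⬝ᵥ feature q S x.2) * outGrad q S (V x.1) x.2) ^ 2
        ∂(κ.prod (roundLaw ρ ν)) =
      ∫ x : A × Round p Θ, ((b ⬝ᵥ feature q S x.2) *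
        (label q x.2 - preact q S (V x.1) x.2)) ^ 2 ∂(κ.prod (roundLaw ρ ν)) +
      ∫ x : A × Round p Θ, (b ⬝ᵥ feature q S x.2) ^ 2 * q.Qa.errVar (preact q S (V x.1) x.2)
        ∂(κ.prod (roundLaw ρ ν)) ∧
    ∀ ψ : A → ℝ, MemLp ψ 2 κ →
      ∫ x : A × Round p Θ, ψ x.1 * ((b ⬝ᵥ feature q S x.2) * outGrad q S (V x.1) x.2)
          ∂(κ.prod (roundLaw ρ ν)) =
        ∫ x : A × Round p Θ, ψ x.1 * ((b ⬝ᵥ feature q S x.2) *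
          (label q x.2 - preact q S (V x.1) x.2)) ∂(κ.prod (roundLaw ρ ν)) := by
  have e : ∀ x : A × Round p Θ, (b ⬝ᵥ feature q S x.2) * outGrad q S (V x.1) x.2 =
      (b ⬝ᵥ feature q S x.2) * label q x.2 +
        -(b ⬝ᵥ feature q S x.2) * q.Qa.scalar (x.2.2 5) (preact q S (V x.1) x.2) := fun x => by
    rw [outGrad]; ring
  have e' : ∀ x : A × Round p Θ, (b ⬝ᵥ feature q S x.2) * (label q x.2 - preact q S (V x.1) x.2) =
      (b ⬝ᵥ feature q S x.2) * label q x.2 +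
        -(b ⬝ᵥ feature q S x.2) * preact q S (V x.1) x.2 := fun x => by ring
  simp only [e] at h
  obtain ⟨h1, h2, h3, h4⟩ := scalar_split (κ := κ) (ρ := ρ) q.Qa 5
    (h := fun x => (b ⬝ᵥ feature q S x.2) * label q x.2)
    (g := fun x => -(b ⬝ᵥ feature q S x.2)) (a := fun x => preact q S (V x.1) x.2)
    (fun x θ => by simp [reseedSnd]) (fun x θ => by simp [reseedSnd])
    (fun x θ => by simp [reseedSnd]) h
  simp only [neg_sq] at h2 h3
  simp only [e, e']
  exact ⟨h1, h2, h3, fun ψ hψ => h4 (fun x => ψ x.1) (memLp_fst_of hψ) fun _ _ => rfl⟩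

/-- The innermost layer: averaging the parameter seed turns the activation into ⟨x̃, V⟩, and Q_l(y)
- ⟨x̃, V⟩ = ξ - ⟨x̃, V - v*⟩. The label quantizer is not averaged; its error stays in ξ. -/
theorem qparam_split {b : Fin M → ℝ}
    (h : MemLp (fun x : A × Round p Θ => (b ⬝ᵥ feature q S x.2) *
      (label q x.2 - preact q S (V x.1) x.2)) 2 (κ.prod (roundLaw ρ ν))) :
    ∫ x : A × Round p Θ, ((b ⬝ᵥ feature q S x.2) *
        (label q x.2 - preact q S (V x.1) x.2)) ^ 2 ∂(κ.prod (roundLaw ρ ν)) =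
      ∫ x : A × Round p Θ, ((b ⬝ᵥ feature q S x.2) * xi q S vstar x.2 -
        (b ⬝ᵥ feature q S x.2) * (feature q S x.2 ⬝ᵥ (V x.1 - vstar))) ^ 2
          ∂(κ.prod (roundLaw ρ ν)) +
      ∫ x : A × Round p Θ, ((b ⬝ᵥ feature q S x.2) *
        (feature q S x.2 ⬝ᵥ (qparam q (V x.1) x.2 - V x.1))) ^ 2 ∂(κ.prod (roundLaw ρ ν)) ∧
    ∀ ψ : A → ℝ, MemLp ψ 2 κ →
      ∫ x : A × Round p Θ, ψ x.1 * ((b ⬝ᵥ feature q S x.2) *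
          (label q x.2 - preact q S (V x.1) x.2)) ∂(κ.prod (roundLaw ρ ν)) =
        ∫ x : A × Round p Θ, ψ x.1 * ((b ⬝ᵥ feature q S x.2) * xi q S vstar x.2 -
          (b ⬝ᵥ feature q S x.2) * (feature q S x.2 ⬝ᵥ (V x.1 - vstar)))
            ∂(κ.prod (roundLaw ρ ν)) := by
  have e : ∀ x : A × Round p Θ, (b ⬝ᵥ feature q S x.2) * (label q x.2 - preact q S (V x.1) x.2) =
      (b ⬝ᵥ feature q S x.2) * label q x.2 + (-(b ⬝ᵥ feature q S x.2) • feature q S x.2) ⬝ᵥ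
        q.Qp.toFun (x.2.2 4) (V x.1) := fun x => by
    rw [preact, qparam, smul_dotProduct, smul_eq_mul]; ring
  have e' : ∀ x : A × Round p Θ, (b ⬝ᵥ feature q S x.2) * xi q S vstar x.2 -
      (b ⬝ᵥ feature q S x.2) * (feature q S x.2 ⬝ᵥ (V x.1 - vstar)) =
      (b ⬝ᵥ feature q S x.2) * label q x.2 + (-(b ⬝ᵥ feature q S x.2) • feature q S x.2) ⬝ᵥ
        V x.1 := fun x => by
    rw [xi, dotProduct_sub, smul_dotProduct, smul_eq_mul, dotProduct_comm vstar]; ring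
  simp only [e] at h
  obtain ⟨h1, h2, h3, h4⟩ := quantizer_split (κ := κ) (ρ := ρ) q.Qp 4
    (h := fun x => (b ⬝ᵥ feature q S x.2) * label q x.2)
    (g := fun x => -(b ⬝ᵥ feature q S x.2) • feature q S x.2) (U := fun x => V x.1)
    (fun x θ => by simp [reseedSnd]) (fun x θ => by simp [reseedSnd])
    (fun x θ => by simp [reseedSnd]) h
  have e2 : ∀ x : A × Round p Θ, ((b ⬝ᵥ feature q S x.2) *
      (feature q S x.2 ⬝ᵥ (qparam q (V x.1) x.2 - V x.1))) ^ 2 =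
      ((-(b ⬝ᵥ feature q S x.2) • feature q S x.2) ⬝ᵥ
        (q.Qp.toFun (x.2.2 4) (V x.1) - V x.1)) ^ 2 := fun x => by
    rw [smul_dotProduct, smul_eq_mul, qparam]; ring
  simp only [e, e', e2]
  exact ⟨h3, fun ψ hψ => h4 (fun x => ψ x.1) (memLp_fst_of hψ) fun _ _ => rfl⟩

end OneStepSplit

/-! ### One-step moments under general quantization -/

section OneStepBounds

variable {p : ℕ∞} {M : ℕ} {Θ : Type*} [MeasurableSpace Θ] {ν : Measure Θ} [IsProbabilityMeasure ν]
  {ρ : Measure ((Coord p → ℝ) × ℝ)} [IsProbabilityMeasure ρ]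
  {A : Type*} [MeasurableSpace A] {κ : Measure A} [IsProbabilityMeasure κ]
  {q : Scheme p M ν} {S : Fin M × Coord p → ℝ} {α β σlo σhi : ℝ} {vstar : Fin M → ℝ}
  {V : A → Fin M → ℝ} {lam : Fin M → ℝ} {u : Fin M → (Fin M → ℝ)}
  (hF : FourthMomentCondition q S ρ α β) (hN : NoiseCondition q S ρ vstar σlo σhi)
  (hO : IsQuantOptimum q S ρ vstar) (hW : WellSpecified q S ρ vstar)
  (heig : IsEigenDecomposition (Hf q S ρ) lam u)
  (hL : ∀ j, MemLp (fun w => V w j) 2 κ)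

theorem memLp_sub_const (hL : ∀ j, MemLp (fun w => V w j) 2 κ) (c : Fin M → ℝ) (j : Fin M) :
    MemLp (fun w => (V w - c) j) 2 κ := (hL j).sub (memLp_const _)

include hF hN hO hW heig hL in
theorem integral_mul_gradDot {i : Fin M}
    (hG : MemLp (gradDot q S V (u i)) 2 (κ.prod (roundLaw ρ ν))) {ψ : A → ℝ} (hψ : MemLp ψ 2 κ) :
    ∫ x, ψ x.1 * gradDot q S V (u i) x ∂(κ.prod (roundLaw ρ ν)) =
      -lam i * ∫ w, ψ w * (u i ⬝ᵥ (V w - vstar)) ∂κ := by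
  obtain ⟨h1, -, -, h1'⟩ := outGrad_split hG
  obtain ⟨h2, -, -, h2'⟩ := preact_split h1
  obtain ⟨-, h3'⟩ := qparam_split (vstar := vstar) h2
  rw [h1' ψ hψ, h2' ψ hψ, h3' ψ hψ]
  exact integral_mul_residual hF hN hO hW heig (memLp_sub_const hL vstar) hψ i

include hF hN hO hW heig hL in
/-- A unit-direction cross moment contracts by `1 - γ lam i` in one step. -/
theorem integral_mul_dot_step {i : Fin M} (γ : ℝ)
    (hG : MemLp (gradDot q S V (u i)) 2 (κ.prod (roundLaw ρ ν))) {ψ : A → ℝ} (hψ : MemLp ψ 2 κ) :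
    ∫ x : A × Round p Θ, ψ x.1 * (u i ⬝ᵥ (step q S γ (V x.1) x.2 - vstar))
        ∂(κ.prod (roundLaw ρ ν)) =
      (1 - γ * lam i) * ∫ w, ψ w * (u i ⬝ᵥ (V w - vstar)) ∂κ := by
  have e : ∀ x : A × Round p Θ, ψ x.1 * (u i ⬝ᵥ (step q S γ (V x.1) x.2 - vstar)) =
      ψ x.1 * (u i ⬝ᵥ (V x.1 - vstar)) + γ * (ψ x.1 * gradDot q S V (u i) x) := fun x => by
    rw [dotProduct_sub, dot_step, dotProduct_sub]; ring
  have hη := memLp_dotProduct (memLp_sub_const hL vstar) (u i)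
  have i1 : Integrable (fun w => ψ w * (u i ⬝ᵥ (V w - vstar))) κ := hψ.integrable_mul hη
  have i2 : Integrable (fun x : A × Round p Θ => ψ x.1 * gradDot q S V (u i) x)
    (κ.prod (roundLaw ρ ν)) := (memLp_fst_of hψ).integrable_mul hG
  have i3 : Integrable (fun x : A × Round p Θ => ψ x.1 * (u i ⬝ᵥ (V x.1 - vstar)))
    (κ.prod (roundLaw ρ ν)) := i1.comp_fst (roundLaw ρ ν)
  simp_rw [e]
  rw [integral_add i3 (i2.const_mul γ), integral_const_mul,
    integral_mul_gradDot hF hN hO hW heig hL hG hψ,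
    integral_comp_of_measurePreserving (f := Prod.fst) measurePreserving_fst i1.1]
  ring

include hF hN hO hW heig hL in
-- Expanding the square, the cross term sees only the conditional mean of the gradient and
-- contributes -2γλ.
theorem integral_sq_dot_step {i : Fin M} (γ : ℝ)
    (hG : MemLp (gradDot q S V (u i)) 2 (κ.prod (roundLaw ρ ν))) :
    ∫ x : A × Round p Θ, (u i ⬝ᵥ (step q S γ (V x.1) x.2 - vstar)) ^ 2
        ∂(κ.prod (roundLaw ρ ν)) =
      (1 - 2 * γ * lam i) * ∫ w, (u i ⬝ᵥ (V w - vstar)) ^ 2 ∂κ +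
        γ ^ 2 * ∫ x, gradDot q S V (u i) x ^ 2 ∂(κ.prod (roundLaw ρ ν)) := by
  have e : ∀ x : A × Round p Θ, (u i ⬝ᵥ (step q S γ (V x.1) x.2 - vstar)) ^ 2 =
      (u i ⬝ᵥ (V x.1 - vstar)) ^ 2 + 2 * γ * ((u i ⬝ᵥ (V x.1 - vstar)) * gradDot q S V (u i) x) +
      γ ^ 2 * gradDot q S V (u i) x ^ 2 := fun x => by
    rw [dotProduct_sub, dot_step, dotProduct_sub]; ring
  have hη := memLp_dotProduct (memLp_sub_const hL vstar) (u i)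
  have i2 : Integrable (fun x : A × Round p Θ => (u i ⬝ᵥ (V x.1 - vstar)) *
    gradDot q S V (u i) x) (κ.prod (roundLaw ρ ν)) := (memLp_fst_of hη).integrable_mul hG
  have i3 : Integrable (fun x : A × Round p Θ => (u i ⬝ᵥ (V x.1 - vstar)) ^ 2)
    (κ.prod (roundLaw ρ ν)) := (memLp_fst_of hη).integrable_sq
  have i4 : Integrable (fun x : A × Round p Θ => (u i ⬝ᵥ (V x.1 - vstar)) ^ 2 +
    2 * γ * ((u i ⬝ᵥ (V x.1 - vstar)) * gradDot q S V (u i) x)) (κ.prod (roundLaw ρ ν)) :=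
    i3.add (i2.const_mul _)
  simp_rw [e]
  rw [integral_add i4 (hG.integrable_sq.const_mul _), integral_add i3 (i2.const_mul _),
    integral_const_mul, integral_const_mul, integral_mul_gradDot hF hN hO hW heig hL hG hη]
  rw [integral_comp_of_measurePreserving (f := Prod.fst) (g := fun w => (u i ⬝ᵥ (V w - vstar)) ^ 2)
    measurePreserving_fst hη.integrable_sq.1]
  simp only [← sq]
  ring

include hF heig in
theorem integral_sq_dot_feature (i : Fin M) :
    Integrable (fun x : A × Round p Θ => (u i ⬝ᵥ feature q S x.2) ^ 2)
      (κ.prod (roundLaw ρ ν)) ∧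
    ∫ x : A × Round p Θ, (u i ⬝ᵥ feature q S x.2) ^ 2 ∂(κ.prod (roundLaw ρ ν)) = lam i := by
  have h : Integrable (fun z => (u i ⬝ᵥ feature q S z) ^ 2) (roundLaw ρ ν) := by
    simpa only [sq] using (hF.memLp_dot_mul_dot (u i) (u i)).integrable (by norm_num)
  refine ⟨h.comp_snd κ, ?_⟩
  rw [integral_comp_of_measurePreserving (f := Prod.snd)
    (g := fun z => (u i ⬝ᵥ feature q S z) ^ 2) measurePreserving_snd h.1]
  simp only [sq]
  rw [hF.integral_dot_mul_dot, heig.dot_mulVec, heig.orthonormal, if_pos rfl, mul_one]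

include hF hN hO hW heig hL in
/-- Lower bound on the noise that comes from the sample and the current error. -/
theorem integral_sq_residual_ge (i : Fin M) :
    σlo ^ 2 * lam i + (lam i ^ 2 * ∫ w, (u i ⬝ᵥ (V w - vstar)) ^ 2 ∂κ +
        β * lam i * ∑ j, lam j * ∫ w, (u j ⬝ᵥ (V w - vstar)) ^ 2 ∂κ) ≤
      ∫ x : A × Round p Θ, ((u i ⬝ᵥ feature q S x.2) * xi q S vstar x.2 -
        (u i ⬝ᵥ feature q S x.2) * (feature q S x.2 ⬝ᵥ (V x.1 - vstar))) ^ 2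
          ∂(κ.prod (roundLaw ρ ν)) := by
  have hη := memLp_sub_const hL vstar
  rw [integral_sq_residual hF hN hO hW hη (u i)]
  refine add_le_add (hN.integral_ge heig i) ?_
  have h := integral_sq_dot_mul_dot_ge (κ := κ) hF heig
    (F := fun x : A × Round p Θ => V x.1 - vstar) (fun j => memLp_fst_of (hη j))
    (fun x z => rfl) i
  have e : ∀ j, ∫ x : A × Round p Θ, (u j ⬝ᵥ (V x.1 - vstar)) ^ 2 ∂(κ.prod (roundLaw ρ ν)) =
      ∫ w, (u j ⬝ᵥ (V w - vstar)) ^ 2 ∂κ := fun j =>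
    integral_comp_of_measurePreserving (f := Prod.fst) (g := fun w => (u j ⬝ᵥ (V w - vstar)) ^ 2)
      measurePreserving_fst (memLp_dotProduct hη (u j)).integrable_sq.1
  simp only [e] at h
  exact h

variable (hQ : ∀ j, MemLp (fun x : A × Round p Θ => qparam q (V x.1) x.2 j) 2
  (κ.prod (roundLaw ρ ν)))

theorem qparam_renew (x : A × Round p Θ) (z : Round p Θ) :
    qparam q (V (renew (x, z)).1) (renew (x, z)).2 = qparam q (V x.1) x.2 := by
  simp [qparam, renew]

include hL hQ in
theorem memLp_paramErr (j : Fin M) :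
    MemLp (fun x : A × Round p Θ => (qparam q (V x.1) x.2 - V x.1) j) 2
      (κ.prod (roundLaw ρ ν)) := (hQ j).sub (memLp_fst_of (hL j))

include hF heig hL hQ in
theorem integral_sq_paramErr_ge (i : Fin M) :
    β * lam i * ∑ j, lam j * ∫ x : A × Round p Θ, (u j ⬝ᵥ (qparam q (V x.1) x.2 - V x.1)) ^ 2
      ∂(κ.prod (roundLaw ρ ν)) ≤
    ∫ x : A × Round p Θ, ((u i ⬝ᵥ feature q S x.2) *
        (feature q S x.2 ⬝ᵥ (qparam q (V x.1) x.2 - V x.1))) ^ 2 ∂(κ.prod (roundLaw ρ ν)) := by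
  have h := integral_sq_dot_mul_dot_ge (κ := κ) hF heig
    (F := fun x : A × Round p Θ => qparam q (V x.1) x.2 - V x.1) (memLp_paramErr hL hQ)
    (fun x z => by rw [qparam_renew]; rfl) i
  -- Only the trace part of the fourth-moment bound is kept; the H A H part is nonnegative and is
  -- discarded.
  refine le_trans ?_ h
  have : 0 ≤ lam i ^ 2 * ∫ x : A × Round p Θ, (u i ⬝ᵥ (qparam q (V x.1) x.2 - V x.1)) ^ 2
      ∂(κ.prod (roundLaw ρ ν)) := mul_nonneg (sq_nonneg _) (integral_nonneg fun _ => sq_nonneg _)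
  linarith

include hF hN hO hW heig hL hQ in
/-- Second moment of the stochastic gradient, general quantization. -/
theorem integral_sq_gradDot_ge {i : Fin M}
    (hG : MemLp (gradDot q S V (u i)) 2 (κ.prod (roundLaw ρ ν))) {e : ℝ}
    (he : ∀ᵐ x : A × Round p Θ ∂(κ.prod (roundLaw ρ ν)),
      e ≤ q.Qa.errVar (preact q S (V x.1) x.2) + q.Qo.errVar (outGrad q S (V x.1) x.2)) :
    lam i ^ 2 * ∫ w, (u i ⬝ᵥ (V w - vstar)) ^ 2 ∂κ +
      lam i * (β * ∑ j, lam j * ∫ w, (u j ⬝ᵥ (V w - vstar)) ^ 2 ∂κ +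
        (σlo ^ 2 + β * ∑ j, lam j * ∫ x : A × Round p Θ,
          (u j ⬝ᵥ (qparam q (V x.1) x.2 - V x.1)) ^ 2 ∂(κ.prod (roundLaw ρ ν)) + e)) ≤
      ∫ x, gradDot q S V (u i) x ^ 2 ∂(κ.prod (roundLaw ρ ν)) := by
  obtain ⟨h1, k1, h1', -⟩ := outGrad_split hG
  obtain ⟨h2, k2, h2', -⟩ := preact_split h1
  obtain ⟨h3', -⟩ := qparam_split (vstar := vstar) h2
  obtain ⟨k3, k4⟩ := integral_sq_dot_feature (κ := κ) hF heig i
  have h4 := integral_sq_residual_ge hF hN hO hW heig hL i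
  have h5 := integral_sq_paramErr_ge hF heig hL hQ i
  have h6 : e * lam i ≤ ∫ x : A × Round p Θ, (u i ⬝ᵥ feature q S x.2) ^ 2 *
        q.Qa.errVar (preact q S (V x.1) x.2) ∂(κ.prod (roundLaw ρ ν)) +
      ∫ x : A × Round p Θ, (u i ⬝ᵥ feature q S x.2) ^ 2 *
        q.Qo.errVar (outGrad q S (V x.1) x.2) ∂(κ.prod (roundLaw ρ ν)) := by
    -- The factor `lam i` is E⟨u_i, x̃⟩², so the almost sure bound `e` can be applied under the
    -- integral.
    rw [← k4, ← integral_const_mul, ← integral_add k2 k1]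
    refine integral_mono_ae (k3.const_mul e) (k2.add k1) ?_
    filter_upwards [he] with x hx
    have := mul_le_mul_of_nonneg_left hx (sq_nonneg (u i ⬝ᵥ feature q S x.2))
    linarith
  rw [h1', h2', h3']
  linarith

end OneStepBounds

/-! ### One-step moments under multiplicative quantization -/

section OneStepMultiplicative

variable {p : ℕ∞} {M : ℕ} {Θ : Type*} [MeasurableSpace Θ] {ν : Measure Θ} [IsProbabilityMeasure ν]
  {ρ : Measure ((Coord p → ℝ) × ℝ)} [IsProbabilityMeasure ρ]
  {A : Type*} [MeasurableSpace A] {κ : Measure A} [IsProbabilityMeasure κ]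
  {q : Scheme p M ν} {S : Fin M × Coord p → ℝ} {α β σlo σhi : ℝ} {vstar : Fin M → ℝ}
  {V : A → Fin M → ℝ} {lam : Fin M → ℝ} {u : Fin M → (Fin M → ℝ)} {εp εp' εa εa' εo εo' : ℝ}
  (hF : FourthMomentCondition q S ρ α β) (hN : NoiseCondition q S ρ vstar σlo σhi)
  (hO : IsQuantOptimum q S ρ vstar) (hW : WellSpecified q S ρ vstar)
  (heig : IsEigenDecomposition (Hf q S ρ) lam u) (hV : Measurable V)
  (hL : ∀ j, MemLp (fun w => V w j) 2 κ)
  (hp : q.Qp.IsMultiplicative εp εp') (ha : q.Qa.IsMultiplicative εa εa')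
  (ho : q.Qo.IsMultiplicative εo εo')

include hV hL hp in
theorem memLp_qparam_of_isMultiplicative (j : Fin M) :
    MemLp (fun x : A × Round p Θ => qparam q (V x.1) x.2 j) 2 (κ.prod (roundLaw ρ ν)) := by
  have hm : Measurable fun x : A × Round p Θ => qparam q (V x.1) x.2 :=
    measurable_lift hV measurable_qparam_uncurry
  have hVj : MemLp (fun x : A × Round p Θ => V x.1 j) 2 (κ.prod (roundLaw ρ ν)) :=
    memLp_fst_of (hL j)
  have hb : ∀ v θ, (Pi.single j (1 : ℝ) ⬝ᵥ (q.Qp.toFun θ v - v)) = q.Qp.toFun θ v j - v j :=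
    fun v θ => by rw [single_one_dotProduct, Pi.sub_apply]
  have hd : MemLp (fun x : A × Round p Θ => qparam q (V x.1) x.2 j - V x.1 j) 2
      (κ.prod (roundLaw ρ ν)) := by
    refine memLp_of_resample_var (measurePreserving_reseedSnd ρ (ν := ν) κ 4)
      (B := fun x => εp' * V x.1 j ^ 2)
      ((measurable_pi_iff.1 hm j).aestronglyMeasurable.sub hVj.1) (fun x => ?_)
      (hVj.integrable_sq.const_mul _) (fun x => ?_)
    · have := (hp.integral_dot (Pi.single j 1) (V x.1)).1
      simpa [hb, reseedSnd, qparam] using this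
    · have := (hp.integral_dot (Pi.single j 1) (V x.1)).2.2
      simpa [hb, reseedSnd, qparam] using this
  refine (hd.add hVj).ae_eq (Eventually.of_forall fun x => ?_)
  simp

include hF hN hV hL hp ha ho in
-- Square-integrability passes from the inside out through Q_p, Q_a and Q_o: each error, weighted by
-- ⟨b, x̃⟩, has conditional variance at most a constant times the square of the equally weighted
-- input.
theorem memLp_gradDot_of_isMultiplicative (b : Fin M → ℝ) :
    MemLp (gradDot q S V b) 2 (κ.prod (roundLaw ρ ν)) := by
  have hQ := memLp_qparam_of_isMultiplicative (ρ := ρ) hV hL hp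
  have hb : Measurable fun x : A × Round p Θ => b ⬝ᵥ feature q S x.2 :=
    measurable_dot_feature_snd b
  have hpre : Measurable fun x : A × Round p Θ => preact q S (V x.1) x.2 :=
    measurable_lift hV measurable_preact_uncurry
  have hout : Measurable fun x : A × Round p Θ => outGrad q S (V x.1) x.2 :=
    measurable_lift hV measurable_outGrad_uncurry
  have hqa : Measurable fun x : A × Round p Θ => q.Qa.scalar (x.2.2 5) (preact q S (V x.1) x.2) :=
    q.Qa.measurable_scalar_comp ((measurable_seed 5).comp measurable_snd) hpre
  have hqo : Measurable fun x : A × Round p Θ => q.Qo.scalar (x.2.2 6) (outGrad q S (V x.1) x.2) :=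
    measurable_lift hV measurable_qoutGrad_uncurry
  have h1 : MemLp (fun x : A × Round p Θ => (b ⬝ᵥ feature q S x.2) * preact q S (V x.1) x.2) 2
      (κ.prod (roundLaw ρ ν)) :=
    memLp_dot_mul_dot_of_renew hF hQ (fun x z => qparam_renew x z) b
  have h2 : MemLp (fun x : A × Round p Θ => (b ⬝ᵥ feature q S x.2) *
      (q.Qa.scalar (x.2.2 5) (preact q S (V x.1) x.2) - preact q S (V x.1) x.2)) 2
      (κ.prod (roundLaw ρ ν)) := by
    refine memLp_of_resample_var (measurePreserving_reseedSnd ρ (ν := ν) κ 5)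
      (B := fun x => εa' * ((b ⬝ᵥ feature q S x.2) * preact q S (V x.1) x.2) ^ 2)
      (hb.mul (hqa.sub hpre)).aestronglyMeasurable (fun x => ?_)
      (h1.integrable_sq.const_mul _) (fun x => ?_)
    · have := (ha.errVar (preact q S (V x.1) x.2)).1.const_mul ((b ⬝ᵥ feature q S x.2) ^ 2)
      simpa [reseedSnd, mul_pow] using this
    · have := mul_le_mul_of_nonneg_left (ha.errVar (preact q S (V x.1) x.2)).2.2
        (sq_nonneg (b ⬝ᵥ feature q S x.2))
      rw [Quantizer.errVar, ← integral_const_mul] at this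
      simp only [reseedSnd, feature_reseed_five, preact_reseed_five, reseed_apply_self, mul_pow]
      linarith
  have h3 : MemLp (fun x : A × Round p Θ => (b ⬝ᵥ feature q S x.2) * label q x.2) 2
      (κ.prod (roundLaw ρ ν)) := by
    -- Write the label as ξ + ⟨v*, x̃⟩: the ξ-part is controlled by the noise condition, the rest by
    -- fourth moments of x̃.
    have : MemLp (fun z => (b ⬝ᵥ feature q S z) * label q z) 2 (roundLaw ρ ν) := by
      refine (((hN.memLp_xi_mul_dot b).add (hF.memLp_dot_mul_dot b vstar)).ae_eq
        (Eventually.of_forall fun z => ?_))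
      simp only [xi, Pi.add_apply]; ring
    exact memLp_snd_of this
  have h4 : MemLp (fun x : A × Round p Θ => (b ⬝ᵥ feature q S x.2) * outGrad q S (V x.1) x.2) 2
      (κ.prod (roundLaw ρ ν)) := by
    refine ((h3.sub h1).sub h2).ae_eq (Eventually.of_forall fun x => ?_)
    simp only [outGrad, Pi.sub_apply]; ring
  have h5 : MemLp (fun x : A × Round p Θ => (b ⬝ᵥ feature q S x.2) *
      (q.Qo.scalar (x.2.2 6) (outGrad q S (V x.1) x.2) - outGrad q S (V x.1) x.2)) 2
      (κ.prod (roundLaw ρ ν)) := by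
    refine memLp_of_resample_var (measurePreserving_reseedSnd ρ (ν := ν) κ 6)
      (B := fun x => εo' * ((b ⬝ᵥ feature q S x.2) * outGrad q S (V x.1) x.2) ^ 2)
      (hb.mul (hqo.sub hout)).aestronglyMeasurable (fun x => ?_)
      (h4.integrable_sq.const_mul _) (fun x => ?_)
    · have := (ho.errVar (outGrad q S (V x.1) x.2)).1.const_mul ((b ⬝ᵥ feature q S x.2) ^ 2)
      simpa [reseedSnd, mul_pow] using this
    · have := mul_le_mul_of_nonneg_left (ho.errVar (outGrad q S (V x.1) x.2)).2.2
        (sq_nonneg (b ⬝ᵥ feature q S x.2))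
      rw [Quantizer.errVar, ← integral_const_mul] at this
      simp only [reseedSnd, feature_reseed_six, outGrad_reseed_six, reseed_apply_self, mul_pow]
      linarith
  refine (h4.add h5).ae_eq (Eventually.of_forall fun x => ?_)
  simp only [gradDot, Pi.add_apply]; ring

include hF hN hV hL hp ha ho in
theorem memLp_step_of_isMultiplicative (γ : ℝ) (j : Fin M) :
    MemLp (fun x : A × Round p Θ => step q S γ (V x.1) x.2 j) 2 (κ.prod (roundLaw ρ ν)) := by
  have h := memLp_gradDot_of_isMultiplicative hF hN hV hL hp ha ho (Pi.single j 1)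
  have hVj : MemLp (fun x : A × Round p Θ => V x.1 j) 2 (κ.prod (roundLaw ρ ν)) :=
    memLp_fst_of (hL j)
  refine (hVj.add (h.const_mul γ)).ae_eq (Eventually.of_forall fun x => ?_)
  have := dot_step (q := q) (S := S) (V := V) γ (Pi.single j 1) x
  simp only [single_one_dotProduct] at this
  exact this.symm

include hV hL hp in
theorem integral_sq_dot_paramErr_ge (b : Fin M → ℝ) :
    εp * ∫ w, (b ⬝ᵥ V w) ^ 2 ∂κ ≤
      ∫ x : A × Round p Θ, (b ⬝ᵥ (qparam q (V x.1) x.2 - V x.1)) ^ 2 ∂(κ.prod (roundLaw ρ ν)) := by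
  have hQ := memLp_qparam_of_isMultiplicative (ρ := ρ) hV hL hp
  have hT := measurePreserving_reseedSnd ρ (ν := ν) κ 4
  have hi := (memLp_dotProduct (memLp_paramErr hL hQ) b).integrable_sq
  have hb := (memLp_dotProduct hL b).integrable_sq
  rw [integral_eq_integral_resample hT hi,
    ← integral_comp_of_measurePreserving (f := Prod.fst) (μ := κ.prod (roundLaw ρ ν))
      measurePreserving_fst hb.1, ← integral_const_mul]
  refine integral_mono ((hb.comp_fst (roundLaw ρ ν)).const_mul εp)
    (integrable_integral_resample hT hi) fun x => ?_
  simpa [reseedSnd, qparam] using (hp.integral_dot b (V x.1)).2.1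

include hV hL hp in
theorem integral_sq_dot_qparam_ge (b : Fin M → ℝ) :
    (1 + εp) * ∫ w, (b ⬝ᵥ V w) ^ 2 ∂κ ≤
      ∫ x : A × Round p Θ, (b ⬝ᵥ qparam q (V x.1) x.2) ^ 2 ∂(κ.prod (roundLaw ρ ν)) := by
  have hQ := memLp_qparam_of_isMultiplicative (ρ := ρ) hV hL hp
  have h := (quantizer_split (κ := κ) (ρ := ρ) q.Qp 4 (h := fun _ => 0) (g := fun _ => b)
    (U := fun x => V x.1) (fun _ _ => rfl) (fun _ _ => rfl) (fun _ _ => rfl)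
    (by simp only [zero_add]; exact memLp_dotProduct hQ b)).2.2.1
  simp only [zero_add] at h
  have h2 := integral_sq_dot_paramErr_ge (ρ := ρ) hV hL hp b
  have h3 : ∫ x : A × Round p Θ, (b ⬝ᵥ V x.1) ^ 2 ∂(κ.prod (roundLaw ρ ν)) =
      ∫ w, (b ⬝ᵥ V w) ^ 2 ∂κ :=
    integral_comp_of_measurePreserving (f := Prod.fst) (g := fun w => (b ⬝ᵥ V w) ^ 2)
      measurePreserving_fst (memLp_dotProduct hL b).integrable_sq.1
  rw [h3] at h
  simp only [qparam] at h2 ⊢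
  rw [h]
  linarith

include hF hN hO hW heig hV hL hp ha ho in
/-- Second moment of the stochastic gradient, multiplicative quantization. -/
theorem integral_sq_gradDot_ge_of_isMultiplicative (hεa : 0 ≤ εa) (hεo : 0 ≤ εo)
    (i : Fin M) :
    lam i ^ 2 * ∫ w, (u i ⬝ᵥ (V w - vstar)) ^ 2 ∂κ +
      lam i * (β * ∑ j, lam j * ∫ w, (u j ⬝ᵥ (V w - vstar)) ^ 2 ∂κ +
        ((1 + εo) * σlo ^ 2 + β * (1 + εo) * (εp + (1 + εp) * εa) *
          ∑ j, lam j * ∫ w, (u j ⬝ᵥ V w) ^ 2 ∂κ)) ≤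
      ∫ x, gradDot q S V (u i) x ^ 2 ∂(κ.prod (roundLaw ρ ν)) := by
  have hQ := memLp_qparam_of_isMultiplicative (ρ := ρ) hV hL hp
  have hG := memLp_gradDot_of_isMultiplicative hF hN hV hL hp ha ho (u i)
  obtain ⟨h1, k1, h1', -⟩ := outGrad_split hG
  obtain ⟨h2, k2, h2', -⟩ := preact_split h1
  obtain ⟨h3', -⟩ := qparam_split (vstar := vstar) h2
  have h4 := integral_sq_residual_ge hF hN hO hW heig hL i
  have h5 := integral_sq_paramErr_ge hF heig hL hQ i
  have hlam := hF.lam_nonneg heig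
  have hβ := hF.pos_beta.le
  have h6 : εo * ∫ x : A × Round p Θ, ((u i ⬝ᵥ feature q S x.2) * outGrad q S (V x.1) x.2) ^ 2
        ∂(κ.prod (roundLaw ρ ν)) ≤ ∫ x : A × Round p Θ, (u i ⬝ᵥ feature q S x.2) ^ 2 *
        q.Qo.errVar (outGrad q S (V x.1) x.2) ∂(κ.prod (roundLaw ρ ν)) := by
    rw [← integral_const_mul]
    refine integral_mono (h1.integrable_sq.const_mul _) k1 fun x => ?_
    have := mul_le_mul_of_nonneg_left (ho.errVar (outGrad q S (V x.1) x.2)).2.1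
      (sq_nonneg (u i ⬝ᵥ feature q S x.2))
    simp only [mul_pow]
    linarith
  -- The activation error is proportional to a² = ⟨x̃, Q_p(v)⟩², hence sees the quantized parameter;
  -- this is the source of the product `(1 + εp) * εa`.
  have hpre : MemLp (fun x : A × Round p Θ => (u i ⬝ᵥ feature q S x.2) *
      (feature q S x.2 ⬝ᵥ qparam q (V x.1) x.2)) 2 (κ.prod (roundLaw ρ ν)) :=
    memLp_dot_mul_dot_of_renew hF hQ (fun x z => qparam_renew x z) (u i)
  have h7 : εa * ∫ x : A × Round p Θ, ((u i ⬝ᵥ feature q S x.2) *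
        (feature q S x.2 ⬝ᵥ qparam q (V x.1) x.2)) ^ 2
        ∂(κ.prod (roundLaw ρ ν)) ≤ ∫ x : A × Round p Θ, (u i ⬝ᵥ feature q S x.2) ^ 2 *
        q.Qa.errVar (preact q S (V x.1) x.2) ∂(κ.prod (roundLaw ρ ν)) := by
    rw [← integral_const_mul]
    refine integral_mono (hpre.integrable_sq.const_mul _) k2 fun x => ?_
    have := mul_le_mul_of_nonneg_left (ha.errVar (preact q S (V x.1) x.2)).2.1
      (sq_nonneg (u i ⬝ᵥ feature q S x.2))
    simp only [mul_pow]
    rw [preact] at this ⊢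
    linarith
  have h8 := integral_sq_dot_mul_dot_ge (κ := κ) hF heig
    (F := fun x : A × Round p Θ => qparam q (V x.1) x.2) hQ (fun x z => qparam_renew x z) i
  have h8' : 0 ≤ lam i ^ 2 * ∫ x : A × Round p Θ, (u i ⬝ᵥ qparam q (V x.1) x.2) ^ 2
      ∂(κ.prod (roundLaw ρ ν)) := mul_nonneg (sq_nonneg _) (integral_nonneg fun _ => sq_nonneg _)
  have h9 : (1 + εp) * ∑ j, lam j * ∫ w, (u j ⬝ᵥ V w) ^ 2 ∂κ ≤
      ∑ j, lam j * ∫ x : A × Round p Θ, (u j ⬝ᵥ qparam q (V x.1) x.2) ^ 2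
        ∂(κ.prod (roundLaw ρ ν)) := by
    rw [Finset.mul_sum]
    refine Finset.sum_le_sum fun j _ => ?_
    have := mul_le_mul_of_nonneg_left (integral_sq_dot_qparam_ge (ρ := ρ) hV hL hp (u j)) (hlam j)
    linarith
  have h10 : εp * ∑ j, lam j * ∫ w, (u j ⬝ᵥ V w) ^ 2 ∂κ ≤
      ∑ j, lam j * ∫ x : A × Round p Θ, (u j ⬝ᵥ (qparam q (V x.1) x.2 - V x.1)) ^ 2
        ∂(κ.prod (roundLaw ρ ν)) := by
    rw [Finset.mul_sum]
    refine Finset.sum_le_sum fun j _ => ?_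
    have := mul_le_mul_of_nonneg_left (integral_sq_dot_paramErr_ge (ρ := ρ) hV hL hp (u j))
      (hlam j)
    linarith
  set T := ∑ j, lam j * ∫ w, (u j ⬝ᵥ V w) ^ 2 ∂κ
  set C := ∑ j, lam j * ∫ w, (u j ⬝ᵥ (V w - vstar)) ^ 2 ∂κ with hC
  have hC0 : 0 ≤ C := Finset.sum_nonneg fun j _ =>
    mul_nonneg (hlam j) (integral_nonneg fun _ => sq_nonneg _)
  set c := ∫ w, (u i ⬝ᵥ (V w - vstar)) ^ 2 ∂κ
  have hc0 : 0 ≤ c := integral_nonneg fun _ => sq_nonneg _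
  have hbl : 0 ≤ β * lam i := mul_nonneg hβ (hlam i)
  have h11 := mul_le_mul_of_nonneg_left h9 hbl
  have h12 := mul_le_mul_of_nonneg_left h10 hbl
  have h13 : εa * (β * lam i * ((1 + εp) * T)) ≤ ∫ x : A × Round p Θ,
      (u i ⬝ᵥ feature q S x.2) ^ 2 * q.Qa.errVar (preact q S (V x.1) x.2)
        ∂(κ.prod (roundLaw ρ ν)) :=
    (mul_le_mul_of_nonneg_left (by linarith) hεa).trans h7
  have h14 : σlo ^ 2 * lam i + lam i ^ 2 * c + β * lam i * C + β * lam i * (εp * T) +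
      εa * (β * lam i * ((1 + εp) * T)) ≤
      ∫ x : A × Round p Θ, ((u i ⬝ᵥ feature q S x.2) * outGrad q S (V x.1) x.2) ^ 2
        ∂(κ.prod (roundLaw ρ ν)) := by
    rw [h2', h3']; linarith
  -- The output quantizer multiplies everything by 1 + ε_o. The extra ε_o copies of the two terms in
  -- the current error are dropped, so that the recursion has the same form as in the general case.
  have h15 := mul_le_mul_of_nonneg_left h14 (by linarith : 0 ≤ 1 + εo)
  have h16 : 0 ≤ εo * (lam i ^ 2 * c) := by positivity
  have h17 : 0 ≤ εo * (β * lam i * C) := mul_nonneg hεo (mul_nonneg hbl hC0)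
  rw [h1']
  linarith

end OneStepMultiplicative

/-! ### The SGD run: independence, correlations and the averaged risk -/

section Iterates

variable {p : ℕ∞} {M : ℕ} {Θ : Type*} [MeasurableSpace Θ] {ν : Measure Θ} [IsProbabilityMeasure ν]
  {ρ : Measure ((Coord p → ℝ) × ℝ)} [IsProbabilityMeasure ρ]
  {Ω : Type*} [MeasurableSpace Ω] {P : Measure Ω} [IsProbabilityMeasure P]
  {q : Scheme p M ν} {S : Fin M × Coord p → ℝ} {Z : ℕ → Ω → Round p Θ} {γ : ℝ}

/-- The information in the rounds before round `t`. -/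
abbrev past (Z : ℕ → Ω → Round p Θ) (t : ℕ) : MeasurableSpace Ω :=
  ⨆ i ∈ Set.Iio t, MeasurableSpace.comap (Z i) inferInstance

theorem past_mono {s t : ℕ} (h : s ≤ t) : past Z s ≤ past Z t :=
  biSup_mono fun _ hi => lt_of_lt_of_le hi h

theorem measurable_iterate_past (t : ℕ) : Measurable[past Z t] (iterate q S γ Z t) := by
  induction t with
  | zero => exact measurable_const
  | succ t ih =>
    have h1 : Measurable[past Z (t + 1)] (iterate q S γ Z t) := ih.mono (past_mono t.le_succ) le_rfl
    have h2 : Measurable[past Z (t + 1)] (Z t) :=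
      (comap_measurable (Z t)).mono
        (le_iSup₂_of_le (f := fun i (_ : i ∈ Set.Iio (t + 1)) =>
          MeasurableSpace.comap (Z i) inferInstance) t (Set.mem_Iio.2 t.lt_succ_self) le_rfl) le_rfl
    exact (measurable_step_uncurry (q := q) (S := S) γ).comp (h1.prodMk h2)

variable (hZ : IsSampling P ρ ν Z)

include hZ in
theorem measurable_iterate (t : ℕ) : Measurable (iterate q S γ Z t) :=
  (measurable_iterate_past t).mono (iSup₂_le fun i _ => (hZ.measurable i).comap_le) le_rfl

include hZ in
-- Both iterates are functions of the rounds before `t`. Pairs are needed because the averaged risk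
-- involves correlations of different times.
theorem indepFun_iterate {s t : ℕ} (h : s ≤ t) :
    IndepFun (fun ω => (iterate q S γ Z s ω, iterate q S γ Z t ω)) (Z t) P := by
  have h1 := indep_iSup_of_disjoint (m := fun i => MeasurableSpace.comap (Z i) inferInstance)
    (fun i => (hZ.measurable i).comap_le) hZ.indep (S := Set.Iio t) (T := {t}) (by simp)
  have h2 : Measurable[past Z t] (fun ω => (iterate q S γ Z s ω, iterate q S γ Z t ω)) :=
    ((measurable_iterate_past s).mono (past_mono h) le_rfl).prodMk (measurable_iterate_past t)
  refine indep_of_indep_of_le_left (indep_of_indep_of_le_right h1 ?_) h2.comap_le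
  simp

include hZ in
theorem identDistrib_of_indepFun {B : Type*} [MeasurableSpace B] {W : Ω → B} (hW : Measurable W)
    {t : ℕ} (h : IndepFun W (Z t) P) :
    IdentDistrib (fun ω => (W ω, Z t ω)) (fun x : Ω × Round p Θ => (W x.1, x.2)) P
      (P.prod (roundLaw ρ ν)) where
  aemeasurable_fst := (hW.prodMk (hZ.measurable t)).aemeasurable
  aemeasurable_snd := ((hW.comp measurable_fst).prodMk measurable_snd).aemeasurable
  map_eq := by
    rw [(indepFun_iff_map_prod_eq_prod_map_map hW.aemeasurable
      (hZ.measurable t).aemeasurable).1 h, hZ.law t]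
    have := Measure.map_prod_map P (roundLaw ρ ν) hW measurable_id
    rw [Measure.map_id] at this
    exact this

include hZ in
/-- The pair of past iterates and the current round has a product law. -/
theorem identDistrib_iterate {s t : ℕ} (h : s ≤ t) {E : Type*} [MeasurableSpace E]
    {f : ((Fin M → ℝ) × (Fin M → ℝ)) × Round p Θ → E} (hf : Measurable f) :
    IdentDistrib (fun ω => f ((iterate q S γ Z s ω, iterate q S γ Z t ω), Z t ω))
      (fun x : Ω × Round p Θ => f ((iterate q S γ Z s x.1, iterate q S γ Z t x.1), x.2)) P
      (P.prod (roundLaw ρ ν)) :=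
  (identDistrib_of_indepFun hZ ((measurable_iterate hZ s).prodMk (measurable_iterate hZ t))
    (indepFun_iterate hZ h)).comp hf

include hZ in
theorem identDistrib_lift {t : ℕ} {E : Type*} [MeasurableSpace E]
    {f : (Fin M → ℝ) × Round p Θ → E} (hf : Measurable f) :
    IdentDistrib (fun ω => f (iterate q S γ Z t ω, Z t ω))
      (fun x : Ω × Round p Θ => f (iterate q S γ Z t x.1, x.2)) P
      (P.prod (roundLaw ρ ν)) :=
  identDistrib_iterate hZ (le_refl t) (f := fun y => f (y.1.2, y.2))
    (hf.comp ((measurable_snd.comp measurable_fst).prodMk measurable_snd))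

variable {α β σlo σhi : ℝ} {vstar : Fin M → ℝ} {lam : Fin M → ℝ} {u : Fin M → (Fin M → ℝ)}
  (hF : FourthMomentCondition q S ρ α β) (hN : NoiseCondition q S ρ vstar σlo σhi)
  (hO : IsQuantOptimum q S ρ vstar) (hW : WellSpecified q S ρ vstar)
  (heig : IsEigenDecomposition (Hf q S ρ) lam u) {N : ℕ}

theorem memLp_iterate_sub (h2 : FiniteSecondMoments q S P γ Z N) {t : ℕ} (ht : t < N)
    (b : Fin M → ℝ) : MemLp (fun ω => b ⬝ᵥ (iterate q S γ Z t ω - vstar)) 2 P :=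
  memLp_dotProduct (memLp_sub_const (fun j => (h2 t ht j).1) vstar) b

include hZ in
-- The gradient in direction `b` is the difference of consecutive iterates divided by γ. Both must
-- lie in the range where second moments are known, whence `t + 1 < N`.
theorem memLp_gradDot (hγ : 0 < γ) (h2 : FiniteSecondMoments q S P γ Z N) {t : ℕ}
    (ht : t + 1 < N) (b : Fin M → ℝ) :
    MemLp (gradDot q S (iterate q S γ Z t) b) 2 (P.prod (roundLaw ρ ν)) := by
  have h1 : ∀ j, MemLp (fun x : Ω × Round p Θ => step q S γ (iterate q S γ Z t x.1) x.2 j) 2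
      (P.prod (roundLaw ρ ν)) := fun j =>
    (identDistrib_lift hZ (f := fun y => step q S γ y.1 y.2 j)
      (measurable_pi_iff.1 (measurable_step_uncurry γ) j)).memLp_iff.1 (h2 (t + 1) ht j).1
  have h3 : ∀ j, MemLp (fun x : Ω × Round p Θ => iterate q S γ Z t x.1 j) 2
      (P.prod (roundLaw ρ ν)) := fun j => memLp_fst_of (h2 t (by omega) j).1
  refine (((memLp_dotProduct h1 b).sub (memLp_dotProduct h3 b)).const_mul γ⁻¹).ae_eq
    (Eventually.of_forall fun x => ?_)
  simp only [Pi.sub_apply, dot_step]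
  field_simp
  ring

include hZ in
theorem memLp_qparam_prod (h2 : FiniteSecondMoments q S P γ Z N) {t : ℕ} (ht : t < N) (j : Fin M) :
    MemLp (fun x : Ω × Round p Θ => qparam q (iterate q S γ Z t x.1) x.2 j) 2
      (P.prod (roundLaw ρ ν)) :=
  (identDistrib_lift hZ (f := fun y => qparam q y.1 y.2 j)
    (measurable_pi_iff.1 measurable_qparam_uncurry j)).memLp_iff.1 (h2 t ht j).2

include hZ hF hN hO hW heig in
theorem integral_cross_succ (hγ : 0 < γ) (h2 : FiniteSecondMoments q S P γ Z N) {s t : ℕ}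
    (hst : s ≤ t) (ht : t + 1 < N) (i : Fin M) {g : (Fin M → ℝ) → ℝ} (hg : Measurable g)
    (hgL : MemLp (fun ω => g (iterate q S γ Z s ω)) 2 P) :
    ∫ ω, g (iterate q S γ Z s ω) * (u i ⬝ᵥ (iterate q S γ Z (t + 1) ω - vstar)) ∂P =
      (1 - γ * lam i) *
        ∫ ω, g (iterate q S γ Z s ω) * (u i ⬝ᵥ (iterate q S γ Z t ω - vstar)) ∂P := by
  have hL : ∀ j, MemLp (fun ω => iterate q S γ Z t ω j) 2 P := fun j => (h2 t (by omega) j).1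
  rw [← integral_mul_dot_step hF hN hO hW heig hL γ (memLp_gradDot hZ hγ h2 ht (u i)) hgL]
  exact (identDistrib_iterate hZ hst
    (f := fun y => g y.1.1 * (u i ⬝ᵥ (step q S γ y.1.2 y.2 - vstar)))
    ((hg.comp (measurable_fst.comp measurable_fst)).mul (measurable_dot measurable_const
      (((measurable_step_uncurry γ).comp ((measurable_snd.comp measurable_fst).prodMk
        measurable_snd)).sub measurable_const)))).integral_eq

include hZ hF hN hO hW heig in
-- The test function `g` covers two uses: `g = 1` gives the mean of the error, and `g v = ⟨u_i, v -
-- v*⟩` gives its autocorrelation.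
theorem integral_cross (hγ : 0 < γ) (h2 : FiniteSecondMoments q S P γ Z N) {s : ℕ} (k : ℕ)
    (ht : s + k < N) (i : Fin M) {g : (Fin M → ℝ) → ℝ} (hg : Measurable g)
    (hgL : MemLp (fun ω => g (iterate q S γ Z s ω)) 2 P) :
    ∫ ω, g (iterate q S γ Z s ω) * (u i ⬝ᵥ (iterate q S γ Z (s + k) ω - vstar)) ∂P =
      (1 - γ * lam i) ^ k *
        ∫ ω, g (iterate q S γ Z s ω) * (u i ⬝ᵥ (iterate q S γ Z s ω - vstar)) ∂P := by
  induction k with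
  | zero => simp
  | succ k ih =>
    rw [← Nat.add_assoc, integral_cross_succ hZ hF hN hO hW heig hγ h2 (Nat.le_add_right s k)
      (by omega) i hg hgL, ih (by omega), pow_succ]
    ring

/-- The second moment of the error of iterate `t` in direction `u i`. -/
noncomputable def errSq (q : Scheme p M ν) (S : Fin M × Coord p → ℝ) (P : Measure Ω) (γ : ℝ)
    (Z : ℕ → Ω → Round p Θ) (vstar : Fin M → ℝ) (u : Fin M → (Fin M → ℝ)) (t : ℕ) (i : Fin M) : ℝ :=
  ∫ ω, (u i ⬝ᵥ (iterate q S γ Z t ω - vstar)) ^ 2 ∂P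

theorem errSq_nonneg (t : ℕ) (i : Fin M) : 0 ≤ errSq q S P γ Z vstar u t i :=
  integral_nonneg fun _ => sq_nonneg _

theorem errSq_zero (i : Fin M) : errSq q S P γ Z vstar u 0 i = (u i ⬝ᵥ vstar) ^ 2 := by
  simp [errSq, iterate]

include hZ hF hN hO hW heig in
theorem errSq_succ (hγ : 0 < γ) (h2 : FiniteSecondMoments q S P γ Z N) {t : ℕ}
    (ht : t + 1 < N) (i : Fin M) :
    errSq q S P γ Z vstar u (t + 1) i = (1 - 2 * γ * lam i) * errSq q S P γ Z vstar u t i +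
      γ ^ 2 * ∫ x, gradDot q S (iterate q S γ Z t) (u i) x ^ 2 ∂(P.prod (roundLaw ρ ν)) := by
  have hL : ∀ j, MemLp (fun ω => iterate q S γ Z t ω j) 2 P := fun j => (h2 t (by omega) j).1
  rw [errSq, errSq,
    ← integral_sq_dot_step hF hN hO hW heig hL γ (memLp_gradDot hZ hγ h2 ht (u i))]
  exact (identDistrib_lift hZ (f := fun y => (u i ⬝ᵥ (step q S γ y.1 y.2 - vstar)) ^ 2)
    ((measurable_dot measurable_const
      ((measurable_step_uncurry γ).sub measurable_const)).pow_const 2)).integral_eq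

include hZ hF hN hO hW heig in
theorem integral_dot_iterate (hγ : 0 < γ) (h2 : FiniteSecondMoments q S P γ Z N) {t : ℕ}
    (ht : t < N) (i : Fin M) :
    ∫ ω, u i ⬝ᵥ (iterate q S γ Z t ω - vstar) ∂P = -(1 - γ * lam i) ^ t * (u i ⬝ᵥ vstar) := by
  have h := integral_cross hZ hF hN hO hW heig hγ h2 (s := 0) t (by omega) i (g := fun _ => 1)
    measurable_const (memLp_const 1)
  simp only [one_mul, zero_add] at h
  rw [h]
  simp [iterate]

include hZ hF hN hO hW heig in
theorem integral_sq_dot_iterate (hγ : 0 < γ) (h2 : FiniteSecondMoments q S P γ Z N) {t : ℕ}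
    (ht : t < N) (i : Fin M) :
    ∫ ω, (u i ⬝ᵥ iterate q S γ Z t ω) ^ 2 ∂P = errSq q S P γ Z vstar u t i +
      (u i ⬝ᵥ vstar) ^ 2 * (1 - 2 * (1 - γ * lam i) ^ t) := by
  have hη := memLp_iterate_sub (vstar := vstar) h2 ht (u i)
  have e : ∀ ω, (u i ⬝ᵥ iterate q S γ Z t ω) ^ 2 = (u i ⬝ᵥ (iterate q S γ Z t ω - vstar)) ^ 2 +
      2 * (u i ⬝ᵥ vstar) * (u i ⬝ᵥ (iterate q S γ Z t ω - vstar)) + (u i ⬝ᵥ vstar) ^ 2 :=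
    fun ω => by rw [dotProduct_sub]; ring
  have i1 := hη.integrable (by norm_num : (1 : ENNReal) ≤ 2)
  have i2 : Integrable (fun ω => (u i ⬝ᵥ (iterate q S γ Z t ω - vstar)) ^ 2 +
      2 * (u i ⬝ᵥ vstar) * (u i ⬝ᵥ (iterate q S γ Z t ω - vstar))) P :=
    hη.integrable_sq.add (i1.const_mul _)
  simp_rw [e]
  rw [integral_add i2 (integrable_const _), integral_add hη.integrable_sq (i1.const_mul _),
    integral_const_mul, integral_dot_iterate hZ hF hN hO hW heig hγ h2 ht, errSq]
  simp
  ring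

include hZ hF hN hO hW heig in
/-- The averaged excess risk in terms of the second moments of the iterates. -/
theorem RN0_ge (hγ : 0 < γ) (hγlam : ∀ i, γ * lam i < 1) (hNpos : 0 < N)
    (h2 : FiniteSecondMoments q S P γ Z N) :
    1 / (2 * (N : ℝ) ^ 2) * ∑ i, lam i * ∑ s ∈ Finset.range N, errSq q S P γ Z vstar u s i *
      ∑ k ∈ Finset.range (N - s), (1 - γ * lam i) ^ k ≤ RN0 q S ρ P γ Z vstar N := by
  have hNr : (N : ℝ) ≠ 0 := by positivity
  have hL : ∀ t ∈ Finset.range N, ∀ b, MemLp (fun ω => b ⬝ᵥ (iterate q S γ Z t ω - vstar)) 2 P :=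
    fun t ht b => memLp_iterate_sub h2 (Finset.mem_range.1 ht) b
  have havg : ∀ ω, average q S γ Z N ω - vstar =
      (1 / (N : ℝ)) • ∑ t ∈ Finset.range N, (iterate q S γ Z t ω - vstar) := fun ω => by
    rw [average, Finset.sum_sub_distrib, smul_sub, Finset.sum_const, Finset.card_range,
      ← Nat.cast_smul_eq_nsmul ℝ, smul_smul, one_div, inv_mul_cancel₀ hNr, one_smul]
  have havgL : ∀ b, MemLp (fun ω => b ⬝ᵥ (average q S γ Z N ω - vstar)) 2 P := fun b => by
    simp only [havg, dotProduct_smul, dotProduct_sum, smul_eq_mul]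
    exact (memLp_finsetSum _ fun t ht => hL t ht b).const_mul _
  have hint : ∀ k l, Integrable (fun ω => (1 : ℝ) *
      ((average q S γ Z N ω - vstar) k * (average q S γ Z N ω - vstar) l)) P := fun k l => by
    have hk := havgL (Pi.single k 1)
    have hl := havgL (Pi.single l 1)
    simp only [single_one_dotProduct] at hk hl
    simp only [one_mul]
    exact hk.integrable_mul hl
  have hR : RN0 q S ρ P γ Z vstar N =
      1 / 2 * ∑ i, lam i * ∫ ω, (u i ⬝ᵥ (average q S γ Z N ω - vstar)) ^ 2 ∂P := by
    rw [RN0, heig.transpose_eq, heig.trace_mul]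
    congr 1
    refine Finset.sum_congr rfl fun i _ => ?_
    have := (integral_mul_dot_mul_dot hint (u i) (u i)).2
    simp only [one_mul, ← sq] at this
    rw [← this]
    rfl
  have hmain : ∀ i, 1 / (N : ℝ) ^ 2 * ∑ s ∈ Finset.range N, errSq q S P γ Z vstar u s i *
      ∑ k ∈ Finset.range (N - s), (1 - γ * lam i) ^ k ≤
      ∫ ω, (u i ⬝ᵥ (average q S γ Z N ω - vstar)) ^ 2 ∂P := fun i => by
    have ha : 0 ≤ 1 - γ * lam i := by linarith [hγlam i]
    have hcross : ∀ s k, s + k < N →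
        ∫ ω, (u i ⬝ᵥ (iterate q S γ Z s ω - vstar)) * (u i ⬝ᵥ (iterate q S γ Z (s + k) ω - vstar))
          ∂P = (1 - γ * lam i) ^ k * errSq q S P γ Z vstar u s i := fun s k hk => by
      have := integral_cross hZ hF hN hO hW heig hγ h2 k hk i
        (g := fun v => u i ⬝ᵥ (v - vstar))
        (measurable_dot measurable_const (measurable_id.sub measurable_const))
        (memLp_iterate_sub h2 (by omega) (u i))
      simpa only [errSq, sq] using this
    -- Nonnegativity, which rests on γλ ≤ 1, allows the pairs with t < s to be dropped from the
    -- double sum.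
    have hcross0 : ∀ s ∈ Finset.range N, ∀ t ∈ Finset.range N,
        0 ≤ ∫ ω, (u i ⬝ᵥ (iterate q S γ Z s ω - vstar)) *
          (u i ⬝ᵥ (iterate q S γ Z t ω - vstar)) ∂P := fun s hs t ht => by
      rw [Finset.mem_range] at hs ht
      rcases le_total s t with h | h
      · obtain ⟨k, rfl⟩ := Nat.exists_eq_add_of_le h
        rw [hcross s k ht]
        exact mul_nonneg (pow_nonneg ha k) (errSq_nonneg s i)
      · obtain ⟨k, rfl⟩ := Nat.exists_eq_add_of_le h
        simp only [mul_comm (u i ⬝ᵥ (iterate q S γ Z (t + k) _ - vstar))]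
        rw [hcross t k hs]
        exact mul_nonneg (pow_nonneg ha k) (errSq_nonneg t i)
    have e : ∀ ω, (u i ⬝ᵥ (average q S γ Z N ω - vstar)) ^ 2 = 1 / (N : ℝ) ^ 2 *
        ∑ s ∈ Finset.range N, ∑ t ∈ Finset.range N, (u i ⬝ᵥ (iterate q S γ Z s ω - vstar)) *
          (u i ⬝ᵥ (iterate q S γ Z t ω - vstar)) := fun ω => by
      rw [havg, dotProduct_smul, dotProduct_sum, ← Finset.sum_mul_sum, smul_eq_mul]
      field_simp
    have hi : ∀ s ∈ Finset.range N, ∀ t ∈ Finset.range N, Integrable (fun ω =>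
        (u i ⬝ᵥ (iterate q S γ Z s ω - vstar)) * (u i ⬝ᵥ (iterate q S γ Z t ω - vstar))) P :=
      fun s hs t ht => (hL s hs (u i)).integrable_mul (hL t ht (u i))
    simp_rw [e]
    rw [integral_const_mul, integral_finsetSum _ fun s hs => integrable_finsetSum _ (hi s hs)]
    refine mul_le_mul_of_nonneg_left (Finset.sum_le_sum fun s hs => ?_) (by positivity)
    rw [integral_finsetSum _ (hi s hs)]
    rw [Finset.mem_range] at hs
    calc errSq q S P γ Z vstar u s i * ∑ k ∈ Finset.range (N - s), (1 - γ * lam i) ^ k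
        = ∑ k ∈ Finset.range (N - s), ∫ ω, (u i ⬝ᵥ (iterate q S γ Z s ω - vstar)) *
          (u i ⬝ᵥ (iterate q S γ Z (s + k) ω - vstar)) ∂P := by
          rw [Finset.mul_sum]
          refine Finset.sum_congr rfl fun k hk => ?_
          rw [hcross s k (by have := Finset.mem_range.1 hk; omega), mul_comm]
      _ = ∑ t ∈ Finset.Ico s N, ∫ ω, (u i ⬝ᵥ (iterate q S γ Z s ω - vstar)) *
          (u i ⬝ᵥ (iterate q S γ Z t ω - vstar)) ∂P := by
          rw [Finset.sum_Ico_eq_sum_range]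
      _ ≤ _ := by
          refine Finset.sum_le_sum_of_subset_of_nonneg (fun t ht => ?_) fun t ht _ =>
            hcross0 s (Finset.mem_range.2 hs) t ht
          exact Finset.mem_range.2 (Finset.mem_Ico.1 ht).2
  rw [hR]
  calc _ = 1 / 2 * ∑ i, lam i * (1 / (N : ℝ) ^ 2 * ∑ s ∈ Finset.range N,
        errSq q S P γ Z vstar u s i * ∑ k ∈ Finset.range (N - s), (1 - γ * lam i) ^ k) := by
        rw [Finset.mul_sum, Finset.mul_sum]
        refine Finset.sum_congr rfl fun i _ => ?_
        field_simp
    _ ≤ _ := by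
        refine mul_le_mul_of_nonneg_left (Finset.sum_le_sum fun i _ => ?_) (by norm_num)
        exact mul_le_mul_of_nonneg_left (hmain i) (hF.lam_nonneg heig i)

end Iterates

/-! ### Scalar recursions, kernels and polynomial weights -/

section ScalarRecursions

/-- The kernel `∑_{s < n} a^(2 s) (1 - a^(n - s))`. -/
def kern (a : ℝ) (n : ℕ) : ℝ := ∑ s ∈ Finset.range n, a ^ (2 * s) * (1 - a ^ (n - s))

theorem kern_succ (a : ℝ) (n : ℕ) : kern a (n + 1) = (1 - a ^ (n + 1)) + a ^ 2 * kern a n := by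
  rw [kern, Finset.sum_range_succ', kern, Finset.mul_sum, add_comm]
  congr 1
  · simp
  · refine Finset.sum_congr rfl fun s _ => ?_
    rw [Nat.add_sub_add_right]; ring

theorem kern_closed (a : ℝ) (n : ℕ) :
    (1 - a ^ 2) * kern a n = (1 - a ^ n) * (1 - a ^ (n + 1)) := by
  induction n with
  | zero => simp [kern]
  | succ n ih =>
    rw [kern_succ, mul_add, mul_left_comm, ih]; ring

theorem kern_nonneg {a : ℝ} (h0 : 0 ≤ a) (h1 : a ≤ 1) (n : ℕ) : 0 ≤ kern a n :=
  Finset.sum_nonneg fun _ _ => mul_nonneg (pow_nonneg h0 _)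
    (sub_nonneg.2 (pow_le_one₀ h0 h1))

/-- Linear response: one unit present at time s decays at least like a^(2k), so with n times left it
contributes `kern a n` to the weighted sum; noise injected at time s + k first appears one step
later, hence `n - 1 - k`. -/
theorem weighted_sum_ge {a : ℝ} (h0 : 0 ≤ a) (h1 : a ≤ 1) {c E : ℕ → ℝ} {N : ℕ}
    (hrec : ∀ t, t + 1 < N → a ^ 2 * c t + E t ≤ c (t + 1)) (n : ℕ) :
    ∀ s, s + n ≤ N → c s * kern a n + ∑ k ∈ Finset.range n, E (s + k) * kern a (n - 1 - k) ≤
      ∑ k ∈ Finset.range n, c (s + k) * (1 - a ^ (n - k)) := by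
  induction n with
  | zero => intro _ _; simp [kern]
  | succ n ih =>
    intro s hs
    have h := ih (s + 1) (by omega)
    rw [Finset.sum_range_succ' (fun k => c (s + k) * (1 - a ^ (n + 1 - k))),
      Finset.sum_range_succ' (fun k => E (s + k) * kern a (n + 1 - 1 - k)), kern_succ]
    have e1 : ∀ k, c (s + (k + 1)) * (1 - a ^ (n + 1 - (k + 1))) =
        c (s + 1 + k) * (1 - a ^ (n - k)) := fun k => by
      rw [Nat.add_sub_add_right, show s + (k + 1) = s + 1 + k by ring]
    have e2 : ∀ k, E (s + (k + 1)) * kern a (n + 1 - 1 - (k + 1)) =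
        E (s + 1 + k) * kern a (n - 1 - k) := fun k => by
      rw [show s + (k + 1) = s + 1 + k by ring, show n + 1 - 1 - (k + 1) = n - 1 - k by omega]
    simp only [e1, e2]
    simp only [Nat.add_zero, Nat.sub_zero, Nat.add_sub_cancel]
    have h3 : (a ^ 2 * c s + E s) * kern a n ≤ c (s + 1) * kern a n := by
      -- For `n = 0` the recursion may be unavailable, as `s + 1 = N` is possible; the kernel is
      -- then zero.
      rcases n with - | n
      · simp [kern]
      · exact mul_le_mul_of_nonneg_right (hrec s (by omega)) (kern_nonneg h0 h1 _)
    linarith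

/-- Replace δ by the smaller η = min(1, Nδ)/N, for which mη ≤ K. Bernoulli for (1 + η)^m and (1 -
η)^m (1 + η)^m ≤ 1 give (1 - η)^m ≤ 1/(1 + mη), and mη/(1 + mη) ≥ mη/(1 + K). -/
theorem one_sub_pow_ge {δ : ℝ} (h0 : 0 ≤ δ) (h1 : δ ≤ 1) {N : ℕ} (hN : 0 < N) {K : ℝ} (hK : 0 ≤ K)
    {m : ℕ} (hm : (m : ℝ) ≤ K * N) :
    m * min 1 (N * δ) / ((1 + K) * N) ≤ 1 - (1 - δ) ^ m := by
  have hNr : (0 : ℝ) < N := by exact_mod_cast hN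
  set μ := min 1 (N * δ) with hμ
  have hμ0 : 0 ≤ μ := le_min zero_le_one (by positivity)
  have hμ1 : μ ≤ 1 := min_le_left _ _
  set η := μ / N with hη
  have hη0 : 0 ≤ η := by positivity
  have hηδ : η ≤ δ := by
    rw [hη, div_le_iff₀ hNr, mul_comm]; exact min_le_right _ _
  have hmη0 : 0 ≤ m * η := by positivity
  have hmηK : m * η ≤ K := by
    rw [hη, mul_div_assoc', div_le_iff₀ hNr]
    calc (m : ℝ) * μ ≤ m * 1 := by gcongr
      _ ≤ K * N := by linarith
  have h2 : (1 - δ) ^ m ≤ (1 - η) ^ m := pow_le_pow_left₀ (by linarith) (by linarith) m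
  have h3 : (1 - η) ^ m * (1 + m * η) ≤ 1 := by
    calc (1 - η) ^ m * (1 + m * η) ≤ (1 - η) ^ m * (1 + η) ^ m :=
          mul_le_mul_of_nonneg_left (one_add_mul_le_pow (by linarith) m)
            (pow_nonneg (by linarith) m)
      _ = (1 - η ^ 2) ^ m := by rw [← mul_pow]; ring
      _ ≤ 1 := pow_le_one₀ (by nlinarith) (by nlinarith)
  have h4 : (1 - η) ^ m ≤ 1 / (1 + m * η) := by
    rw [le_div_iff₀ (by linarith)]; exact h3
  have h5 : m * η / (1 + K) ≤ 1 - 1 / (1 + m * η) := by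
    rw [one_sub_div (by linarith), add_sub_cancel_left]
    exact div_le_div_of_nonneg_left hmη0 (by linarith) (by linarith)
  calc m * μ / ((1 + K) * N) = m * η / (1 + K) := by rw [hη]; field_simp
    _ ≤ _ := by linarith

/-- In `kern_closed` one has 1 - a² ≤ 2δ, and each of the two factors on the right is bounded by
`one_sub_pow_ge` with K = 1; the constant 8 is 2 · 2 · 2. -/
theorem kern_ge {δ : ℝ} (h0 : 0 ≤ δ) (h1 : δ ≤ 1) {N : ℕ} (hN : 0 < N) {n : ℕ} (hn : n + 1 ≤ N) :
    min 1 (N * δ) ^ 2 * (n * (n + 1)) / (8 * N ^ 2) ≤ δ * kern (1 - δ) n := by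
  have hNr : (0 : ℝ) < N := by exact_mod_cast hN
  have hn' : (n : ℝ) + 1 ≤ N := by exact_mod_cast hn
  have e1 := one_sub_pow_ge h0 h1 hN zero_le_one (m := n) (by linarith)
  have e2 := one_sub_pow_ge h0 h1 hN zero_le_one (m := n + 1) (by push_cast; linarith)
  have hc := kern_closed (1 - δ) n
  have hk := mul_nonneg h0 (kern_nonneg (sub_nonneg.2 h1) (by linarith) n)
  set μ := min 1 (N * δ) with hμ
  have hμ0 : 0 ≤ μ := le_min zero_le_one (by positivity)
  have h3 : n * μ / ((1 + 1) * N) * ((n + 1 : ℕ) * μ / ((1 + 1) * N)) ≤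
      (1 - (1 - δ) ^ n) * (1 - (1 - δ) ^ (n + 1)) :=
    mul_le_mul e1 e2 (by positivity) (le_trans (by positivity) e1)
  rw [← hc] at h3
  have e : μ ^ 2 * (n * (n + 1)) / (8 * N ^ 2) =
      (n * μ / ((1 + 1) * N) * ((n + 1 : ℕ) * μ / ((1 + 1) * N))) / 2 := by
    push_cast; field_simp; norm_num; ring
  rw [e]
  nlinarith

theorem kern_self_ge {δ : ℝ} (h0 : 0 ≤ δ) (h1 : δ ≤ 1) {N : ℕ} (hN : 0 < N) :
    min 1 (N * δ) ^ 2 / 8 ≤ δ * kern (1 - δ) N := by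
  have hNr : (0 : ℝ) < N := by exact_mod_cast hN
  have e1 := one_sub_pow_ge h0 h1 hN zero_le_one (m := N) (by linarith)
  -- The exponent N + 1 is out of range for K = 1, so monotonicity in the exponent replaces the
  -- second application.
  have e2 : 1 - (1 - δ) ^ N ≤ 1 - (1 - δ) ^ (N + 1) :=
    sub_le_sub_left (pow_le_pow_of_le_one (by linarith) (by linarith) N.le_succ) 1
  have hc := kern_closed (1 - δ) N
  have hk := mul_nonneg h0 (kern_nonneg (sub_nonneg.2 h1) (by linarith) N)
  set μ := min 1 (N * δ) with hμ
  have hμ0 : 0 ≤ μ := le_min zero_le_one (by positivity)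
  have e3 : μ / 2 ≤ 1 - (1 - δ) ^ N := by
    refine le_trans (le_of_eq ?_) e1
    field_simp; norm_num
  have h3 : μ / 2 * (μ / 2) ≤ (1 - (1 - δ) ^ N) * (1 - (1 - δ) ^ (N + 1)) :=
    mul_le_mul e3 (e3.trans e2) (by positivity) (le_trans (by positivity) e3)
  rw [← hc] at h3
  nlinarith

/-- The weights are n(n+1) at n = N - 1 - r, as produced by `kern_ge`. Keeping `X` apart from the
number of terms makes the induction possible. -/
theorem sum_weights (X : ℝ) (k : ℕ) : ∑ r ∈ Finset.range k, (X - 1 - r) * (X - r) =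
    X * (X - 1) * k - (2 * X - 1) * (k * (k - 1) / 2) + k * (k - 1) * (2 * k - 1) / 6 := by
  induction k with
  | zero => simp
  | succ k ih => rw [Finset.sum_range_succ, ih]; push_cast; ring

theorem sum_mul_weights (X : ℝ) (k : ℕ) : ∑ r ∈ Finset.range k, r * ((X - 1 - r) * (X - r)) =
    X * (X - 1) * (k * (k - 1) / 2) - (2 * X - 1) * (k * (k - 1) * (2 * k - 1) / 6) +
      (k * (k - 1) / 2) ^ 2 := by
  induction k with
  | zero => simp
  | succ k ih => rw [Finset.sum_range_succ, ih]; push_cast; ring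

theorem sum_sq_mul_weights (X : ℝ) (k : ℕ) :
    ∑ r ∈ Finset.range k, (r : ℝ) ^ 2 * ((X - 1 - r) * (X - r)) =
    X * (X - 1) * (k * (k - 1) * (2 * k - 1) / 6) - (2 * X - 1) * (k * (k - 1) / 2) ^ 2 +
      k * (k - 1) * (2 * k - 1) * (3 * k ^ 2 - 3 * k - 1) / 30 := by
  induction k with
  | zero => simp
  | succ k ih => rw [Finset.sum_range_succ, ih]; push_cast; ring

variable {N : ℕ}

/-- The leading coefficient is 1/3 here, and 1/12 and 1/30 for the two analogues below. The factors
16 are there to cancel the 16 in `risk_ge`. -/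
theorem sum_weights_ge (hN : 500 < N) :
    16 / 50 * (N : ℝ) ^ 3 ≤ ∑ r ∈ Finset.range N, ((N : ℝ) - 1 - r) * (N - r) := by
  have hNr : (500 : ℝ) < N := by exact_mod_cast hN
  rw [sum_weights]
  have : (0 : ℝ) ≤ N * ((N - 500) * (N + 500)) := by
    refine mul_nonneg (by linarith) (mul_nonneg (by linarith) (by linarith))
  nlinarith

theorem sum_mul_weights_ge (hN : 500 < N) :
    16 * (N : ℝ) ^ 4 * 3 / 600 ≤ ∑ r ∈ Finset.range N, r * (((N : ℝ) - 1 - r) * (N - r)) := by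
  have hNr : (500 : ℝ) < N := by exact_mod_cast hN
  rw [sum_mul_weights]
  -- After this shift the difference of the two sides is a polynomial in x > 0 whose positivity is
  -- visible from its coefficients.
  obtain ⟨x, hx⟩ : ∃ x : ℝ, (N : ℝ) = x + 500 := ⟨N - 500, by ring⟩
  have hx0 : 0 < x := by linarith
  rw [hx, ← sub_nonneg]
  ring_nf
  positivity

theorem sum_sq_mul_weights_ge (hN : 500 < N) :
    16 * (N : ℝ) ^ 5 * 4 / 2500 ≤
      ∑ r ∈ Finset.range N, (r : ℝ) ^ 2 * (((N : ℝ) - 1 - r) * (N - r)) := by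
  have hNr : (500 : ℝ) < N := by exact_mod_cast hN
  rw [sum_sq_mul_weights]
  obtain ⟨x, hx⟩ : ∃ x : ℝ, (N : ℝ) = x + 500 := ⟨N - 500, by ring⟩
  have hx0 : 0 < x := by linarith
  rw [hx, ← sub_nonneg]
  ring_nf
  positivity

theorem sum_geom_sq_ge {δ : ℝ} (h0 : 0 ≤ δ) (h1 : δ ≤ 1) (r : ℕ) :
    (1 - (1 - δ) ^ (2 * r)) / 2 ≤ δ * ∑ k ∈ Finset.range r, (1 - δ) ^ (2 * k) := by
  have h := mul_neg_geom_sum ((1 - δ) ^ 2) r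
  simp only [← pow_mul] at h
  have hs : 0 ≤ ∑ k ∈ Finset.range r, (1 - δ) ^ (2 * k) :=
    Finset.sum_nonneg fun k _ => pow_nonneg (by linarith) _
  rw [← h]
  nlinarith [mul_nonneg (mul_nonneg h0 h0) hs]

/-- Keep only r < ⌊N/2⌋, where the weight is at least N²/4. The geometric sum over that range is at
least μ/10 after multiplication by δ, and 1/40 exceeds 16/1000. -/
theorem sum_decay_weights_ge {δ : ℝ} (h0 : 0 ≤ δ) (h1 : δ ≤ 1) (hN : 500 < N) :
    16 / 1000 * (N : ℝ) ^ 2 * min 1 (N * δ) ≤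
      δ * ∑ r ∈ Finset.range N, (1 - δ) ^ (2 * r) * (((N : ℝ) - 1 - r) * (N - r)) := by
  have hNr : (500 : ℝ) < N := by exact_mod_cast hN
  set K := N / 2 with hK
  have hK1 : 2 * (K : ℝ) ≤ N := by exact_mod_cast (by omega : 2 * K ≤ N)
  have hK2 : (N : ℝ) - 1 ≤ 2 * K := by
    have : (N : ℝ) ≤ 2 * K + 1 := by exact_mod_cast (by omega : N ≤ 2 * K + 1)
    linarith
  set μ := min 1 (N * δ) with hμ
  have hμ0 : 0 ≤ μ := le_min zero_le_one (by positivity)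
  have hsub : ∑ r ∈ Finset.range K, (1 - δ) ^ (2 * r) * ((N : ℝ) ^ 2 / 4) ≤
      ∑ r ∈ Finset.range N, (1 - δ) ^ (2 * r) * (((N : ℝ) - 1 - r) * (N - r)) := by
    calc _ ≤ ∑ r ∈ Finset.range K, (1 - δ) ^ (2 * r) * (((N : ℝ) - 1 - r) * (N - r)) := by
          refine Finset.sum_le_sum fun r hr => mul_le_mul_of_nonneg_left ?_
            (pow_nonneg (by linarith) _)
          have : (r : ℝ) + 1 ≤ K := by exact_mod_cast Finset.mem_range.1 hr
          nlinarith
      _ ≤ _ := by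
          refine Finset.sum_le_sum_of_subset_of_nonneg (Finset.range_mono (by omega))
            fun r hr _ => mul_nonneg (pow_nonneg (by linarith) _) ?_
          have : (r : ℝ) + 1 ≤ N := by exact_mod_cast Finset.mem_range.1 hr
          exact mul_nonneg (by linarith) (by linarith)
  rw [← Finset.sum_mul] at hsub
  have h2 := sum_geom_sq_ge h0 h1 K
  have h3 := one_sub_pow_ge h0 h1 (by omega : 0 < N) zero_le_one (m := 2 * K)
    (by push_cast; linarith)
  rw [← hμ] at h3
  have h4 : μ / 5 ≤ (2 * K : ℕ) * μ / ((1 + 1) * N) := by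
    rw [div_le_div_iff₀ (by norm_num) (by positivity)]
    push_cast
    nlinarith
  have h5 : μ / 10 ≤ δ * ∑ k ∈ Finset.range K, (1 - δ) ^ (2 * k) := by linarith
  have h6 := mul_le_mul_of_nonneg_left hsub h0
  have h7 := mul_le_mul_of_nonneg_right h5 (by positivity : (0 : ℝ) ≤ (N : ℝ) ^ 2 / 4)
  nlinarith [mul_nonneg hμ0 (sq_nonneg (N : ℝ))]

end ScalarRecursions

/-! ### From the recursion to risk bounds -/

section RiskBounds

variable {M N : ℕ} {lam w : Fin M → ℝ} {γ β : ℝ} {c : ℕ → Fin M → ℝ} {D : ℕ → ℝ}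

/-- `min 1 (N γ lam i)`, the part of direction `i` that is learnt. -/
noncomputable def learnt (lam : Fin M → ℝ) (γ : ℝ) (N : ℕ) (i : Fin M) : ℝ :=
  min 1 (N * (γ * lam i))

/-- In each direction the geometric sum is (1 - a^(N-s))/(γλ), so `weighted_sum_ge` applies with E_t
= γ²λD_t. The kernel bounds turn the initial error into the first sum; in the second, λ is absorbed
by `kern_ge`, which leaves a factor μ² that no longer depends on r. -/
theorem risk_ge (hlam : ∀ i, 0 ≤ lam i) (hγ : 0 < γ) (hγlam : ∀ i, γ * lam i < 1) (hN : 0 < N)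
    (hD : ∀ r < N, 0 ≤ D r) (hc0 : ∀ i, c 0 i = w i ^ 2)
    (hrec : ∀ t i, t + 1 < N →
      (1 - γ * lam i) ^ 2 * c t i + γ ^ 2 * lam i * D t ≤ c (t + 1) i) :
    ∑ i, w i ^ 2 * learnt lam γ N i ^ 2 / (16 * γ ^ 2 * (N : ℝ) ^ 2 * lam i) +
      (∑ i, learnt lam γ N i ^ 2) / (16 * (N : ℝ) ^ 4) *
        ∑ r ∈ Finset.range N, D r * (((N : ℝ) - 1 - r) * (N - r)) ≤
    1 / (2 * (N : ℝ) ^ 2) * ∑ i, lam i * ∑ s ∈ Finset.range N, c s i *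
      ∑ k ∈ Finset.range (N - s), (1 - γ * lam i) ^ k := by
  have hNr : (0 : ℝ) < N := by exact_mod_cast hN
  have hsplit : ∀ T : ℝ, (∑ i, learnt lam γ N i ^ 2) / (16 * (N : ℝ) ^ 4) * T =
      ∑ i, learnt lam γ N i ^ 2 / (16 * (N : ℝ) ^ 4) * T := fun T => by
    rw [Finset.sum_div, Finset.sum_mul]
  rw [hsplit, Finset.mul_sum _ _ (1 / (2 * (N : ℝ) ^ 2)), ← Finset.sum_add_distrib]
  refine Finset.sum_le_sum fun i _ => ?_
  set a := 1 - γ * lam i with ha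
  have hδ0 : 0 ≤ γ * lam i := mul_nonneg hγ.le (hlam i)
  have hδ1 := (hγlam i).le
  set μ := learnt lam γ N i with hμ
  have hw := weighted_sum_ge (a := a) (by linarith) (by linarith)
    (c := fun t => c t i) (E := fun t => γ ^ 2 * lam i * D t) (fun t ht => hrec t i ht) N 0
    (by omega)
  simp only [zero_add, hc0] at hw
  have hgeo : ∀ n, γ * lam i * ∑ k ∈ Finset.range n, a ^ k = 1 - a ^ n := fun n => by
    have := mul_neg_geom_sum a n
    rwa [show 1 - a = γ * lam i by rw [ha]; ring] at this
  have h1 : lam i * ∑ s ∈ Finset.range N, c s i * ∑ k ∈ Finset.range (N - s), a ^ k =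
      1 / γ * ∑ s ∈ Finset.range N, c s i * (1 - a ^ (N - s)) := by
    rw [Finset.mul_sum, Finset.mul_sum]
    refine Finset.sum_congr rfl fun s _ => ?_
    rw [← hgeo]; field_simp
  rw [h1]
  have h2 : w i ^ 2 * μ ^ 2 / (8 * γ * lam i) ≤ w i ^ 2 * kern a N := by
    -- In a null direction the quotient is zero by the convention for division by zero.
    rcases (hlam i).eq_or_lt with h | h
    · rw [← h]; simp only [mul_zero, div_zero]
      exact mul_nonneg (sq_nonneg _) (kern_nonneg (by linarith) (by linarith) _)
    · rw [mul_div_assoc]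
      refine mul_le_mul_of_nonneg_left ?_ (sq_nonneg _)
      rw [div_le_iff₀ (by positivity)]
      have := kern_self_ge hδ0 hδ1 hN
      rw [← ha] at this
      change μ ^ 2 / 8 ≤ _ at this
      linarith
  have h3 : γ * (μ ^ 2 / (8 * N ^ 2)) * ∑ r ∈ Finset.range N, D r * (((N : ℝ) - 1 - r) * (N - r)) ≤
      ∑ r ∈ Finset.range N, γ ^ 2 * lam i * D r * kern a (N - 1 - r) := by
    rw [Finset.mul_sum]
    refine Finset.sum_le_sum fun r hr => ?_
    have hr' := Finset.mem_range.1 hr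
    have hk := kern_ge hδ0 hδ1 hN (n := N - 1 - r) (by omega)
    rw [← ha] at hk
    change μ ^ 2 * _ / _ ≤ _ at hk
    have hcast : ((N - 1 - r : ℕ) : ℝ) = (N : ℝ) - 1 - r := by
      rw [Nat.cast_sub (by omega), Nat.cast_sub (by omega)]; simp
    rw [hcast] at hk
    have := mul_le_mul_of_nonneg_left hk (mul_nonneg hγ.le (hD r hr'))
    calc _ = γ * D r * (μ ^ 2 * ((N - 1 - r) * (N - 1 - r + 1)) / (8 * N ^ 2)) := by ring
      _ ≤ _ := this
      _ = _ := by ring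
  have h4 : w i ^ 2 * μ ^ 2 / (16 * γ ^ 2 * N ^ 2 * lam i) =
      1 / (2 * N ^ 2) * (1 / γ * (w i ^ 2 * μ ^ 2 / (8 * γ * lam i))) := by
    rcases (hlam i).eq_or_lt with h | h
    · rw [← h]; simp
    · field_simp; ring
  have h5 : μ ^ 2 / (16 * N ^ 4) * ∑ r ∈ Finset.range N, D r * (((N : ℝ) - 1 - r) * (N - r)) =
      1 / (2 * N ^ 2) * (1 / γ * (γ * (μ ^ 2 / (8 * N ^ 2)) *
        ∑ r ∈ Finset.range N, D r * (((N : ℝ) - 1 - r) * (N - r)))) := by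
    field_simp; ring
  rw [h4, h5, ← mul_add, ← mul_add]
  have : 0 ≤ 1 / γ := by positivity
  gcongr
  linarith

/-- The part of the second moments that comes from the initial error. -/
theorem iterate_ge (hlam : ∀ i, 0 ≤ lam i) (hγlam : ∀ i, γ * lam i < 1)
    (hγ : 0 < γ) {G : ℕ → ℝ} (hG : ∀ r, 0 ≤ G r) (hGD : ∀ r, r + 1 < N → G r ≤ D r)
    (hc0 : ∀ i, c 0 i = w i ^ 2)
    (hrec : ∀ t i, t + 1 < N →
      (1 - γ * lam i) ^ 2 * c t i + γ ^ 2 * lam i * D t ≤ c (t + 1) i) (t : ℕ) (ht : t < N)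
    (i : Fin M) :
    (1 - γ * lam i) ^ (2 * t) * (w i ^ 2 + γ ^ 2 * lam i * ∑ r ∈ Finset.range t, G r) ≤ c t i := by
  have ha0 : 0 ≤ 1 - γ * lam i := by linarith [hγlam i]
  have ha1 : 1 - γ * lam i ≤ 1 := by linarith [mul_nonneg hγ.le (hlam i)]
  induction t with
  | zero => simp [hc0]
  | succ t ih =>
    refine le_trans ?_ (hrec t i ht)
    have h1 := mul_le_mul_of_nonneg_left (ih (by omega)) (sq_nonneg (1 - γ * lam i))
    -- All injected noise is charged the full decay from time 0, whenever it entered. This is lossy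
    -- but keeps the bound a product.
    have h2 : (1 - γ * lam i) ^ (2 * (t + 1)) * (γ ^ 2 * lam i * G t) ≤ γ ^ 2 * lam i * D t := by
      have hg : 0 ≤ γ ^ 2 * lam i := mul_nonneg (sq_nonneg _) (hlam i)
      calc _ ≤ 1 * (γ ^ 2 * lam i * G t) :=
            mul_le_mul_of_nonneg_right (pow_le_one₀ ha0 ha1) (mul_nonneg hg (hG t))
        _ ≤ _ := by rw [one_mul]; exact mul_le_mul_of_nonneg_left (hGD t ht) hg
    rw [Finset.sum_range_succ]
    calc _ = (1 - γ * lam i) ^ 2 * ((1 - γ * lam i) ^ (2 * t) *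
          (w i ^ 2 + γ ^ 2 * lam i * ∑ r ∈ Finset.range t, G r)) +
          (1 - γ * lam i) ^ (2 * (t + 1)) * (γ ^ 2 * lam i * G t) := by ring
      _ ≤ _ := add_le_add h1 h2

theorem learnt_nonneg (hlam : ∀ i, 0 ≤ lam i) (hγ : 0 < γ) (i : Fin M) : 0 ≤ learnt lam γ N i :=
  le_min zero_le_one (by have := hlam i; positivity)

theorem sum_bias_weights_ge (hlam : ∀ i, 0 ≤ lam i) (hγ : 0 < γ) (hγlam : ∀ i, γ * lam i < 1)
    (hN : 500 < N) :
    16 * (N : ℝ) ^ 3 / 1000 * (1 / (N * γ) * ∑ i, w i ^ 2 * learnt lam γ N i) ≤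
      ∑ r ∈ Finset.range N, (∑ j, lam j * ((1 - γ * lam j) ^ (2 * r) * w j ^ 2)) *
        (((N : ℝ) - 1 - r) * (N - r)) := by
  have hNr : (500 : ℝ) < N := by exact_mod_cast hN
  have e : ∑ r ∈ Finset.range N, (∑ j, lam j * ((1 - γ * lam j) ^ (2 * r) * w j ^ 2)) *
        (((N : ℝ) - 1 - r) * (N - r)) = ∑ j, w j ^ 2 / γ * (γ * lam j *
        ∑ r ∈ Finset.range N, (1 - γ * lam j) ^ (2 * r) * (((N : ℝ) - 1 - r) * (N - r))) := by
    simp only [Finset.sum_mul, Finset.mul_sum]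
    rw [Finset.sum_comm]
    refine Finset.sum_congr rfl fun j _ => Finset.sum_congr rfl fun r _ => ?_
    field_simp
  rw [e, Finset.mul_sum, Finset.mul_sum]
  refine Finset.sum_le_sum fun j _ => ?_
  have h := sum_decay_weights_ge (mul_nonneg hγ.le (hlam j)) (hγlam j).le hN
  have h' := mul_le_mul_of_nonneg_left h (by positivity : 0 ≤ w j ^ 2 / γ)
  refine le_trans (le_of_eq ?_) h'
  rw [learnt]
  field_simp

/-- The summand in r is E[v_rᵀ H v_r]. It is bounded below by a quadratic term in r, from learning
the signal, and a linear one, from noise accumulated through β; summed against the weights they give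
the two parts of P_eff. -/
theorem sum_signal_weights_ge (hlam : ∀ i, 0 ≤ lam i) (hγ : 0 < γ) (hγlam : ∀ i, γ * lam i < 1)
    (hβ : 0 ≤ β) (hN : 500 < N)
    (hc : ∀ t < N, ∀ i, (1 - γ * lam i) ^ (2 * t) * (w i ^ 2 + γ ^ 2 * lam i *
      ∑ r ∈ Finset.range t, β * ∑ j, lam j * ((1 - γ * lam j) ^ (2 * r) * w j ^ 2)) ≤ c t i) :
    16 * (N : ℝ) ^ 3 * (1 / 2500 * ∑ i, lam i * (w i ^ 2 * learnt lam γ N i ^ 2) +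
      γ * β / 600 * (∑ i, w i ^ 2 * learnt lam γ N i) *
        ∑ i, lam i ^ 2 * (1 - γ * lam i) ^ (2 * N)) ≤
      ∑ r ∈ Finset.range N, (∑ j, lam j * (c r j + w j ^ 2 * (1 - 2 * (1 - γ * lam j) ^ r))) *
        (((N : ℝ) - 1 - r) * (N - r)) := by
  have hNr : (500 : ℝ) < N := by exact_mod_cast hN
  have hN0 : 0 < N := by omega
  set T := ∑ i, lam i ^ 2 * (1 - γ * lam i) ^ (2 * N) with hT
  set W := ∑ i, w i ^ 2 * learnt lam γ N i with hW
  set U := ∑ i, lam i * (w i ^ 2 * learnt lam γ N i ^ 2) with hU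
  have hT0 : 0 ≤ T := Finset.sum_nonneg fun i _ =>
    mul_nonneg (sq_nonneg _) (pow_nonneg (by linarith [hγlam i]) _)
  have hW0 : 0 ≤ W := Finset.sum_nonneg fun i _ =>
    mul_nonneg (sq_nonneg _) (learnt_nonneg hlam hγ i)
  have hU0 : 0 ≤ U := Finset.sum_nonneg fun i _ =>
    mul_nonneg (hlam i) (mul_nonneg (sq_nonneg _) (sq_nonneg _))
  have hpt : ∀ r ∈ Finset.range N, (U / (4 * N ^ 2) * (r : ℝ) ^ 2 + γ * β * W * T / (3 * N) * r) *
      (((N : ℝ) - 1 - r) * (N - r)) ≤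
      (∑ j, lam j * (c r j + w j ^ 2 * (1 - 2 * (1 - γ * lam j) ^ r))) *
        (((N : ℝ) - 1 - r) * (N - r)) := fun r hr => by
    have hr' : r < N := Finset.mem_range.1 hr
    have hrr : (r : ℝ) + 1 ≤ N := by exact_mod_cast hr'
    refine mul_le_mul_of_nonneg_right ?_ (mul_nonneg (by linarith) (by linarith))
    set G := ∑ k ∈ Finset.range r, β * ∑ j, lam j * ((1 - γ * lam j) ^ (2 * k) * w j ^ 2) with hG
    have hG1 : β * W * r / (3 * N) ≤ γ * G := by
      have e : γ * G = β * ∑ j, w j ^ 2 * (γ * lam j *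
          ∑ k ∈ Finset.range r, (1 - γ * lam j) ^ (2 * k)) := by
        rw [hG, ← Finset.mul_sum, Finset.sum_comm]
        simp only [Finset.mul_sum]
        refine Finset.sum_congr rfl fun j _ => Finset.sum_congr rfl fun k _ => ?_
        ring
      rw [e, hW, Finset.mul_sum, Finset.mul_sum, Finset.sum_mul, Finset.sum_div]
      refine Finset.sum_le_sum fun j _ => ?_
      have h1 := sum_geom_sq_ge (mul_nonneg hγ.le (hlam j)) (hγlam j).le r
      -- The exponent 2r runs up to 2N, so K = 2; this is the origin of the 3 in `3 * N`.
      have h2 := one_sub_pow_ge (mul_nonneg hγ.le (hlam j)) (hγlam j).le hN0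
        (K := 2) (by norm_num) (m := 2 * r) (by push_cast; linarith)
      have h3 : r * learnt lam γ N j / (3 * N) ≤
          γ * lam j * ∑ k ∈ Finset.range r, (1 - γ * lam j) ^ (2 * k) := by
        refine le_trans ?_ h1
        have e3 : r * learnt lam γ N j / (3 * N) =
            ((2 * r : ℕ) * min 1 (N * (γ * lam j)) / ((1 + 2) * N)) / 2 := by
          rw [learnt]; push_cast; field_simp; norm_num
        rw [e3]; linarith
      have h4 := mul_le_mul_of_nonneg_left h3 (mul_nonneg hβ (sq_nonneg (w j)))
      calc _ = β * w j ^ 2 * (r * learnt lam γ N j / (3 * N)) := by ring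
        _ ≤ _ := h4
        _ = _ := by ring
    have hG0 : 0 ≤ G := by
      have : 0 ≤ γ * G := le_trans (by positivity) hG1
      exact nonneg_of_mul_nonneg_right this hγ
    have hj : ∀ j, lam j * (w j ^ 2 * learnt lam γ N j ^ 2) / (4 * N ^ 2) * r ^ 2 +
        γ * (lam j ^ 2 * (1 - γ * lam j) ^ (2 * N)) * (γ * G) ≤
        lam j * (c r j + w j ^ 2 * (1 - 2 * (1 - γ * lam j) ^ r)) := fun j => by
      have ha0 : 0 ≤ 1 - γ * lam j := by linarith [hγlam j]
      have ha1 : 1 - γ * lam j ≤ 1 := by linarith [mul_nonneg hγ.le (hlam j)]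
      have h1 := hc r hr' j
      have h2 : (1 - γ * lam j) ^ (2 * N) ≤ (1 - γ * lam j) ^ (2 * r) :=
        pow_le_pow_of_le_one ha0 ha1 (by omega)
      have h3 := one_sub_pow_ge (mul_nonneg hγ.le (hlam j)) (hγlam j).le hN0 zero_le_one
        (m := r) (by linarith)
      have h4 : r * learnt lam γ N j / (2 * N) ≤ 1 - (1 - γ * lam j) ^ r := by
        refine le_trans (le_of_eq ?_) h3
        rw [learnt]; norm_num
      have h5 := pow_le_pow_left₀ (by have := learnt_nonneg (N := N) hlam hγ j; positivity) h4 2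
      have h6 := mul_le_mul_of_nonneg_left h5 (sq_nonneg (w j))
      have h7 : (1 - γ * lam j) ^ (2 * N) * (γ ^ 2 * lam j * G) ≤
          (1 - γ * lam j) ^ (2 * r) * (γ ^ 2 * lam j * G) :=
        mul_le_mul_of_nonneg_right h2 (mul_nonneg (mul_nonneg (sq_nonneg _) (hlam j)) hG0)
      -- Complete the square: with a = 1 - γλ, a^(2r) w² + w²(1 - 2a^r) = w²(1 - a^r)².
      have h8 : w j ^ 2 * (r * learnt lam γ N j / (2 * N)) ^ 2 +
          (1 - γ * lam j) ^ (2 * N) * (γ ^ 2 * lam j * G) ≤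
          c r j + w j ^ 2 * (1 - 2 * (1 - γ * lam j) ^ r) := by
        have e8 : (1 - γ * lam j) ^ (2 * r) = ((1 - γ * lam j) ^ r) ^ 2 := by
          rw [← pow_mul, Nat.mul_comm]
        rw [e8] at h1 h7
        linarith
      refine le_trans (le_of_eq ?_) (mul_le_mul_of_nonneg_left h8 (hlam j))
      field_simp
      ring
    refine le_trans ?_ (Finset.sum_le_sum fun j _ => hj j)
    rw [Finset.sum_add_distrib, ← Finset.sum_mul, ← Finset.sum_mul, ← Finset.mul_sum,
      ← Finset.sum_div, ← hU, ← hT]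
    have := mul_le_mul_of_nonneg_left hG1 (mul_nonneg hγ.le hT0)
    refine add_le_add le_rfl (le_trans (le_of_eq ?_) this)
    ring
  refine le_trans ?_ (Finset.sum_le_sum hpt)
  have e : ∀ x y : ℝ, ∑ r ∈ Finset.range N, (x * (r : ℝ) ^ 2 + y * r) *
      (((N : ℝ) - 1 - r) * (N - r)) =
      x * ∑ r ∈ Finset.range N, (r : ℝ) ^ 2 * (((N : ℝ) - 1 - r) * (N - r)) +
      y * ∑ r ∈ Finset.range N, r * (((N : ℝ) - 1 - r) * (N - r)) := fun x y => by
    rw [Finset.mul_sum, Finset.mul_sum, ← Finset.sum_add_distrib]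
    exact Finset.sum_congr rfl fun r _ => by ring
  rw [e, mul_add]
  refine add_le_add ?_ ?_
  · refine le_trans (le_of_eq ?_)
      (mul_le_mul_of_nonneg_left (sum_sq_mul_weights_ge hN) (by positivity))
    field_simp
  · refine le_trans (le_of_eq ?_)
      (mul_le_mul_of_nonneg_left (sum_mul_weights_ge hN) (by positivity))
    field_simp

end RiskBounds

/-! ### Spectral quantities as sums over all directions -/

section SpectralQuantities

variable {M N : ℕ} {lam : Fin M → ℝ} {u : Fin M → (Fin M → ℝ)} {γ : ℝ}

/-- By monotonicity the indices above the threshold form an initial segment; the shift `i + 1` in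
the supremum makes `kStar` its length. -/
theorem lt_kStar_iff (h : Antitone lam) (i : Fin M) :
    i.val < kStar lam γ N ↔ 1 / (γ * N) ≤ lam i := by
  rw [kStar, Finset.lt_sup_iff]
  constructor
  · rintro ⟨j, hj, hij⟩
    have hj' := (Finset.mem_filter.1 hj).2
    exact hj'.trans (h (Fin.le_def.2 (by omega)))
  · intro hi
    exact ⟨i, Finset.mem_filter.2 ⟨Finset.mem_univ _, hi⟩, Nat.lt_succ_self _⟩

theorem kStar_le : kStar lam γ N ≤ M := Finset.sup_le fun i _ => i.isLt

variable (hanti : Antitone lam) (hγ : 0 < γ) (hN : 0 < N)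

include hanti hγ hN in
theorem learnt_of_lt {i : Fin M} (h : i.val < kStar lam γ N) : learnt lam γ N i = 1 := by
  have hNr : (0 : ℝ) < N := by exact_mod_cast hN
  rw [lt_kStar_iff hanti, div_le_iff₀ (by positivity)] at h
  exact min_eq_left (by linarith)

include hanti hγ hN in
theorem learnt_of_le {i : Fin M} (h : kStar lam γ N ≤ i.val) :
    learnt lam γ N i = N * (γ * lam i) := by
  have hNr : (0 : ℝ) < N := by exact_mod_cast hN
  rw [← not_lt, lt_kStar_iff hanti, div_le_iff₀ (by positivity)] at h
  exact min_eq_right (by linarith)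

theorem sum_head_add_sum_tail (k : ℕ) {f g h : Fin M → ℝ} (hf : ∀ i, i.val < k → f i = h i)
    (hg : ∀ i, k ≤ i.val → g i = h i) :
    ∑ i ∈ Finset.univ.filter (fun i : Fin M => i.val < k), f i +
      ∑ i ∈ Finset.univ.filter (fun i : Fin M => k ≤ i.val), g i = ∑ i, h i := by
  rw [← Finset.sum_filter_add_sum_filter_not Finset.univ (fun i : Fin M => i.val < k) h]
  simp only [not_lt]
  congr 1
  · exact Finset.sum_congr rfl fun i hi => hf i (Finset.mem_filter.1 hi).2
  · exact Finset.sum_congr rfl fun i hi => hg i (Finset.mem_filter.1 hi).2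

include hanti hγ hN in
-- `learnt` is 1 on the head and Nγλ on the tail, so head count and tail sum merge. The other
-- spectral quantities are rewritten in the same way.
theorem dEff_eq : dEff lam γ N = ∑ i, learnt lam γ N i ^ 2 := by
  have h1 : (kStar lam γ N : ℝ) =
      ∑ i ∈ Finset.univ.filter (fun i : Fin M => i.val < kStar lam γ N), (1 : ℝ) := by
    rw [Finset.sum_const, nsmul_eq_mul, mul_one, Fin.card_filter_val_lt, min_eq_right kStar_le]
  rw [dEff]
  nth_rewrite 1 [h1]
  rw [Finset.mul_sum]
  refine sum_head_add_sum_tail _ (fun i hi => ?_) fun i hi => ?_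
  · rw [learnt_of_lt hanti hγ hN hi]; norm_num
  · rw [learnt_of_le hanti hγ hN hi]; ring

variable (v : Fin M → ℝ)

theorem sqNorm_headId (k : ℕ) : sqNorm (headId u k) v =
    ∑ i ∈ Finset.univ.filter (fun i : Fin M => i.val < k), (u i ⬝ᵥ v) ^ 2 := by
  have := sqNorm_sum_smul_vecMulVec (Finset.univ.filter fun i : Fin M => i.val < k)
    (fun _ => (1 : ℝ)) u v
  simpa only [one_smul, one_mul, headId] using this

theorem sum_mul_sum_vecMulVec (horth : ∀ i j, u i ⬝ᵥ u j = if i = j then 1 else 0)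
    (s : Finset (Fin M)) (a b : Fin M → ℝ) :
    (∑ i ∈ s, a i • Matrix.vecMulVec (u i) (u i)) * (∑ i ∈ s, b i • Matrix.vecMulVec (u i) (u i)) =
      ∑ i ∈ s, (a i * b i) • Matrix.vecMulVec (u i) (u i) := by
  rw [Finset.sum_mul]
  refine Finset.sum_congr rfl fun i hi => ?_
  rw [Finset.mul_sum, Finset.sum_eq_single i]
  · rw [Matrix.smul_mul, Matrix.mul_smul, Matrix.vecMulVec_mul_vecMulVec, horth, if_pos rfl,
      smul_smul]
    simp
  · intro j _ hj
    rw [Matrix.smul_mul, Matrix.mul_smul, Matrix.vecMulVec_mul_vecMulVec, horth, if_neg hj.symm]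
    simp
  · exact fun h => absurd hi h

theorem sqNorm_tailMat_pow_three (horth : ∀ i j, u i ⬝ᵥ u j = if i = j then 1 else 0) (k : ℕ) :
    sqNorm (tailMat lam u k ^ 3) v =
      ∑ i ∈ Finset.univ.filter (fun i : Fin M => k ≤ i.val), lam i ^ 3 * (u i ⬝ᵥ v) ^ 2 := by
  rw [pow_succ, sq, tailMat, sum_mul_sum_vecMulVec horth, sum_mul_sum_vecMulVec horth,
    sqNorm_sum_smul_vecMulVec]
  exact Finset.sum_congr rfl fun i _ => by ring

include hanti hγ hN in
theorem sum_learnt_eq : sqNorm (headId u (kStar lam γ N)) v +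
    N * γ * sqNorm (tailMat lam u (kStar lam γ N)) v =
      ∑ i, (u i ⬝ᵥ v) ^ 2 * learnt lam γ N i := by
  rw [sqNorm_headId, tailMat, sqNorm_sum_smul_vecMulVec, Finset.mul_sum]
  refine sum_head_add_sum_tail _ (fun i hi => ?_) fun i hi => ?_
  · rw [learnt_of_lt hanti hγ hN hi, mul_one]
  · rw [learnt_of_le hanti hγ hN hi]; ring

include hanti hγ hN in
theorem sigmaBias2_eq : sigmaBias2 lam u γ N v =
    1 / (N * γ) * ∑ i, (u i ⬝ᵥ v) ^ 2 * learnt lam γ N i := by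
  have hNr : (0 : ℝ) < N := by exact_mod_cast hN
  rw [← sum_learnt_eq hanti hγ hN, sigmaBias2]
  field_simp

include hanti hγ hN in
theorem pEff_eq (horth : ∀ i j, u i ⬝ᵥ u j = if i = j then 1 else 0) (β : ℝ) :
    pEff lam u γ β N v =
      1 / 2500 * ∑ i, lam i * ((u i ⬝ᵥ v) ^ 2 * learnt lam γ N i ^ 2) +
        γ * β / 600 * (∑ i, (u i ⬝ᵥ v) ^ 2 * learnt lam γ N i) *
          ∑ i, lam i ^ 2 * (1 - γ * lam i) ^ (2 * N) := by
  rw [pEff, sum_learnt_eq hanti hγ hN, sqNorm_tailMat_pow_three v horth, headMat,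
    sqNorm_sum_smul_vecMulVec, Finset.mul_sum (Finset.univ.filter _)]
  congr 2
  refine sum_head_add_sum_tail _ (fun i hi => ?_) fun i hi => ?_
  · rw [learnt_of_lt hanti hγ hN hi]; ring
  · rw [learnt_of_le hanti hγ hN hi]; ring

include hanti hγ hN in
-- The quotient μ²/λ is 1/λ on the head and N²γ²λ on the tail, so the left side is exactly 16/100 of
-- the right side.
theorem biasLB_le (hlam : ∀ i, 0 ≤ lam i) : biasLB lam u γ N v ≤
    ∑ i, (u i ⬝ᵥ v) ^ 2 * learnt lam γ N i ^ 2 / (16 * γ ^ 2 * (N : ℝ) ^ 2 * lam i) := by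
  have hNr : (0 : ℝ) < N := by exact_mod_cast hN
  have e : biasLB lam u γ N v = 16 / 100 *
      ∑ i, (u i ⬝ᵥ v) ^ 2 * learnt lam γ N i ^ 2 / (16 * γ ^ 2 * (N : ℝ) ^ 2 * lam i) := by
    rw [biasLB, headInv, tailMat, sqNorm_sum_smul_vecMulVec, sqNorm_sum_smul_vecMulVec, mul_add,
      Finset.mul_sum, Finset.mul_sum, Finset.mul_sum, Finset.mul_sum]
    refine sum_head_add_sum_tail _ (fun i hi => ?_) fun i hi => ?_
    · rw [learnt_of_lt hanti hγ hN hi]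
      rcases (hlam i).eq_or_lt with h | h
      · rw [← h]; simp
      · field_simp
    · rw [learnt_of_le hanti hγ hN hi]
      rcases (hlam i).eq_or_lt with h | h
      · rw [← h]; simp
      · field_simp
  rw [e]
  have : 0 ≤ ∑ i, (u i ⬝ᵥ v) ^ 2 * learnt lam γ N i ^ 2 / (16 * γ ^ 2 * (N : ℝ) ^ 2 * lam i) :=
    Finset.sum_nonneg fun i _ => by have := hlam i; positivity
  linarith

end SpectralQuantities

/-! ### Risk bound for a given additional noise sequence -/

section Combine

variable {M N : ℕ} {lam : Fin M → ℝ} {u : Fin M → (Fin M → ℝ)} {γ β : ℝ} {v : Fin M → ℝ}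
  {c : ℕ → Fin M → ℝ} {F : ℕ → ℝ}

/-- The noise β ∑ λ_j c_r(j) generated by the current error is bounded through the decay of the
initial error alone; this gives σ_bias². The rest, `F`, is left arbitrary so that both kinds of
quantization are covered. -/
theorem risk_ge_of_noise (hanti : Antitone lam) (hlam : ∀ i, 0 ≤ lam i) (hγ : 0 < γ)
    (hγlam : ∀ i, γ * lam i < 1) (hN : 500 < N) (hβ : 0 ≤ β) (hc : ∀ t i, 0 ≤ c t i)
    (hF : ∀ r < N, 0 ≤ F r) (hc0 : ∀ i, c 0 i = (u i ⬝ᵥ v) ^ 2)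
    (hrec : ∀ t i, t + 1 < N → (1 - γ * lam i) ^ 2 * c t i +
      γ ^ 2 * lam i * (β * ∑ j, lam j * c t j + F t) ≤ c (t + 1) i) :
    biasLB lam u γ N v + (β / 1000 * sigmaBias2 lam u γ N v * (dEff lam γ N / N) +
      (∑ r ∈ Finset.range N, F r * (((N : ℝ) - 1 - r) * (N - r))) / (16 * (N : ℝ) ^ 3) *
        (dEff lam γ N / N)) ≤
    1 / (2 * (N : ℝ) ^ 2) * ∑ i, lam i * ∑ s ∈ Finset.range N, c s i *
      ∑ k ∈ Finset.range (N - s), (1 - γ * lam i) ^ k := by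
  have hN0 : 0 < N := by omega
  have hNr : (0 : ℝ) < N := by exact_mod_cast hN0
  have hC : ∀ r, 0 ≤ β * ∑ j, lam j * c r j := fun r =>
    mul_nonneg hβ (Finset.sum_nonneg fun j _ => mul_nonneg (hlam j) (hc r j))
  have hD : ∀ r < N, 0 ≤ β * ∑ j, lam j * c r j + F r := fun r hr => add_nonneg (hC r) (hF r hr)
  have hge : ∀ t < N, ∀ i, (1 - γ * lam i) ^ (2 * t) * (u i ⬝ᵥ v) ^ 2 ≤ c t i := fun t ht i => by
    simpa using iterate_ge hlam hγlam hγ (G := fun _ => 0) (fun _ => le_rfl)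
      (fun r hr => hD r (by omega)) hc0 hrec t ht i
  refine le_trans ?_ (risk_ge hlam hγ hγlam hN0 hD hc0 hrec)
  refine add_le_add (biasLB_le hanti hγ hN0 v hlam) ?_
  have hb := sum_bias_weights_ge (w := fun i => u i ⬝ᵥ v) hlam hγ hγlam hN
  rw [← sigmaBias2_eq hanti hγ hN0] at hb
  have hsum : β * (16 * (N : ℝ) ^ 3 / 1000 * sigmaBias2 lam u γ N v) +
      ∑ r ∈ Finset.range N, F r * (((N : ℝ) - 1 - r) * (N - r)) ≤
      ∑ r ∈ Finset.range N, (β * ∑ j, lam j * c r j + F r) * (((N : ℝ) - 1 - r) * (N - r)) := by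
    refine le_trans (add_le_add_left (mul_le_mul_of_nonneg_left hb hβ) _) ?_
    rw [Finset.mul_sum, ← Finset.sum_add_distrib]
    refine Finset.sum_le_sum fun r hr => ?_
    have hr' := Finset.mem_range.1 hr
    have hrr : (r : ℝ) + 1 ≤ N := by exact_mod_cast hr'
    rw [← mul_assoc, ← add_mul]
    refine mul_le_mul_of_nonneg_right (add_le_add_left (mul_le_mul_of_nonneg_left
      (Finset.sum_le_sum fun j _ => mul_le_mul_of_nonneg_left (hge r hr' j) (hlam j)) hβ) _)
      (mul_nonneg (by linarith) (by linarith))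
  rw [← dEff_eq hanti hγ hN0]
  have hd : 0 ≤ dEff lam γ N := by
    rw [dEff_eq hanti hγ hN0]; exact Finset.sum_nonneg fun i _ => sq_nonneg _
  refine le_trans (le_of_eq ?_) (mul_le_mul_of_nonneg_left hsum
    (by positivity : 0 ≤ dEff lam γ N / (16 * (N : ℝ) ^ 4)))
  generalize ∑ r ∈ Finset.range N, F r * (((N : ℝ) - 1 - r) * (N - r)) = T
  field_simp

end Combine

/-! ### The recursion for both kinds of quantization, and the theorem -/

section Main

variable {p : ℕ∞} {M : ℕ} {Θ : Type*} [MeasurableSpace Θ] {ν : Measure Θ} [IsProbabilityMeasure ν]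
  {ρ : Measure ((Coord p → ℝ) × ℝ)} [IsProbabilityMeasure ρ]
  {Ω : Type*} [MeasurableSpace Ω] {P : Measure Ω} [IsProbabilityMeasure P]
  {q : Scheme p M ν} {S : Fin M × Coord p → ℝ} {Z : ℕ → Ω → Round p Θ} {γ : ℝ}
  (hZ : IsSampling P ρ ν Z)
  {α β σlo σhi : ℝ} {vstar : Fin M → ℝ} {lam : Fin M → ℝ} {u : Fin M → (Fin M → ℝ)}
  (hF : FourthMomentCondition q S ρ α β) (hN : NoiseCondition q S ρ vstar σlo σhi)
  (hO : IsQuantOptimum q S ρ vstar) (hW : WellSpecified q S ρ vstar)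
  (heig : IsEigenDecomposition (Hf q S ρ) lam u) {N : ℕ}

theorem actOutErr_nonneg (t : ℕ) (ω : Ω) : 0 ≤ actOutErr q S γ Z t ω :=
  add_nonneg (q.Qa.errVar_nonneg _) (q.Qo.errVar_nonneg _)

theorem essInf_nonneg {f : Ω → ℝ} (hf : ∀ ω, 0 ≤ f ω) : 0 ≤ essInf f P := by
  rw [essInf, liminf_eq]
  by_cases h : BddAbove {a | ∀ᶠ ω in ae P, a ≤ f ω}
  · exact le_csSup h (show ∀ᶠ ω in ae P, 0 ≤ f ω from Eventually.of_forall hf)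
  -- A real supremum of an unbounded set is 0 by convention, so this case is harmless.
  · rw [Real.sSup_of_not_bddAbove h]

include hZ heig in
theorem trace_paramErrMoment (h2 : FiniteSecondMoments q S P γ Z N) {t : ℕ} (ht : t < N) :
    (Hf q S ρ * paramErrMoment q S P γ Z t).trace =
      ∑ j, lam j * ∫ x : Ω × Round p Θ, (u j ⬝ᵥ (qparam q (iterate q S γ Z t x.1) x.2 -
        iterate q S γ Z t x.1)) ^ 2 ∂(P.prod (roundLaw ρ ν)) := by
  rw [heig.trace_mul]
  refine Finset.sum_congr rfl fun j _ => ?_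
  congr 1
  have hint : ∀ k l, Integrable (fun ω => (1 : ℝ) *
      ((qparam q (iterate q S γ Z t ω) (Z t ω) - iterate q S γ Z t ω) k *
        (qparam q (iterate q S γ Z t ω) (Z t ω) - iterate q S γ Z t ω) l)) P := fun k l => by
    have h : ∀ k, MemLp (fun ω => (qparam q (iterate q S γ Z t ω) (Z t ω) -
      iterate q S γ Z t ω) k) 2 P := fun k => (h2 t ht k).2.sub (h2 t ht k).1
    simp only [one_mul]
    exact (h k).integrable_mul (h l)
  have h := (integral_mul_dot_mul_dot hint (u j) (u j)).2
  simp only [one_mul, ← sq] at h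
  refine Eq.trans h ?_
  exact (identDistrib_lift hZ (f := fun y => (u j ⬝ᵥ (qparam q y.1 y.2 - y.1)) ^ 2)
    ((measurable_dot measurable_const
      (measurable_qparam_uncurry.sub measurable_fst)).pow_const 2)).integral_eq

include hZ hF heig in
theorem sigmaG2_le (h2 : FiniteSecondMoments q S P γ Z N) {t : ℕ} (ht : t < N) :
    sigmaG2 q S ρ P γ Z β σlo N ≤ σlo ^ 2 + β * ∑ j, lam j * ∫ x : Ω × Round p Θ,
      (u j ⬝ᵥ (qparam q (iterate q S γ Z t x.1) x.2 - iterate q S γ Z t x.1)) ^ 2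
        ∂(P.prod (roundLaw ρ ν)) + essInf (actOutErr q S γ Z t) P := by
  rw [sigmaG2, ← trace_paramErrMoment hZ heig h2 ht]
  refine add_le_add (add_le_add le_rfl ?_) ?_
  · exact ciInf_le (Set.finite_range _).bddBelow (⟨t, ht⟩ : Fin N)
  · exact ciInf_le (Set.finite_range _).bddBelow (⟨t, ht⟩ : Fin N)

include hZ hF heig in
theorem sigmaG2_nonneg (h2 : FiniteSecondMoments q S P γ Z N) :
    0 ≤ sigmaG2 q S ρ P γ Z β σlo N := by
  refine add_nonneg (add_nonneg (sq_nonneg _) (Real.iInf_nonneg fun t => ?_))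
    (Real.iInf_nonneg fun t => essInf_nonneg (actOutErr_nonneg t))
  rw [trace_paramErrMoment hZ heig h2 t.isLt]
  exact mul_nonneg hF.pos_beta.le (Finset.sum_nonneg fun j _ =>
    mul_nonneg (hF.lam_nonneg heig j) (integral_nonneg fun _ => sq_nonneg _))

include hZ in
-- The essential infimum lives on Ω, the one-step estimate on the product of past and round;
-- equality in law carries the bound across.
theorem ae_essInf_le_errVar (t : ℕ) : ∀ᵐ x : Ω × Round p Θ ∂(P.prod (roundLaw ρ ν)),
    essInf (actOutErr q S γ Z t) P ≤ q.Qa.errVar (preact q S (iterate q S γ Z t x.1) x.2) +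
      q.Qo.errVar (outGrad q S (iterate q S γ Z t x.1) x.2) := by
  have h : ∀ᵐ ω ∂P, essInf (actOutErr q S γ Z t) P ≤ actOutErr q S γ Z t ω :=
    ae_essInf_le ⟨0, eventually_map.2 (Eventually.of_forall (actOutErr_nonneg t))⟩
  have hm : Measurable fun y : (Fin M → ℝ) × Round p Θ =>
      q.Qa.errVar (preact q S y.1 y.2) + q.Qo.errVar (outGrad q S y.1 y.2) :=
    (q.Qa.measurable_errVar.comp measurable_preact_uncurry).add
      (q.Qo.measurable_errVar.comp measurable_outGrad_uncurry)
  exact (identDistrib_lift hZ hm).ae_snd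
    (p := fun r => essInf (actOutErr q S γ Z t) P ≤ r) measurableSet_Ici h

include hZ hF hN hO hW heig in
-- The term γ²λ² of the gradient bound turns the exact factor 1 - 2γλ into (1 - γλ)².
theorem errSq_succ_ge (hγ : 0 < γ) (h2 : FiniteSecondMoments q S P γ Z N) {t : ℕ}
    (ht : t + 1 < N) (i : Fin M) :
    (1 - γ * lam i) ^ 2 * errSq q S P γ Z vstar u t i + γ ^ 2 * lam i *
      (β * ∑ j, lam j * errSq q S P γ Z vstar u t j + sigmaG2 q S ρ P γ Z β σlo N) ≤
      errSq q S P γ Z vstar u (t + 1) i := by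
  have hL : ∀ j, MemLp (fun ω => iterate q S γ Z t ω j) 2 P := fun j => (h2 t (by omega) j).1
  have h := integral_sq_gradDot_ge hF hN hO hW heig hL (memLp_qparam_prod hZ h2 (by omega))
    (memLp_gradDot hZ hγ h2 ht (u i)) (ae_essInf_le_errVar hZ t)
  rw [errSq_succ hZ hF hN hO hW heig hγ h2 ht]
  have h3 := mul_le_mul_of_nonneg_left
    (sigmaG2_le (σlo := σlo) hZ hF heig h2 (by omega : t < N)) (hF.lam_nonneg heig i)
  have h4 := mul_le_mul_of_nonneg_left h (sq_nonneg γ)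
  have h5 := mul_le_mul_of_nonneg_left h3 (sq_nonneg γ)
  simp only [errSq]
  linarith

variable {εp εp' εa εa' εo εo' : ℝ} (hp : q.Qp.IsMultiplicative εp εp')
  (ha : q.Qa.IsMultiplicative εa εa') (ho : q.Qo.IsMultiplicative εo εo')

include hZ hF hN hp ha ho in
-- Induction from v_0 = 0; the upper multiplicative bounds keep each step in L².
theorem finiteSecondMoments_of_isMultiplicative (N : ℕ) : FiniteSecondMoments q S P γ Z N := by
  have h1 : ∀ t j, MemLp (fun ω => iterate q S γ Z t ω j) 2 P := fun t => by
    induction t with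
    | zero => intro j; exact memLp_const 0
    | succ t ih =>
      intro j
      exact (identDistrib_lift hZ (f := fun y => step q S γ y.1 y.2 j)
        (measurable_pi_iff.1 (measurable_step_uncurry γ) j)).memLp_iff.2
        (memLp_step_of_isMultiplicative hF hN (measurable_iterate hZ t) ih hp ha ho γ j)
  refine fun t _ j => ⟨h1 t j, ?_⟩
  exact (identDistrib_lift hZ (f := fun y => qparam q y.1 y.2 j)
    (measurable_pi_iff.1 measurable_qparam_uncurry j)).memLp_iff.2
    (memLp_qparam_of_isMultiplicative (measurable_iterate hZ t) (h1 t) hp j)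

include hZ hF hN hO hW heig hp ha ho in
theorem errSq_succ_ge_of_isMultiplicative (hγ : 0 < γ) (hεa : 0 ≤ εa) (hεo : 0 ≤ εo) {t : ℕ}
    (ht : t + 1 < N) (i : Fin M) :
    (1 - γ * lam i) ^ 2 * errSq q S P γ Z vstar u t i + γ ^ 2 * lam i *
      (β * ∑ j, lam j * errSq q S P γ Z vstar u t j + ((1 + εo) * σlo ^ 2 +
        β * (1 + εo) * (εp + (1 + εp) * εa) * ∑ j, lam j * (errSq q S P γ Z vstar u t j +
          (u j ⬝ᵥ vstar) ^ 2 * (1 - 2 * (1 - γ * lam j) ^ t)))) ≤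
      errSq q S P γ Z vstar u (t + 1) i := by
  have h2 := finiteSecondMoments_of_isMultiplicative (γ := γ) hZ hF hN hp ha ho N
  have hL : ∀ j, MemLp (fun ω => iterate q S γ Z t ω j) 2 P := fun j => (h2 t (by omega) j).1
  have h := integral_sq_gradDot_ge_of_isMultiplicative hF hN hO hW heig (measurable_iterate hZ t)
    hL hp ha ho hεa hεo i
  simp only [integral_sq_dot_iterate hZ hF hN hO hW heig hγ h2 (by omega : t < N)] at h
  rw [errSq_succ hZ hF hN hO hW heig hγ h2 ht]
  have h4 := mul_le_mul_of_nonneg_left h (sq_nonneg γ)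
  simp only [errSq] at h4 ⊢
  linarith

end Main

end QuantSGD

theorem mainTheorem6
    {p : ℕ∞} {M : ℕ} {Θ Ω : Type*} [MeasurableSpace Θ] [MeasurableSpace Ω]
    (ν : MeasureTheory.Measure Θ) [MeasureTheory.IsProbabilityMeasure ν]
    (ρ : MeasureTheory.Measure ((QuantSGD.Coord p → ℝ) × ℝ)) [MeasureTheory.IsProbabilityMeasure ρ]
    (P : MeasureTheory.Measure Ω) [MeasureTheory.IsProbabilityMeasure P]
    (q : QuantSGD.Scheme p M ν) (S : Fin M × QuantSGD.Coord p → ℝ)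
    (Z : ℕ → Ω → QuantSGD.Round p Θ) (hZ : QuantSGD.IsSampling P ρ ν Z)
    (hS : QuantSGD.SketchConverges q S ρ)
    (α β : ℝ) (hfourth : QuantSGD.FourthMomentCondition q S ρ α β)
    (vstar : Fin M → ℝ) (hopt : QuantSGD.IsQuantOptimum q S ρ vstar)
    (σlo σhi : ℝ) (hnoise : QuantSGD.NoiseCondition q S ρ vstar σlo σhi)
    (hwell : QuantSGD.WellSpecified q S ρ vstar)
    (lam : Fin M → ℝ) (u : Fin M → (Fin M → ℝ))
    (heig : QuantSGD.IsEigenDecomposition (QuantSGD.Hf q S ρ) lam u)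
    (γ : ℝ) (hγ : 0 < γ) (hγlam : ∀ i, γ * lam i < 1)
    (N : ℕ) (hN : 500 < N) :
    -- general quantization
    (QuantSGD.FiniteSecondMoments q S P γ Z N →
      QuantSGD.biasLB lam u γ N vstar +
        (β / 1000 * QuantSGD.sigmaBias2 lam u γ N vstar * (QuantSGD.dEff lam γ N / N) +
          QuantSGD.sigmaG2 q S ρ P γ Z β σlo N / 50 * (QuantSGD.dEff lam γ N / N))
        ≤ QuantSGD.RN0 q S ρ P γ Z vstar N) ∧
    -- multiplicative quantization
    (∀ εp εp' εa εa' εo εo' : ℝ, 0 ≤ εp → 0 ≤ εa → 0 ≤ εo →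
      q.Qp.IsMultiplicative εp εp' → q.Qa.IsMultiplicative εa εa' →
      q.Qo.IsMultiplicative εo εo' →
      QuantSGD.biasLB lam u γ N vstar +
        ((1 + εo) * σlo ^ 2 / 50 * (QuantSGD.dEff lam γ N / N) +
          β * (1 + εo) * (εp + (1 + εp) * εa) * (QuantSGD.dEff lam γ N / N) *
            QuantSGD.pEff lam u γ β N vstar +
          β / 1000 * QuantSGD.sigmaBias2 lam u γ N vstar * (QuantSGD.dEff lam γ N / N))
        ≤ QuantSGD.RN0 q S ρ P γ Z vstar N) := by
  open QuantSGD in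
  have hlam := hfourth.lam_nonneg heig
  have hN0 : 0 < N := by omega
  have hNr : (0 : ℝ) < N := by exact_mod_cast hN0
  have hβ := hfourth.pos_beta.le
  have hd : 0 ≤ dEff lam γ N / N := by
    rw [dEff_eq heig.antitone hγ hN0]
    exact div_nonneg (Finset.sum_nonneg fun i _ => sq_nonneg _) hNr.le
  have hw := sum_weights_ge hN
  constructor
  · intro h2
    have hσ := sigmaG2_nonneg (σlo := σlo) hZ hfourth heig h2
    have hR := RN0_ge hZ hfourth hnoise hopt hwell heig hγ hγlam hN0 h2
    refine le_trans ?_ ((risk_ge_of_noise (u := u) (v := vstar) heig.antitone hlam hγ hγlam hN hβ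
      errSq_nonneg (F := fun _ => sigmaG2 q S ρ P γ Z β σlo N) (fun _ _ => hσ) errSq_zero
      fun t i ht => errSq_succ_ge hZ hfourth hnoise hopt hwell heig hγ h2 ht i).trans hR)
    refine add_le_add le_rfl (add_le_add le_rfl (mul_le_mul_of_nonneg_right ?_ hd))
    -- Constant noise: the weights sum to at least (16/50)N³, and division by 16N³ leaves 1/50.
    rw [← Finset.mul_sum, le_div_iff₀ (by positivity)]
    have := mul_le_mul_of_nonneg_left hw hσ
    linarith
  · intro εp εp' εa εa' εo εo' hεp hεa hεo hp ha ho
    have h2 := finiteSecondMoments_of_isMultiplicative (γ := γ) hZ hfourth hnoise hp ha ho N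
    have hR := RN0_ge hZ hfourth hnoise hopt hwell heig hγ hγlam hN0 h2
    have hκ : 0 ≤ β * (1 + εo) * (εp + (1 + εp) * εa) := by positivity
    set V : ℕ → ℝ := fun t => ∑ j, lam j * (errSq q S P γ Z vstar u t j +
      (u j ⬝ᵥ vstar) ^ 2 * (1 - 2 * (1 - γ * lam j) ^ t)) with hV
    have hV0 : ∀ r < N, 0 ≤ V r := fun r hr => Finset.sum_nonneg fun j _ => by
      rw [← integral_sq_dot_iterate hZ hfourth hnoise hopt hwell heig hγ h2 hr]
      exact mul_nonneg (hlam j) (MeasureTheory.integral_nonneg fun _ => sq_nonneg _)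
    have hFr : ∀ r < N, 0 ≤ (1 + εo) * σlo ^ 2 + β * (1 + εo) * (εp + (1 + εp) * εa) * V r :=
      fun r hr => add_nonneg (by positivity) (mul_nonneg hκ (hV0 r hr))
    have hrec : ∀ t i, t + 1 < N → (1 - γ * lam i) ^ 2 * errSq q S P γ Z vstar u t i +
        γ ^ 2 * lam i * (β * ∑ j, lam j * errSq q S P γ Z vstar u t j + ((1 + εo) * σlo ^ 2 +
          β * (1 + εo) * (εp + (1 + εp) * εa) * V t)) ≤ errSq q S P γ Z vstar u (t + 1) i :=
      fun t i ht => errSq_succ_ge_of_isMultiplicative hZ hfourth hnoise hopt hwell heig hp ha ho hγ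
        hεa hεo ht i
    -- First pass of the bootstrap: the initial error alone.
    have hlow : ∀ t < N, ∀ i, (1 - γ * lam i) ^ (2 * t) * (u i ⬝ᵥ vstar) ^ 2 ≤
        errSq q S P γ Z vstar u t i := fun t ht i => by
      simpa using iterate_ge hlam hγlam hγ (G := fun _ => 0) (fun _ => le_rfl)
        (fun r hr => add_nonneg (mul_nonneg hβ (Finset.sum_nonneg fun j _ =>
          mul_nonneg (hlam j) (errSq_nonneg r j))) (hFr r (by omega))) errSq_zero hrec t ht i
    -- Second pass: the noise generated by the surviving initial error, bounded by `hlow`, is fed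
    -- back into the recursion.
    have hsig := sum_signal_weights_ge (w := fun i => u i ⬝ᵥ vstar)
      (c := errSq q S P γ Z vstar u) hlam hγ hγlam hβ hN fun t ht i =>
        iterate_ge hlam hγlam hγ
          (G := fun r => β * ∑ j, lam j * ((1 - γ * lam j) ^ (2 * r) * (u j ⬝ᵥ vstar) ^ 2))
          (fun r => mul_nonneg hβ (Finset.sum_nonneg fun j _ => mul_nonneg (hlam j)
            (mul_nonneg (pow_nonneg (by linarith [hγlam j]) _) (sq_nonneg _))))
          (fun r hr => le_add_of_le_of_nonneg (mul_le_mul_of_nonneg_left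
            (Finset.sum_le_sum fun j _ => mul_le_mul_of_nonneg_left (hlow r (by omega) j)
              (hlam j)) hβ) (hFr r (by omega))) errSq_zero hrec t ht i
    rw [← pEff_eq heig.antitone hγ hN0 vstar heig.orthonormal] at hsig
    refine le_trans ?_ ((risk_ge_of_noise (u := u) (v := vstar) heig.antitone hlam hγ hγlam hN hβ
      errSq_nonneg hFr errSq_zero hrec).trans hR)
    have hsum : ((1 + εo) * σlo ^ 2 / 50 + β * (1 + εo) * (εp + (1 + εp) * εa) *
        pEff lam u γ β N vstar) * (16 * (N : ℝ) ^ 3) ≤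
        ∑ r ∈ Finset.range N, ((1 + εo) * σlo ^ 2 + β * (1 + εo) * (εp + (1 + εp) * εa) * V r) *
          (((N : ℝ) - 1 - r) * (N - r)) := by
      simp only [add_mul _ _ (((N : ℝ) - 1 - _) * (N - _)), Finset.sum_add_distrib]
      have h3 := mul_le_mul_of_nonneg_left hw (by positivity : 0 ≤ (1 + εo) * σlo ^ 2)
      have h4 := mul_le_mul_of_nonneg_left hsig hκ
      simp only [mul_assoc (β * (1 + εo) * (εp + (1 + εp) * εa)), ← Finset.mul_sum]
      linarith
    have hfin := mul_le_mul_of_nonneg_right ((le_div_iff₀ (by positivity)).2 hsum) hd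
    linarith
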